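/- Let $n,k$ be integers with $2\le k\le n-1$ and $[n]=\{1,\dots,n\}$. Let $\vec C_{n,1}$ be the set of directed trees on the vertex set $[n]$ with all edges directed towards the root $1$. A vertex $v$ (possibly the root) is a leaf if its degree (indegree plus outdegree) is $1$. Let $\vec C_{n,1}^{k}$ be the set of $T\in\vec C_{n,1}$ with exactly $k$ leaves and, for $L\subseteq[n]$ with $|L|=k$, let $\vec C_{n,1}^{k,L}$ be the set of $T\in\vec C_{n,1}$ whose set of leaves is $L$. Let $S(a,b)$ denote the Stirling numbers of the second kind. *The bijection $\Theta$.* Let $\mathcal F_n$ be the set of functions $f:\{2,\dots,n-1\}\to[n]$. If the cycles of the digraph $\{(i,f(i))\}$ of $f$ have maxima $m_1>\dots>m_a$, then $\Theta(f)$ arises from this digraph by deleting the edges $(m_i,f(m_i))$ and adding the edges $(n,f(m_1))$, $(m_i,f(m_{i+1}))$ for $1\le i<a$, and $(m_a,1)$ (only the edge $(n,1)$ is added if $a=0$). Then $\Theta$ is a bijection $\mathcal F_n\to\vec C_{n,1}$. *The sequences.* For $f\in\mathcal F_n$ let $\mathrm{Seq}(f)=(g,h,s)$, where: $g$ lists the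 $i\in[n]$ with $f^{-1}(i)=\emptyset$ in decreasing order (there are $k$ of them if $\Theta(f)\in\vec C^k_{n,1}$); with $i_1<\dots<i_{n-k}$ the other elements of $[n]$, $\pi_j=\{x\in[n-2]: f(x+1)=i_j\}$, $\Gamma_1,\dots,\Gamma_{n-k}$ the sets $\pi_j$ listed by increasing minimum, and $\sigma$ the permutation with $\pi_j=\Gamma_{\sigma_j}$, $h$ is the direct insertion sequence of $\sigma$ (for $\sigma=\sigma_1\cdots\sigma_N$ it is $\sigma_1-1$ followed by the direct insertion sequence of the permutation obtained from $\sigma_2\cdots\sigma_N$ by lowering the entries $>\sigma_1$ by $1$), and $s(x)=j-1$ for $x\in\Gamma_j$, $x\in[n-2]$. Let $\mathrm{rank}_{DF}$, $\mathrm{rank}_{IO}$, $\mathrm{rank}_{RG}$ be the lexicographic ranks (number of smaller elements) in, respectively, the set of decreasing sequences of length $k$ in $[n]$, the set of direct insertion sequences of permutations of $[n-k]$, and the set of restricted growth functions from $[n-2]$ onto $\{0,\dots,n-k-1\}$. *(1) Ranking.* We have $|\vec C^k_{n,1}|=\binom nk (n-k)!\,S(n-2,n-k)$, and with $(g,h,s)=\mathrm{Seq}(\Theta^{-1}(T))$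 the map $$T\mapsto \mathrm{rank}(T)=\mathrm{rank}_{DF}(g)\,(n-k)!\,S(n-2,n-k)+\mathrm{rank}_{IO}(h)\,S(n-2,n-k)+\mathrm{rank}_{RG}(s)$$ is a bijection from $\vec C^k_{n,1}$ onto $\{0,\dots,|\vec C^k_{n,1}|-1\}$; $\mathrm{rank}(T)$ is the number of $T'\in\vec C^k_{n,1}$ for which $\mathrm{Seq}(\Theta^{-1}(T'))$ precedes $\mathrm{Seq}(\Theta^{-1}(T))$ lexicographically. *(2) Unranking.* The inverse map is given by the following procedure. Given $r$, write $r=r_1(n-k)!\,S(n-2,n-k)+r_2S(n-2,n-k)+r_3$ by successive division with remainder. Find $g$ with rank $r_1$ greedily: for $t=1,\dots,k$, $g(t)-1$ is the largest $y$ with $\binom y{k-t+1}\le r_1$, and $r_1$ is replaced by $r_1-\binom{g(t)-1}{k-t+1}$. Find $h$ with rank $r_2$ by successive divisions with remainder by $(n-k-1)!,(n-k-2)!,\dots,0!$. Let $E^{(K)}(0,m)=1$ if $m=K-1$ and $0$ otherwise, $E^{(K)}(j,m)=(m+1)E^{(K)}(j-1,m)+E^{(K)}(j-1,m+1)$, and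 $K=n-k$. Find $s$ with rank $r_3$ greedily: $s(1)=0$, and for $t=n-4,\dots,0$ (that is, $t$ entries come after the next one) with $m$ the maximum of the entries found so far, the next entry is the largest $a\le m+1$ with $aE^{(K)}(t,m)\le r_3$, and $r_3$ is replaced by $r_3-aE^{(K)}(t,m)$. Reconstruct the $f$ with $\mathrm{Seq}(f)=(g,h,s)$: if $i_1<\dots<i_{n-k}$ are the elements of $[n]$ not in $g$ and $\sigma$ is the permutation with direct insertion sequence $h$, then $f(x)=i_j$ where $\sigma_j=s(x-1)+1$. Output $\Theta(f)$. *(3) Fixed leaf set.* For every $L\subseteq[n]$ with $|L|=k$ we have $|\vec C^{k,L}_{n,1}|=(n-k)!\,S(n-2,n-k)$, the map $T\mapsto \mathrm{rank}_{IO}(h)\,S(n-2,n-k)+\mathrm{rank}_{RG}(s)$ is a bijection from $\vec C^{k,L}_{n,1}$ onto $\{0,\dots,|\vec C^{k,L}_{n,1}|-1\}$ and is the lexicographic rank in $\vec C^{k,L}_{n,1}$, and the procedure of (2) with $g$ prescribed as the decreasing listing of $L$, and $r=r_2S(n-2,n-k)+r_3$, is its inverse. *(4) Complexity.* Assume that tables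 of the binomial coefficients and of the numbers $E^{(n-k)}(t,m)$ are available. There are fixed programs of a random access machine that compute these four maps (the two rankings and the two unrankings), trees being given and returned as lists of pairs $\langle i,j\rangle$, one for each edge $(i,j)$, and a constant $C$ independent of $n,k,L$, such that for all inputs at most $Cn^2$ operations (comparisons, and also additions, subtractions, assignments and array accesses) on numbers $\le n$ and at most $Cn$ operations on big numbers (addition, subtraction, multiplication, division, comparison, and also copying, conversion and table look-up) are carried out, all big numbers being at most $|\vec C^k_{n,1}|$ (respectively $|\vec C^{k,L}_{n,1}|$). -/

import Mathlib

open Finset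

namespace LeafTrees

/-! ### Digraphs on `[n] = {1, …, n}`, given by their sets of directed edges -/

/-- The number of edges of `E` that end in `v`. -/
def indeg (E : Finset (ℕ × ℕ)) (v : ℕ) : ℕ := (E.filter (fun e => e.2 = v)).card

/-- The number of edges of `E` that start in `v`. -/
def outdeg (E : Finset (ℕ × ℕ)) (v : ℕ) : ℕ := (E.filter (fun e => e.1 = v)).card

/-- The degree of `v`, as in the underlying undirected graph. -/
def deg (E : Finset (ℕ × ℕ)) (v : ℕ) : ℕ := indeg E v + outdeg E v

/-- Directed trees with vertex set `[n]` that are rooted at `1`, all edges being directed towards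
the root: no edge leaves `1`, exactly one edge leaves every other vertex, and every vertex has a
directed path to `1`. -/
def trees (n : ℕ) : Set (Finset (ℕ × ℕ)) :=
  {E | E ⊆ Icc 1 n ×ˢ Icc 1 n ∧
    (∀ w, (1, w) ∉ E) ∧
    (∀ v ∈ Icc 2 n, ∃! w, (v, w) ∈ E) ∧
    ∀ v ∈ Icc 1 n, Relation.ReflTransGen (fun a b => (a, b) ∈ E) v 1}

/-- The set of leaves: the vertices of degree one (the root `1` may be a leaf). -/
def leaves (n : ℕ) (E : Finset (ℕ × ℕ)) : Finset ℕ := (Icc 1 n).filter (fun v => deg E v = 1)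

/-- The trees with exactly `k` leaves. -/
def treesWithLeafCount (n k : ℕ) : Set (Finset (ℕ × ℕ)) := {E ∈ trees n | (leaves n E).card = k}

/-- The trees whose set of leaves is `L`. -/
def treesWithLeafSet (n : ℕ) (L : Finset ℕ) : Set (Finset (ℕ × ℕ)) :=
  {E ∈ trees n | leaves n E = L}

/-! ### The Eğecioğlu–Remmel bijection -/

/-- The functions `f : {2, …, n-1} → [n]`, extended by the value `0` (which is not a vertex)
outside of their domain. -/
def functions (n : ℕ) : Set (ℕ → ℕ) :=
  {f | (∀ i ∈ Icc 2 (n - 1), f i ∈ Icc 1 n) ∧ ∀ i, i ∉ Icc 2 (n - 1) → f i = 0}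

/-- The digraph of a function. -/
def graph (n : ℕ) (f : ℕ → ℕ) : Finset (ℕ × ℕ) := (Icc 2 (n - 1)).image (fun i => (i, f i))

/-- The set `{f v, f (f v), …}`. (There are at most `n` vertices, so that `n` iterations are enough.
An iteration that reaches `1` or `n` continues with `0`.) -/
def iterates (n : ℕ) (f : ℕ → ℕ) (v : ℕ) : Finset ℕ := (Icc 1 n).image (fun j => f^[j] v)

/-- The maximal elements `m₁ > m₂ > ⋯ > m_a` of the cycles of `f`: the `v` to which iteration of
`f` returns, without passing through a larger vertex. -/
def cycleMaxima (n : ℕ) (f : ℕ → ℕ) : Finset ℕ :=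
  (Icc 2 (n - 1)).filter (fun v => (iterates n f v).max = v)

/-- The left endpoint `f m` of the cycle with the largest maximum `m` below `v`,
and `1` if there is no such cycle. Every cycle is drawn as the path `f m, f (f m), …, m`
with the back edge `(m, f m)`. -/
def nextLeft (n : ℕ) (f : ℕ → ℕ) (v : ℕ) : ℕ :=
  if h : ((cycleMaxima n f).filter (fun m => m < v)).Nonempty then
    f (((cycleMaxima n f).filter (fun m => m < v)).max' h)
  else 1

/-- The map `Θ`: the back edges `(mᵢ, f mᵢ)` of the cycles are deleted; `n` is joined to the
left endpoint of the first cycle, the right endpoint `mᵢ` of each cycle to the left endpoint of the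
next one, and the right endpoint of the last cycle to `1` (if there are no cycles, `n` is joined
to `1`). -/
def Theta (n : ℕ) (f : ℕ → ℕ) : Finset (ℕ × ℕ) :=
  (graph n f \ (cycleMaxima n f).image (fun m => (m, f m))) ∪
    (insert n (cycleMaxima n f)).image (fun v => (v, nextLeft n f v))

/-- The inverse of `Θ`. -/
noncomputable def ThetaInv (n : ℕ) : Finset (ℕ × ℕ) → (ℕ → ℕ) :=
  Function.invFunOn (Theta n) (functions n)

/-! ### The sequences `Seq(f) = (g, h, s)` -/

/-- The set of `i ∈ [n]` with empty preimage. -/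
def missing (n : ℕ) (f : ℕ → ℕ) : Finset ℕ := Icc 1 n \ (Icc 2 (n - 1)).image f

/-- The ordered set partition `π` of `[n-2]`: its parts are the nonempty preimages
`f⁻¹(i₁), f⁻¹(i₂), …` with `i₁ < i₂ < ⋯`, all elements being lowered by one. -/
def orderedParts (n : ℕ) (f : ℕ → ℕ) : List (Finset ℕ) :=
  ((Icc 1 n \ missing n f).sort (· ≤ ·)).map
    (fun i => (Icc 1 (n - 2)).filter (fun x => f (x + 1) = i))

/-- The parts `Γ₁, Γ₂, …` of `π`, listed by increasing minimum. -/
def sortedParts (n : ℕ) (f : ℕ → ℕ) : List (Finset ℕ) :=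
  (orderedParts n f).insertionSort (fun A B => A.min ≤ B.min)

/-- The permutation `σ` (in one-line notation) with `πⱼ = Γ_{σⱼ}`. -/
def partPerm (n : ℕ) (f : ℕ → ℕ) : List ℕ :=
  (orderedParts n f).map (fun A => (sortedParts n f).idxOf A + 1)

/-- The direct insertion sequence of a permutation in one-line notation. -/
def insertionSeq : List ℕ → List ℕ
  | [] => []
  | j :: l => (j - 1) :: insertionSeq (l.map (fun i => if j < i then i - 1 else i))
termination_by l => l.length
decreasing_by simp

/-- The decreasing sequence `g` of the elements with empty preimage. -/
def seqG (n : ℕ) (f : ℕ → ℕ) : List ℕ := (missing n f).sort (· ≥ ·)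

/-- The insertion sequence `h` of the permutation `σ`. -/
def seqH (n : ℕ) (f : ℕ → ℕ) : List ℕ := insertionSeq (partPerm n f)

/-- The restricted growth sequence `s`: `s(x) = j - 1` where `x ∈ Γⱼ`, for `x = 1, …, n-2`. -/
def seqS (n : ℕ) (f : ℕ → ℕ) : List ℕ :=
  (List.range' 1 (n - 2)).map (fun x => (sortedParts n f).findIdx (fun A => decide (x ∈ A)))

/-- The concatenation of the three sequences (whose lengths depend on `n` and `k` only). -/
def seqAll (n : ℕ) (f : ℕ → ℕ) : List ℕ := seqG n f ++ (seqH n f ++ seqS n f)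

/-! ### Ranks -/

/-- Decreasing functions `{1, …, k} → {1, …, n}`, as sequences. -/
def decreasingSeqs (n k : ℕ) : Set (List ℕ) :=
  {g | g.length = k ∧ g.Pairwise (· > ·) ∧ ∀ x ∈ g, x ∈ Icc 1 n}

/-- Insertion sequences of the permutations of `[N]`. -/
def insertionSeqs (N : ℕ) : Set (List ℕ) :=
  {h | ∃ σ : List ℕ, σ.Perm (List.range' 1 N) ∧ insertionSeq σ = h}

/-- Restricted growth functions from `[n]` onto `{0, …, k-1}`, as sequences: `s(1) = 0`,
and `s(i) ≤ 1 + max {s(1), …, s(i-1)}` for `i > 1`. -/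
def growthSeqs (n k : ℕ) : Set (List ℕ) :=
  {s | s.length = n ∧ s.getD 0 0 = 0 ∧
    (∀ i, 0 < i → i < n → ∃ j < i, s.getD i 0 ≤ 1 + s.getD j 0) ∧
    s.toFinset = range k}

/-- The rank of `x` in `S` in lexicographic order: the number of elements of `S` before `x`. -/
noncomputable def lexRank (S : Set (List ℕ)) (x : List ℕ) : ℕ := {y ∈ S | y < x}.ncard

/-- The rank of a tree with `k` leaves and prescribed leaf set. -/
noncomputable def rankLeafSet (n k : ℕ) (T : Finset (ℕ × ℕ)) : ℕ :=
  lexRank (insertionSeqs (n - k)) (seqH n (ThetaInv n T)) * Nat.stirlingSecond (n - 2) (n - k)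
    + lexRank (growthSeqs (n - 2) (n - k)) (seqS n (ThetaInv n T))

/-- The rank of a tree with `k` leaves. -/
noncomputable def rankLeafCount (n k : ℕ) (T : Finset (ℕ × ℕ)) : ℕ :=
  lexRank (decreasingSeqs n k) (seqG n (ThetaInv n T))
      * ((n - k).factorial * Nat.stirlingSecond (n - 2) (n - k))
    + lexRank (insertionSeqs (n - k)) (seqH n (ThetaInv n T)) * Nat.stirlingSecond (n - 2) (n - k)
    + lexRank (growthSeqs (n - 2) (n - k)) (seqS n (ThetaInv n T))

/-! ### Unranking procedures -/

/-- Unranking of decreasing sequences `f(1), …, f(k)`: `f(1) - 1` is the largest `y` with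
`y.choose k ≤ m`, and one continues with `k - 1` and `m - (f(1) - 1).choose k`.
(All `y` with `y.choose (k + 1) ≤ m` satisfy `y ≤ m + k`.) -/
def unrankDecreasing : ℕ → ℕ → List ℕ
  | 0, _ => []
  | k + 1, m =>
    (Nat.findGreatest (fun y => y.choose (k + 1) ≤ m) (m + k) + 1) ::
      unrankDecreasing k
        (m - (Nat.findGreatest (fun y => y.choose (k + 1) ≤ m) (m + k)).choose (k + 1))

/-- Unranking of insertion sequences by successive divisions by factorials. -/
def unrankInsertion : ℕ → ℕ → List ℕ
  | 0, _ => []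
  | N + 1, p => (p / N.factorial) :: unrankInsertion N (p % N.factorial)

/-- The numbers `E^{(K)}(j, m)` of ways to extend a restricted growth sequence with maximum `m`
by `j` further entries to one that is onto `{0, …, K-1}`. -/
def extensionCount (K : ℕ) : ℕ → ℕ → ℕ
  | 0, m => if m + 1 = K then 1 else 0
  | j + 1, m => (m + 1) * extensionCount K j m + extensionCount K j (m + 1)

/-- The last `t` entries of the restricted growth sequence to be found, when the previous entries
have maximum `m` and the remaining rank is `r`: the next entry is the largest `a ≤ m + 1` with
`a * E^{(K)}(t-1, m) ≤ r`. -/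
def unrankGrowthAux (K : ℕ) : ℕ → ℕ → ℕ → List ℕ
  | 0, _, _ => []
  | t + 1, m, r =>
    Nat.findGreatest (fun a => a * extensionCount K t m ≤ r) (m + 1) ::
      unrankGrowthAux K t
        (max m (Nat.findGreatest (fun a => a * extensionCount K t m ≤ r) (m + 1)))
        (r - Nat.findGreatest (fun a => a * extensionCount K t m ≤ r) (m + 1)
          * extensionCount K t m)

/-- Unranking of restricted growth functions from `[n]` onto `{0, …, K-1}`. -/
def unrankGrowth (n K r : ℕ) : List ℕ := 0 :: unrankGrowthAux K (n - 1) 0 r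

/-- The permutation with a given direct insertion sequence. -/
def permOfInsertion : List ℕ → List ℕ
  | [] => []
  | a :: h => (a + 1) :: (permOfInsertion h).map (fun i => if a + 1 ≤ i then i + 1 else i)

/-- The function `f` with `Seq(f) = (g, h, s)`: if `i₁ < i₂ < ⋯` are the elements of `[n]` that do
not occur in `g` and `σ` is the permutation given by `h`, then `f x = iⱼ` for the `j` with
`σⱼ = s(x - 1) + 1`. -/
def ofSeq (n : ℕ) (g h s : List ℕ) : ℕ → ℕ := fun x =>
  if x ∈ Icc 2 (n - 1) then
    ((Icc 1 n \ g.toFinset).sort (· ≤ ·)).getD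
      ((permOfInsertion h).idxOf (s.getD (x - 2) 0 + 1)) 0
  else 0

/-- The unranking procedure for trees with `k` leaves and leaf set `L`. -/
def unrankLeafSet (n k : ℕ) (L : Finset ℕ) (r : ℕ) : Finset (ℕ × ℕ) :=
  Theta n (ofSeq n (L.sort (· ≥ ·))
    (unrankInsertion (n - k) (r / Nat.stirlingSecond (n - 2) (n - k)))
    (unrankGrowth (n - 2) (n - k) (r % Nat.stirlingSecond (n - 2) (n - k))))

/-- The unranking procedure for trees with `k` leaves. -/
def unrankLeafCount (n k r : ℕ) : Finset (ℕ × ℕ) :=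
  let S := Nat.stirlingSecond (n - 2) (n - k)
  let M := (n - k).factorial * S
  Theta n (ofSeq n (unrankDecreasing k (r / M))
    (unrankInsertion (n - k) (r % M / S))
    (unrankGrowth (n - 2) (n - k) (r % M % S)))

/-! ### A machine model that counts small and big operations

A random access machine has small registers and arrays (`reg`, `arr`), which hold numbers
`≤ n`, and big registers and arrays (`breg`, `barr`), which hold numbers up to a larger bound.
All arrays are addressed by the contents of small registers; register and array names are fixed by
the program. Tables of the binomial coefficients and of the numbers `E^{(n-k)}(t, m)` can be read. -/

/-- The memory of the machine. -/
structure Memory where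
  reg : ℕ → ℕ
  arr : ℕ → ℕ → ℕ
  breg : ℕ → ℕ
  barr : ℕ → ℕ → ℕ

/-- Every small cell holds a number `≤ n`, every big cell a number `≤ N`. -/
def Memory.Bounded (n N : ℕ) (M : Memory) : Prop :=
  (∀ x, M.reg x ≤ n) ∧ (∀ a i, M.arr a i ≤ n) ∧ (∀ X, M.breg X ≤ N) ∧ ∀ A i, M.barr A i ≤ N

/-- Arithmetic operations (on natural numbers). -/
inductive BinOp
  | add | sub | mul | div

/-- The value of an operation; subtraction and division are those of `ℕ`. -/
def BinOp.eval : BinOp → ℕ → ℕ → ℕ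
  | .add, x, y => x + y
  | .sub, x, y => x - y
  | .mul, x, y => x * y
  | .div, x, y => x / y

/-- Operations on small cells. -/
inductive SmallInstr
  /-- `reg x := c` -/
  | const (x c : ℕ)
  /-- `reg x := reg y` -/
  | move (x y : ℕ)
  /-- `reg x := reg y + reg z` -/
  | add (x y z : ℕ)
  /-- `reg x := reg y - reg z` -/
  | sub (x y z : ℕ)
  /-- `reg x := arr a [reg i]` -/
  | load (x a i : ℕ)
  /-- `arr a [reg i] := reg x` -/
  | store (a i x : ℕ)

/-- Operations that involve big cells. -/
inductive BigInstr
  /-- `breg X := breg Y ∘ breg Z` -/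
  | arith (op : BinOp) (X Y Z : ℕ)
  /-- `breg X := reg x` -/
  | ofSmall (X x : ℕ)
  /-- `reg x := breg X` -/
  | toSmall (x X : ℕ)
  /-- `breg X := barr A [reg i]` -/
  | load (X A i : ℕ)
  /-- `barr A [reg i] := breg X` -/
  | store (A i X : ℕ)
  /-- `breg X :=` the binomial coefficient `reg y` over `reg z` (table look-up) -/
  | binomial (X y z : ℕ)
  /-- `breg X := E^{(K)}(reg t, reg m)` (table look-up) -/
  | extension (X t m : ℕ)

/-- The effect of an operation on small cells. -/
def SmallInstr.exec : SmallInstr → Memory → Memory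
  | .const x c, M => { M with reg := Function.update M.reg x c }
  | .move x y, M => { M with reg := Function.update M.reg x (M.reg y) }
  | .add x y z, M => { M with reg := Function.update M.reg x (M.reg y + M.reg z) }
  | .sub x y z, M => { M with reg := Function.update M.reg x (M.reg y - M.reg z) }
  | .load x a i, M => { M with reg := Function.update M.reg x (M.arr a (M.reg i)) }
  | .store a i x, M =>
    { M with arr := Function.update M.arr a (Function.update (M.arr a) (M.reg i) (M.reg x)) }

/-- The effect of an operation on big cells; `K` is the parameter of the table of the numbers
`E^{(K)}(t, m)`. -/
def BigInstr.exec (K : ℕ) : BigInstr → Memory → Memory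
  | .arith op X Y Z, M =>
    { M with breg := Function.update M.breg X (op.eval (M.breg Y) (M.breg Z)) }
  | .ofSmall X x, M => { M with breg := Function.update M.breg X (M.reg x) }
  | .toSmall x X, M => { M with reg := Function.update M.reg x (M.breg X) }
  | .load X A i, M => { M with breg := Function.update M.breg X (M.barr A (M.reg i)) }
  | .store A i X, M =>
    { M with barr := Function.update M.barr A (Function.update (M.barr A) (M.reg i) (M.breg X)) }
  | .binomial X y z, M =>
    { M with breg := Function.update M.breg X ((M.reg y).choose (M.reg z)) }
  | .extension X t m, M =>
    { M with breg := Function.update M.breg X (extensionCount K (M.reg t) (M.reg m)) }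

/-- Tests: comparisons of two small or of two big registers. -/
inductive Test
  /-- `reg x < reg y` -/
  | small (x y : ℕ)
  /-- `breg X < breg Y` -/
  | big (X Y : ℕ)

/-- The truth value of a test. -/
def Test.holds : Test → Memory → Prop
  | .small x y, M => M.reg x < M.reg y
  | .big X Y, M => M.breg X < M.breg Y

/-- The number of small operations in a test. -/
def Test.smallCost : Test → ℕ
  | .small _ _ => 1
  | .big _ _ => 0

/-- The number of big operations in a test. -/
def Test.bigCost : Test → ℕ
  | .small _ _ => 0
  | .big _ _ => 1

/-- Programs. -/
inductive Program
  | skip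
  | small (i : SmallInstr)
  | big (i : BigInstr)
  | comp (p q : Program)
  | cond (t : Test) (p q : Program)
  | loop (t : Test) (p : Program)

/-- `Runs n N K p M M' a b`: started in memory `M`, the program `p` halts in memory `M'` after
`a` small and `b` big operations (all instructions and all tests are counted), all values written
to small cells being `≤ n` and all values written to big cells being `≤ N`. -/
inductive Runs (n N K : ℕ) : Program → Memory → Memory → ℕ → ℕ → Prop
  | skip (M : Memory) : Runs n N K .skip M M 0 0
  | small (i : SmallInstr) (M : Memory) (h : (i.exec M).Bounded n N) :
      Runs n N K (.small i) M (i.exec M) 1 0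
  | big (i : BigInstr) (M : Memory) (h : (i.exec K M).Bounded n N) :
      Runs n N K (.big i) M (i.exec K M) 0 1
  | comp {p q : Program} {M M' M'' : Memory} {a b a' b' : ℕ} (hp : Runs n N K p M M' a b)
      (hq : Runs n N K q M' M'' a' b') : Runs n N K (.comp p q) M M'' (a + a') (b + b')
  | condTrue {t : Test} {p q : Program} {M M' : Memory} {a b : ℕ} (ht : t.holds M)
      (hp : Runs n N K p M M' a b) :
      Runs n N K (.cond t p q) M M' (t.smallCost + a) (t.bigCost + b)
  | condFalse {t : Test} {p q : Program} {M M' : Memory} {a b : ℕ} (ht : ¬ t.holds M)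
      (hq : Runs n N K q M M' a b) :
      Runs n N K (.cond t p q) M M' (t.smallCost + a) (t.bigCost + b)
  | loopTrue {t : Test} {p : Program} {M M' M'' : Memory} {a b a' b' : ℕ} (ht : t.holds M)
      (hp : Runs n N K p M M' a b) (hl : Runs n N K (.loop t p) M' M'' a' b') :
      Runs n N K (.loop t p) M M'' (t.smallCost + a + a') (t.bigCost + b + b')
  | loopFalse {t : Test} {p : Program} {M : Memory} (ht : ¬ t.holds M) :
      Runs n N K (.loop t p) M M t.smallCost t.bigCost

/-- The array `A` stores the tree `T` as the list of pairs `⟨i, A i⟩`, `i = 2, …, n`. -/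
def Stores (n : ℕ) (A : ℕ → ℕ) (T : Finset (ℕ × ℕ)) : Prop := ∀ i ∈ Icc 2 n, (i, A i) ∈ T

/-- The array that stores a tree `T` in the cells `2, …, n` (there is only one edge `(i, j)` for
each such `i`, so that the sum is just `j`) and is `0` elsewhere. -/
def treeArray (T : Finset (ℕ × ℕ)) : ℕ → ℕ := fun i => ∑ e ∈ T.filter (fun e => e.1 = i), e.2

/-- The array whose cells `1, …, k` contain the elements `l₁ < ⋯ < l_k` of `L`, and `0`
elsewhere. -/
def setArray (L : Finset ℕ) : ℕ → ℕ := fun i =>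
  if i = 0 then 0 else (L.sort (· ≤ ·)).getD (i - 1) 0

/-- The initial memory: `n` and `k` are in the small registers `0` and `1`, a number `r` is in the
big register `0`, and an array `A` is given as small array `0`; all other cells are `0`. -/
def input (n k r : ℕ) (A : ℕ → ℕ) : Memory where
  reg := fun x => if x = 0 then n else if x = 1 then k else 0
  arr := fun a i => if a = 0 then A i else 0
  breg := fun X => if X = 0 then r else 0
  barr := fun _ _ => 0

/-- The number `f(T)` is computed in big register `0`, from the list of edges of `T`, with at most
`C n²` small and `C n` big operations on numbers `≤ n` and `≤ N`, respectively. -/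
def Ranks (p : Program) (C n k N : ℕ) (f : Finset (ℕ × ℕ) → ℕ) (T : Finset (ℕ × ℕ)) : Prop :=
  ∃ (M : Memory) (a b : ℕ), Runs n N (n - k) p (input n k 0 (treeArray T)) M a b ∧
    M.breg 0 = f T ∧ a ≤ C * n ^ 2 ∧ b ≤ C * n

/-- The list of edges of the tree `f(r)` is computed in small array `0`, from the number `r` and
an array `A`, with at most `C n²` small and `C n` big operations on numbers `≤ n` and `≤ N`,
respectively. -/
def Unranks (p : Program) (C n k N : ℕ) (A : ℕ → ℕ) (f : ℕ → Finset (ℕ × ℕ)) (r : ℕ) : Prop :=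
  ∃ (M : Memory) (a b : ℕ), Runs n N (n - k) p (input n k r A) M a b ∧
    Stores n (M.arr 0) (f r) ∧ a ≤ C * n ^ 2 ∧ b ≤ C * n

end LeafTrees

open LeafTrees

namespace LeafTrees

/-! ### Ranking systems -/

/-! `Θ` writes each cycle of `f` as a path ending in the maximum of the cycle and strings these
paths together, with decreasing maxima, between `n` and `1`. The maxima can be read off the tree
again. Every vertex of a segment is bounded by the maximum that ends it, so on the path from `n` to
the root the maxima are exactly the inner vertices larger than everything after them
(`records_thetaParent`). Cutting the path of an arbitrary tree behind these records and closing the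
pieces up gives the inverse (`cycleMaxima_thetaInvFun`, `thetaParent_thetaInvFun`). The relinking
only redistributes the targets of the edges that leave the maxima and adds one edge into `1`. A
vertex other than the root is therefore a leaf iff it is not a value of `f`, and the root, which has
received one extra incoming edge, is a leaf iff `1` is not a value (`leaves_Theta`).

A tree with leaf set `L`, `|L| = k`, is thus a function with set of values `[n] \ L`, that is, a
partition of its `n - 2` arguments into `K = n - k` blocks, assigned bijectively to these values.
Numbering the values by first occurrence (`label`) separates the unordered partition, coded by the
restricted growth sequence `s`, from the assignment, a permutation coded by `h`; the set `L` itself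
is `g`. The three codes can be chosen independently (`ofSeq_spec`, `ofSeq_seq`). Their lengths are
fixed, so the lexicographic order of the concatenation is the lexicographic order of triples, and
the rank is a three-digit number in mixed radix. The digits come from the combinatorial number
system, from the factorial number system, and from the counts `E`, for which `E(n - 3, 0) = S(n - 2,
K)` (`extensionCount_zero`). In each case an order-preserving map into an initial segment of `ℕ`
with a right inverse is enough. Bijectivity, cardinality and the interpretation as a number of
predecessors follow formally from `RankSystem`.

For the complexity, programs are built from loops over `0, …, n - 1` only. The operation counts are
then bounded by the size of the text times `n` to the nesting depth, which is at most two in general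
and at most one for loops containing big operations; these are finite checks. Correctness is proved
with weakest preconditions and loop invariants (`reaches_of_wp`), which also record that no cell
exceeds its bound. Partial results of a Horner scheme are at most its final value, and table entries
are only consulted where they are at most the first one consulted. A single quadratic device,
walking from a vertex to the first vertex that is not smaller, detects both records and cycle
maxima. -/

/-- A ranking function `φ` of the elements of `S`, ordered lexicographically by their keys, together
with an unranking function `ψ`. -/
structure RankSystem {α : Type*} (S : Set α) (key : α → List ℕ) (N : ℕ) (φ : α → ℕ) (ψ : ℕ → α) :
    Prop where
  inj : Set.InjOn key S
  lt : ∀ x ∈ S, φ x < N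
  mono : ∀ x ∈ S, ∀ y ∈ S, key x < key y → φ x < φ y
  mem : ∀ r < N, ψ r ∈ S
  right_inv : ∀ r < N, φ (ψ r) = r

namespace RankSystem

variable {α : Type*} {S : Set α} {key : α → List ℕ} {N : ℕ} {φ : α → ℕ} {ψ : ℕ → α}

theorem injOn (h : RankSystem S key N φ ψ) : Set.InjOn φ S := by
  intro x hx y hy hxy
  apply h.inj hx hy
  rcases lt_trichotomy (key x) (key y) with h1 | h1 | h1
  · have := h.mono x hx y hy h1; omega
  · exact h1
  · have := h.mono y hy x hx h1; omega

theorem bijOn (h : RankSystem S key N φ ψ) : Set.BijOn φ S (Set.Iio N) :=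
  ⟨fun x hx => h.lt x hx, h.injOn, fun r hr => ⟨ψ r, h.mem r hr, h.right_inv r hr⟩⟩

theorem ncard_Iio (N : ℕ) : (Set.Iio N).ncard = N := by
  rw [Set.ncard_eq_toFinset_card']; simp

theorem ncard_eq (h : RankSystem S key N φ ψ) : S.ncard = N := by
  rw [← h.injOn.ncard_image, h.bijOn.image_eq, ncard_Iio]

theorem lt_iff (h : RankSystem S key N φ ψ) {x y : α} (hx : x ∈ S) (hy : y ∈ S) :
    φ x < φ y ↔ key x < key y := by
  refine ⟨fun hlt => ?_, h.mono x hx y hy⟩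
  rcases lt_trichotomy (key x) (key y) with h1 | h1 | h1
  · exact h1
  · rw [h.inj hx hy h1] at hlt; omega
  · have := h.mono y hy x hx h1; omega

/-- The image under `φ` of the predecessors of `x` is all of `{0, …, φ x - 1}`: each such number is
`φ (ψ r)`, and `φ` reflects the order. -/
theorem eq_ncard (h : RankSystem S key N φ ψ) {x : α} (hx : x ∈ S) :
    φ x = {y ∈ S | key y < key x}.ncard := by
  have himg : φ '' {y ∈ S | key y < key x} = Set.Iio (φ x) := by
    ext r
    constructor
    · rintro ⟨y, ⟨hy, hyx⟩, rfl⟩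
      exact h.mono y hy x hx hyx
    · intro hr
      have hrN : r < N := lt_trans hr (h.lt x hx)
      refine ⟨ψ r, ⟨h.mem r hrN, ?_⟩, h.right_inv r hrN⟩
      rw [← h.lt_iff (h.mem r hrN) hx, h.right_inv r hrN]
      exact hr
  rw [← (h.injOn.mono (fun y hy => hy.1)).ncard_image, himg, ncard_Iio]

theorem left_inv (h : RankSystem S key N φ ψ) {x : α} (hx : x ∈ S) : ψ (φ x) = x :=
  h.injOn (h.mem _ (h.lt x hx)) hx (h.right_inv _ (h.lt x hx))

theorem invOn (h : RankSystem S key N φ ψ) : Set.InvOn ψ φ S (Set.Iio N) :=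
  ⟨fun _ hx => h.left_inv hx, fun r hr => h.right_inv r hr⟩

theorem lexRank_eq {S : Set (List ℕ)} {φ : List ℕ → ℕ} {ψ : ℕ → List ℕ}
    (h : RankSystem S id N φ ψ) {x : List ℕ} (hx : x ∈ S) : lexRank S x = φ x :=
  (h.eq_ncard hx).symm

end RankSystem

/-! ### Decreasing sequences -/

/-- Once the first entry is `a`, the bound `n` is irrelevant for the rest, which only has to stay
below `a`. This is the recursion on which all inductions on decreasing sequences run. -/
theorem cons_mem_decreasingSeqs {n k a : ℕ} {l : List ℕ} :
    a :: l ∈ decreasingSeqs n (k + 1) ↔ 1 ≤ a ∧ a ≤ n ∧ l ∈ decreasingSeqs (a - 1) k := by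
  simp only [decreasingSeqs, Set.mem_ofPred_eq, List.length_cons, Nat.add_right_cancel_iff,
    List.pairwise_cons, List.mem_cons, forall_eq_or_imp, Finset.mem_Icc]
  constructor
  · rintro ⟨h1, ⟨h2, h3⟩, h4, h5⟩
    refine ⟨h4.1, h4.2, h1, h3, fun x hx => ?_⟩
    have := h2 x hx; have := h5 x hx; omega
  · rintro ⟨h1, h2, h3, h4, h5⟩
    refine ⟨h3, ⟨fun x hx => ?_, h4⟩, ⟨h1, h2⟩, fun x hx => ?_⟩
    · have := h5 x hx; omega
    · have := h5 x hx; omega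

/-- The rank of a decreasing sequence. -/
def rankDecreasing : List ℕ → ℕ
  | [] => 0
  | a :: l => (a - 1).choose (l.length + 1) + rankDecreasing l

/-- Pascal's rule: the tail contributes less than `(a-1).choose k`, which together with
`(a-1).choose (k+1)` makes `a.choose (k+1)`. -/
theorem rankDecreasing_lt {n k : ℕ} {l : List ℕ} (h : l ∈ decreasingSeqs n k) :
    rankDecreasing l < n.choose k := by
  induction l generalizing n k with
  | nil =>
    have : k = 0 := h.1.symm
    subst this; simp [rankDecreasing]
  | cons a l ih =>
    obtain ⟨k, rfl⟩ : ∃ k', k = k' + 1 := ⟨l.length, h.1.symm⟩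
    obtain ⟨h1, h2, h3⟩ := cons_mem_decreasingSeqs.1 h
    have h4 := ih h3
    have h5 : l.length = k := h3.1
    obtain ⟨b, rfl⟩ : ∃ b, a = b + 1 := ⟨a - 1, by omega⟩
    simp only [Nat.add_sub_cancel] at h4
    have h6 := Nat.choose_le_choose (k + 1) h2
    rw [Nat.choose_succ_succ'] at h6
    simp only [rankDecreasing, h5, Nat.add_sub_cancel]
    omega

theorem rankDecreasing_mono {n k : ℕ} {l l' : List ℕ} (h : l ∈ decreasingSeqs n k)
    (h' : l' ∈ decreasingSeqs n k) (hlt : l < l') : rankDecreasing l < rankDecreasing l' := by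
  induction l generalizing n k l' with
  | nil =>
    have : k = 0 := h.1.symm
    subst this
    have : l' = [] := List.length_eq_zero_iff.1 h'.1
    subst this; exact absurd hlt (lt_irrefl _)
  | cons a l ih =>
    obtain ⟨k, rfl⟩ : ∃ k', k = k' + 1 := ⟨l.length, h.1.symm⟩
    obtain ⟨a', l', rfl⟩ : ∃ a' l'', l' = a' :: l'' := List.exists_cons_of_length_eq_add_one h'.1
    obtain ⟨h1, h2, h3⟩ := cons_mem_decreasingSeqs.1 h
    obtain ⟨h1', h2', h3'⟩ := cons_mem_decreasingSeqs.1 h'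
    rw [List.cons_lt_cons_iff] at hlt
    rcases hlt with hlt | ⟨rfl, hlt⟩
    -- The upper bound is applied with `a` in place of `n`: everything starting with `a` has rank
    -- below `a.choose (k+1)`, which is at most the first summand for a larger `a'`.
    · have h4 := rankDecreasing_lt
        (cons_mem_decreasingSeqs.2 ⟨h1, le_refl a, h3⟩)
      have h5 : a.choose (k + 1) ≤ (a' - 1).choose (k + 1) := Nat.choose_le_choose _ (by omega)
      have h6 : l'.length = k := h3'.1
      simp only [rankDecreasing, h6] at h4 ⊢
      omega
    · have h4 := ih h3 h3' hlt
      have h5 : l.length = k := h3.1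
      have h6 : l'.length = k := h3'.1
      simp only [rankDecreasing, h5, h6]
      omega

/-- Guarantees that the search bound `m + k` in `unrankDecreasing` does not cut off the greedy
choice. -/
theorem lt_choose_add (m k : ℕ) : m < (m + k + 1).choose (k + 1) := by
  induction m with
  | zero => simp
  | succ m ih =>
    have h : 0 < (m + k + 1).choose k := Nat.choose_pos (by omega)
    rw [show m + 1 + k + 1 = (m + k + 1) + 1 by ring, Nat.choose_succ_succ']
    omega

/-- The greedy choice in the unranking of decreasing sequences. -/
theorem findGreatest_choose {m k y : ℕ} (h1 : y.choose (k + 1) ≤ m)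
    (h2 : m < (y + 1).choose (k + 1)) :
    Nat.findGreatest (fun y => y.choose (k + 1) ≤ m) (m + k) = y := by
  rw [Nat.findGreatest_eq_iff]
  refine ⟨?_, fun _ => h1, fun i hi _ h => ?_⟩
  · by_contra hy
    have := lt_choose_add m k
    have := Nat.choose_le_choose (k + 1) (show m + k + 1 ≤ y by omega)
    omega
  · have := Nat.choose_le_choose (k + 1) (show y + 1 ≤ i by omega)
    omega

theorem exists_choose_le {n k m : ℕ} (h : m < n.choose (k + 1)) :
    ∃ y < n, y.choose (k + 1) ≤ m ∧ m < (y + 1).choose (k + 1) := by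
  induction n with
  | zero => simp at h
  | succ n ih =>
    by_cases h1 : m < n.choose (k + 1)
    · obtain ⟨y, hy, hy'⟩ := ih h1
      exact ⟨y, by omega, hy'⟩
    · exact ⟨n, by omega, by omega, h⟩

theorem unrankDecreasing_spec {n k m : ℕ} (h : m < n.choose k) :
    unrankDecreasing k m ∈ decreasingSeqs n k ∧ rankDecreasing (unrankDecreasing k m) = m := by
  induction k generalizing n m with
  | zero =>
    simp at h
    simp [unrankDecreasing, decreasingSeqs, rankDecreasing, h]
  | succ k ih =>
    obtain ⟨y, hy, h1, h2⟩ := exists_choose_le h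
    have h3 := Nat.choose_succ_succ y k
    obtain ⟨h4, h5⟩ := ih (n := y) (m := m - y.choose (k + 1)) (by
      simp only [Nat.succ_eq_add_one] at h3; omega)
    simp only [unrankDecreasing, findGreatest_choose h1 h2, cons_mem_decreasingSeqs,
      Nat.add_sub_cancel, rankDecreasing, h5, h4.1]
    exact ⟨⟨by omega, by omega, h4⟩, by omega⟩

theorem rankSystem_decreasing (n k : ℕ) :
    RankSystem (decreasingSeqs n k) id (n.choose k) rankDecreasing (unrankDecreasing k) where
  inj := Function.injective_id.injOn
  lt _ hx := rankDecreasing_lt hx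
  mono _ hx _ hy hxy := rankDecreasing_mono hx hy hxy
  mem _ hr := (unrankDecreasing_spec hr).1
  right_inv _ hr := (unrankDecreasing_spec hr).2

/-! ### Insertion sequences -/

/-- The sequences `h` with `h j` at most the number of entries after the `j`-th one. -/
def InsertionValid : List ℕ → Prop
  | [] => True
  | a :: l => a ≤ l.length ∧ InsertionValid l

@[simp] theorem length_permOfInsertion (h : List ℕ) : (permOfInsertion h).length = h.length := by
  induction h with
  | nil => rfl
  | cons a h ih => simp [permOfInsertion, ih]

theorem perm_range'_iff {N : ℕ} {l : List ℕ} (h : l.length = N) :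
    l.Perm (List.range' 1 N) ↔ l.Nodup ∧ ∀ i ∈ l, 1 ≤ i ∧ i ≤ N := by
  constructor
  · intro hp
    refine ⟨hp.nodup_iff.2 List.nodup_range', fun i hi => ?_⟩
    have := hp.mem_iff.1 hi
    rw [List.mem_range'_1] at this
    omega
  · rintro ⟨h1, h2⟩
    have hs : l ⊆ List.range' 1 N := fun i hi => by
      rw [List.mem_range'_1]; have := h2 i hi; omega
    exact (h1.subperm hs).perm_of_length_le (by simp [h])

theorem permOfInsertion_perm {h : List ℕ} (hv : InsertionValid h) :
    (permOfInsertion h).Perm (List.range' 1 h.length) := by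
  induction h with
  | nil => simp [permOfInsertion]
  | cons a h ih =>
    rw [perm_range'_iff (by simp)]
    obtain ⟨h1, h2⟩ := (perm_range'_iff (by simp)).1 (ih hv.2)
    have ha := hv.1
    simp only [permOfInsertion, List.nodup_cons, List.mem_map, List.mem_cons, forall_eq_or_imp,
      List.length_cons]
    refine ⟨⟨?_, ?_⟩, by omega, ?_⟩
    · rintro ⟨i, hi, hia⟩
      split_ifs at hia <;> omega
    · apply h1.map_on
      intro x _ y _ hxy
      split_ifs at hxy <;> omega
    · rintro _ ⟨i, hi, rfl⟩
      have := h2 i hi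
      split_ifs <;> omega

/-- Lowering the entries behind the first one undoes raising them. Validity of `h` plays no role
here; it only decides whether the list is a permutation. -/
theorem insertionSeq_permOfInsertion (h : List ℕ) : insertionSeq (permOfInsertion h) = h := by
  induction h with
  | nil => simp [permOfInsertion, insertionSeq]
  | cons a h ih =>
    rw [permOfInsertion, insertionSeq, List.map_map]
    have : (permOfInsertion h).map
        ((fun i => if a + 1 < i then i - 1 else i) ∘ fun i => if a + 1 ≤ i then i + 1 else i)
        = permOfInsertion h := by
      conv_rhs => rw [← List.map_id (permOfInsertion h)]
      apply List.map_congr_left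
      intro i _
      simp only [Function.comp, id]
      split_ifs <;> omega
    rw [this, ih, Nat.add_sub_cancel]

/-- The entries of a permutation after the first entry `j`, lowered if they exceed `j`. -/
theorem perm_lower {N j : ℕ} {l : List ℕ} (hp : (j :: l).Perm (List.range' 1 (N + 1))) :
    (l.map (fun i => if j < i then i - 1 else i)).Perm (List.range' 1 N) := by
  have hl : l.length = N := by simpa using hp.length_eq
  obtain ⟨h1, h2⟩ := (perm_range'_iff (by simp [hl])).1 hp
  rw [List.nodup_cons] at h1
  rw [perm_range'_iff (by simp [hl])]
  simp only [List.mem_cons, forall_eq_or_imp] at h2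
  refine ⟨?_, ?_⟩
  · apply h1.2.map_on
    intro x hx y hy hxy
    have hxj : x ≠ j := fun h => h1.1 (h ▸ hx)
    have hyj : y ≠ j := fun h => h1.1 (h ▸ hy)
    split_ifs at hxy <;> omega
  · simp only [List.mem_map]
    rintro _ ⟨i, hi, rfl⟩
    have hij : i ≠ j := fun h => h1.1 (h ▸ hi)
    have := h2.2 i hi
    split_ifs <;> omega

/-- Raising undoes lowering because no later entry equals the first one. Together with
`insertionSeq_permOfInsertion` this makes the permutations of `[N]` correspond to the valid
sequences of length `N`. -/
theorem insertionSeq_spec {N : ℕ} {σ : List ℕ} (hp : σ.Perm (List.range' 1 N)) :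
    (insertionSeq σ).length = N ∧ InsertionValid (insertionSeq σ) ∧
      permOfInsertion (insertionSeq σ) = σ := by
  induction N generalizing σ with
  | zero =>
    have : σ = [] := by simpa using hp
    subst this; simp [insertionSeq, InsertionValid, permOfInsertion]
  | succ N ih =>
    obtain ⟨j, l, rfl⟩ : ∃ j l, σ = j :: l :=
      List.exists_cons_of_length_eq_add_one (by simpa using hp.length_eq)
    obtain ⟨h1, h2, h3⟩ := ih (perm_lower hp)
    have hl : l.length = N := by simpa using hp.length_eq
    obtain ⟨h4, h5⟩ := (perm_range'_iff (by simp [hl])).1 hp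
    rw [List.nodup_cons] at h4
    simp only [List.mem_cons, forall_eq_or_imp] at h5
    have hj := h5.1
    rw [insertionSeq]
    refine ⟨by simp [h1], ⟨by rw [h1]; omega, h2⟩, ?_⟩
    rw [permOfInsertion, h3, List.map_map, Nat.sub_add_cancel hj.1]
    congr 1
    conv_rhs => rw [← List.map_id l]
    apply List.map_congr_left
    intro i hi
    have hij : i ≠ j := fun h => h4.1 (h ▸ hi)
    simp only [Function.comp, id]
    split_ifs <;> omega

theorem mem_insertionSeqs {N : ℕ} {h : List ℕ} :
    h ∈ insertionSeqs N ↔ h.length = N ∧ InsertionValid h := by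
  constructor
  · rintro ⟨σ, hσ, rfl⟩
    exact ⟨(insertionSeq_spec hσ).1, (insertionSeq_spec hσ).2.1⟩
  · rintro ⟨rfl, h2⟩
    exact ⟨permOfInsertion h, permOfInsertion_perm h2, insertionSeq_permOfInsertion h⟩

/-- The Lehmer code of a sequence. -/
def lehmer : List ℕ → List ℕ
  | [] => []
  | j :: l => l.countP (fun i => decide (i < j)) :: lehmer l

theorem lehmer_map {u : ℕ → ℕ} {l : List ℕ} (hu : ∀ i ∈ l, ∀ j ∈ l, u i < u j ↔ i < j) :
    lehmer (l.map u) = lehmer l := by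
  induction l with
  | nil => rfl
  | cons j l ih =>
    simp only [List.map_cons, lehmer, List.countP_map]
    congr 1
    · apply List.countP_congr
      intro i hi
      simpa using hu i (by simp [hi]) j (by simp)
    · exact ih (fun i hi j hj => hu i (by simp [hi]) j (by simp [hj]))

/-- In a permutation the first entry `j` has exactly `j - 1` smaller entries, all of them later, and
lowering the rest does not change its relative order. The Lehmer code can be computed by counting,
without relabelling. -/
theorem insertionSeq_eq_lehmer {N : ℕ} {σ : List ℕ} (hp : σ.Perm (List.range' 1 N)) :
    insertionSeq σ = lehmer σ := by
  induction N generalizing σ with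
  | zero =>
    have : σ = [] := by simpa using hp
    subst this; simp [insertionSeq, lehmer]
  | succ N ih =>
    obtain ⟨j, l, rfl⟩ : ∃ j l, σ = j :: l :=
      List.exists_cons_of_length_eq_add_one (by simpa using hp.length_eq)
    have hl : l.length = N := by simpa using hp.length_eq
    obtain ⟨h4, h5⟩ := (perm_range'_iff (by simp [hl])).1 hp
    rw [List.nodup_cons] at h4
    have hj := h5 j (by simp)
    rw [insertionSeq, lehmer, ih (perm_lower hp), lehmer_map]
    · congr 1
      have h6 : (j :: l).countP (fun i => decide (i < j)) =
          (List.range' 1 (N + 1)).countP (fun i => decide (i < j)) := hp.countP_eq _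
      rw [List.countP_cons_of_neg (by simp)] at h6
      rw [h6, List.countP_eq_length_filter]
      have h7 : (List.range' 1 (N + 1)).filter (fun i => decide (i < j)) = List.range' 1 (j - 1) := by
        have : N + 1 = (j - 1) + (N + 2 - j) := by omega
        rw [this, ← List.range'_append_1, List.filter_append]
        rw [List.filter_eq_self.2, List.filter_eq_nil_iff.2, List.append_nil]
        · intro i hi; rw [List.mem_range'_1] at hi; simp; omega
        · intro i hi; rw [List.mem_range'_1] at hi; simp; omega
      rw [h7, List.length_range']
    · intro a ha b hb
      have haj : a ≠ j := fun h => h4.1 (h ▸ ha)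
      have hbj : b ≠ j := fun h => h4.1 (h ▸ hb)
      split_ifs <;> omega

/-- The rank of an insertion sequence. -/
def rankInsertion : List ℕ → ℕ
  | [] => 0
  | a :: l => a * l.length.factorial + rankInsertion l

theorem rankInsertion_lt {h : List ℕ} (hv : InsertionValid h) :
    rankInsertion h < h.length.factorial := by
  induction h with
  | nil => simp [rankInsertion]
  | cons a l ih =>
    have h1 := ih hv.2
    have h2 := Nat.mul_le_mul_right l.length.factorial hv.1
    simp only [rankInsertion, List.length_cons, Nat.factorial_succ, Nat.succ_mul]
    omega

theorem rankInsertion_mono {h h' : List ℕ} (hl : h.length = h'.length) (hv : InsertionValid h)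
    (hv' : InsertionValid h') (hlt : h < h') : rankInsertion h < rankInsertion h' := by
  induction h generalizing h' with
  | nil =>
    have : h' = [] := List.length_eq_zero_iff.1 hl.symm
    subst this; exact absurd hlt (lt_irrefl _)
  | cons a l ih =>
    obtain ⟨a', l', rfl⟩ : ∃ a' l'', h' = a' :: l'' := List.exists_cons_of_length_eq_add_one hl.symm
    have hl' : l.length = l'.length := by simpa using hl
    rw [List.cons_lt_cons_iff] at hlt
    simp only [rankInsertion, hl']
    rcases hlt with hlt | ⟨rfl, hlt⟩
    · have h1 := rankInsertion_lt hv.2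
      have h2 := Nat.mul_le_mul_right l'.length.factorial (show a + 1 ≤ a' by omega)
      rw [Nat.succ_mul] at h2
      rw [hl'] at h1
      omega
    · have := ih hl' hv.2 hv'.2 hlt
      omega

theorem unrankInsertion_spec {N p : ℕ} (h : p < N.factorial) :
    (unrankInsertion N p).length = N ∧ InsertionValid (unrankInsertion N p) ∧
      rankInsertion (unrankInsertion N p) = p := by
  induction N generalizing p with
  | zero =>
    simp at h
    simp [unrankInsertion, InsertionValid, rankInsertion, h]
  | succ N ih =>
    obtain ⟨h1, h2, h3⟩ := ih (p := p % N.factorial) (Nat.mod_lt _ (Nat.factorial_pos N))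
    simp only [unrankInsertion, List.length_cons, h1, InsertionValid, rankInsertion, h2, h3,
      and_true, true_and]
    refine ⟨?_, Nat.div_add_mod' _ _⟩
    rw [← Nat.lt_succ_iff, Nat.div_lt_iff_lt_mul (Nat.factorial_pos N), ← Nat.factorial_succ]
    exact h

theorem rankSystem_insertion (N : ℕ) :
    RankSystem (insertionSeqs N) id N.factorial rankInsertion (unrankInsertion N) where
  inj := Function.injective_id.injOn
  lt x hx := by
    obtain ⟨h1, h2⟩ := mem_insertionSeqs.1 hx
    rw [← h1]; exact rankInsertion_lt h2
  mono x hx y hy hxy := by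
    obtain ⟨h1, h2⟩ := mem_insertionSeqs.1 hx
    obtain ⟨h3, h4⟩ := mem_insertionSeqs.1 hy
    exact rankInsertion_mono (by rw [h1, h3]) h2 h4 hxy
  mem r hr := mem_insertionSeqs.2
    ⟨(unrankInsertion_spec hr).1, (unrankInsertion_spec hr).2.1⟩
  right_inv _ hr := (unrankInsertion_spec hr).2.2

/-! ### Restricted growth sequences -/

/-- The sequences that extend a restricted growth sequence with maximum `m` to one that is onto
`{0, …, K-1}`. -/
def GrowthValid (K : ℕ) : ℕ → List ℕ → Prop
  | m, [] => m + 1 = K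
  | m, a :: l => a ≤ m + 1 ∧ GrowthValid K (max m a) l

/-- Exchanges the condition on some earlier entry for a running maximum `m`. Since values grow by at
most one, the values seen so far always form the interval `{0, …, m}`, so surjectivity can be
carried along as well. -/
theorem growthValid_iff {K m : ℕ} {l : List ℕ} :
    GrowthValid K m l ↔
      (∀ i < l.length, l.getD i 0 ≤ 1 + m ∨ ∃ j < i, l.getD i 0 ≤ 1 + l.getD j 0) ∧
        range (m + 1) ∪ l.toFinset = range K := by
  induction l generalizing m with
  | nil =>
    simp only [GrowthValid, List.length_nil, not_lt_zero, List.toFinset_nil, Finset.union_empty]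
    refine ⟨fun h => ⟨fun i hi => hi.elim, by rw [h]⟩, fun h => ?_⟩
    simpa using congrArg Finset.card h.2
  | cons a l ih =>
    rw [GrowthValid, ih]
    have hset : a ≤ m + 1 →
        range (m + 1) ∪ (a :: l).toFinset = range (max m a + 1) ∪ l.toFinset := by
      intro ha
      ext x
      simp only [Finset.mem_union, List.toFinset_cons, Finset.mem_insert, Finset.mem_range]
      have : x < max m a + 1 ↔ x < m + 1 ∨ x = a := by omega
      rw [this, or_assoc]
    constructor
    · rintro ⟨h1, h2, h3⟩
      refine ⟨?_, by rw [hset h1, h3]⟩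
      intro i hi
      cases i with
      | zero => left; simpa [add_comm] using h1
      | succ i =>
        simp only [List.getD_cons_succ]
        rcases h2 i (by simpa using hi) with h | ⟨j, hj, h⟩
        · by_cases h4 : l.getD i 0 ≤ 1 + m
          · exact Or.inl h4
          · exact Or.inr ⟨0, by omega, by simp only [List.getD_cons_zero]; omega⟩
        · exact Or.inr ⟨j + 1, by omega, by simpa using h⟩
    · rintro ⟨h2, h3⟩
      have h1 : a ≤ m + 1 := by
        rcases h2 0 (by simp) with h | ⟨j, hj, _⟩
        · simpa [add_comm] using h
        · omega
      refine ⟨h1, ?_, by rw [← hset h1, h3]⟩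
      intro i hi
      rcases h2 (i + 1) (by simpa using hi) with h | ⟨j, hj, h⟩
      · left; simp only [List.getD_cons_succ] at h; omega
      · cases j with
        | zero => left; simp only [List.getD_cons_succ, List.getD_cons_zero] at h; omega
        | succ j => exact Or.inr ⟨j, by omega, by simpa using h⟩

theorem mem_growthSeqs {n K : ℕ} {s : List ℕ} :
    s ∈ growthSeqs (n + 1) K ↔ ∃ l, s = 0 :: l ∧ l.length = n ∧ GrowthValid K 0 l := by
  constructor
  · rintro ⟨h1, h2, h3, h4⟩
    obtain ⟨b, l, rfl⟩ := List.exists_cons_of_length_eq_add_one h1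
    simp only [List.getD_cons_zero] at h2
    subst h2
    have h1' : l.length = n := by simpa using h1
    refine ⟨l, rfl, h1', growthValid_iff.2 ⟨fun i hi => ?_, by simpa using h4⟩⟩
    obtain ⟨j, hj, h⟩ := h3 (i + 1) (by omega) (by omega)
    cases j with
    | zero => left; simpa using h
    | succ j => exact Or.inr ⟨j, by omega, by simpa using h⟩
  · rintro ⟨l, rfl, rfl, h⟩
    obtain ⟨h1, h2⟩ := growthValid_iff.1 h
    refine ⟨by simp, by simp, fun i hi hi' => ?_, by simpa using h2⟩
    obtain ⟨i, rfl⟩ : ∃ i', i = i' + 1 := ⟨i - 1, by omega⟩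
    rcases h1 i (by omega) with h | ⟨j, hj, h⟩
    · exact ⟨0, by omega, by simpa using h⟩
    · exact ⟨j + 1, by omega, by simpa using h⟩

/-- The rank of a continuation of a restricted growth sequence with maximum `m`. -/
def rankGrowthAux (K : ℕ) : ℕ → List ℕ → ℕ
  | _, [] => 0
  | m, a :: l => a * extensionCount K l.length m + rankGrowthAux K (max m a) l

/-- The two summands of the recurrence for `E` match the two kinds of next entry: at most `m`,
keeping the maximum, or `m + 1`, raising it. -/
theorem rankGrowthAux_lt {K m : ℕ} {l : List ℕ} (h : GrowthValid K m l) :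
    rankGrowthAux K m l < extensionCount K l.length m := by
  induction l generalizing m with
  | nil => simp [GrowthValid] at h; simp [rankGrowthAux, extensionCount, h]
  | cons a l ih =>
    have h1 := ih h.2
    have ha := h.1
    simp only [rankGrowthAux, List.length_cons, extensionCount]
    rcases Nat.lt_or_ge m a with h2 | h2
    · have : a = m + 1 := by omega
      subst this
      rw [max_eq_right (by omega)] at h1 ⊢
      omega
    · rw [max_eq_left h2] at h1 ⊢
      have := Nat.mul_le_mul_right (extensionCount K l.length m) h2
      rw [Nat.succ_mul]
      omega

theorem rankGrowthAux_mono {K m : ℕ} {l l' : List ℕ} (hl : l.length = l'.length)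
    (h : GrowthValid K m l) (h' : GrowthValid K m l') (hlt : l < l') :
    rankGrowthAux K m l < rankGrowthAux K m l' := by
  induction l generalizing m l' with
  | nil =>
    have : l' = [] := List.length_eq_zero_iff.1 hl.symm
    subst this; exact absurd hlt (lt_irrefl _)
  | cons a l ih =>
    obtain ⟨a', l', rfl⟩ : ∃ a' l'', l' = a' :: l'' := List.exists_cons_of_length_eq_add_one hl.symm
    have hl' : l.length = l'.length := by simpa using hl
    have h1 := h'.1
    rw [List.cons_lt_cons_iff] at hlt
    simp only [rankGrowthAux, hl']
    rcases hlt with hlt | ⟨rfl, hlt⟩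
    -- Being smaller than `a' ≤ m + 1`, the entry `a` is at most `m` and leaves the maximum
    -- unchanged, so its tail contributes less than one full block `E(t, m)`.
    · have h2 := rankGrowthAux_lt h.2
      rw [max_eq_left (by omega), hl'] at h2
      rw [max_eq_left (by omega)]
      have h3 := Nat.mul_le_mul_right (extensionCount K l'.length m) (show a + 1 ≤ a' by omega)
      rw [Nat.succ_mul] at h3
      omega
    · have := ih hl' h.2 h'.2 hlt
      omega

/-- The greedy choice in the unranking of restricted growth sequences. -/
theorem findGreatest_extension (e m r : ℕ) :
    Nat.findGreatest (fun a => a * e ≤ r) (m + 1) =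
      if 0 < e then min (m + 1) (r / e) else m + 1 := by
  split_ifs with h
  · rw [Nat.findGreatest_eq_iff]
    refine ⟨min_le_left _ _, fun _ => ?_, fun i hi hi' hir => ?_⟩
    · rw [← Nat.le_div_iff_mul_le h]; exact min_le_right _ _
    · rw [← Nat.le_div_iff_mul_le h] at hir
      omega
  · have : e = 0 := by omega
    subst this
    rw [Nat.findGreatest_eq_iff]
    exact ⟨le_refl _, fun _ => by omega, fun i hi hi' => by omega⟩

/-- After the greedy choice the remaining rank is in range. -/
theorem greedy_growth_lt {K t m r a : ℕ} (h : r < extensionCount K (t + 1) m)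
    (ha : a = Nat.findGreatest (fun a => a * extensionCount K t m ≤ r) (m + 1)) :
    a ≤ m + 1 ∧ a * extensionCount K t m ≤ r ∧
      r - a * extensionCount K t m < extensionCount K t (max m a) := by
  rw [extensionCount] at h
  have h1 : a ≤ m + 1 := by rw [ha]; exact Nat.findGreatest_le _
  have h2 : a * extensionCount K t m ≤ r := by
    rw [ha]
    exact Nat.findGreatest_spec (P := fun a => a * extensionCount K t m ≤ r) (Nat.zero_le (m + 1))
      (by simp)
  refine ⟨h1, h2, ?_⟩
  rcases Nat.lt_or_ge m a with h3 | h3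
  · have : a = m + 1 := by omega
    rw [max_eq_right (by omega), this]
    have := this ▸ h2
    omega
  · rw [max_eq_left h3]
    have h4 : ¬ (a + 1) * extensionCount K t m ≤ r := by
      have := Nat.findGreatest_is_greatest
        (P := fun a => a * extensionCount K t m ≤ r) (n := m + 1) (k := a + 1)
        (by rw [← ha]; omega) (by omega)
      exact this
    rw [Nat.succ_mul] at h4
    omega

theorem unrankGrowthAux_spec {K t m r : ℕ} (h : r < extensionCount K t m) :
    (unrankGrowthAux K t m r).length = t ∧ GrowthValid K m (unrankGrowthAux K t m r) ∧
      rankGrowthAux K m (unrankGrowthAux K t m r) = r := by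
  induction t generalizing m r with
  | zero =>
    simp only [extensionCount] at h
    split_ifs at h with hm
    · simp [unrankGrowthAux, GrowthValid, hm, rankGrowthAux]; omega
    · omega
  | succ t ih =>
    rw [unrankGrowthAux]
    obtain ⟨h1, h2, h3⟩ := greedy_growth_lt h rfl
    generalize Nat.findGreatest (fun a => a * extensionCount K t m ≤ r) (m + 1) = a at *
    obtain ⟨h4, h5, h6⟩ := ih h3
    refine ⟨by simp [h4], ⟨h1, h5⟩, ?_⟩
    rw [rankGrowthAux, h4, h6]
    omega

/-- The rank of a restricted growth sequence onto `{0, …, K-1}`. -/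
def rankGrowth (K : ℕ) (s : List ℕ) : ℕ := rankGrowthAux K 0 s.tail

/-- A maximum that is already too large can never decrease again. -/
theorem extensionCount_eq_zero {K m : ℕ} (hm : K ≤ m) (j : ℕ) : extensionCount K j m = 0 := by
  induction j generalizing m with
  | zero => simp [extensionCount]; omega
  | succ j ih => simp [extensionCount, ih hm, ih (m := m + 1) (by omega)]

/-- Combinatorially, growth sequences of length `a + 1 + j` are sorted by the maximum `m` of their
first `a + 1` entries. The induction moves one entry from the extension to the prefix, playing the
recurrence of `E` against that of the Stirling numbers. The range `B` is arbitrary above `K` because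
the further terms vanish. -/
theorem sum_stirling_extensionCount (K a j B : ℕ) (hB : K ≤ B) :
    ∑ m ∈ range B, Nat.stirlingSecond (a + 1) (m + 1) * extensionCount K j m =
      Nat.stirlingSecond (a + 1 + j) K := by
  induction j generalizing a with
  | zero =>
    simp only [extensionCount, mul_ite, mul_one, mul_zero, add_zero]
    rcases Nat.eq_zero_or_pos K with rfl | hK
    · simp [Nat.stirlingSecond]
    · rw [Finset.sum_eq_single (K - 1)]
      · rw [if_pos (by omega), Nat.sub_add_cancel hK]
      · intro b _ hb; rw [if_neg (by omega)]
      · intro hb; simp at hb; omega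
  | succ j ih =>
    rw [show a + 1 + (j + 1) = (a + 1) + 1 + j by ring, ← ih (a + 1)]
    have h1 : ∀ m, Nat.stirlingSecond (a + 1 + 1) (m + 1) =
        (m + 1) * Nat.stirlingSecond (a + 1) (m + 1) + Nat.stirlingSecond (a + 1) m := fun m => by
      rw [Nat.stirlingSecond_succ_succ]
    simp only [h1, extensionCount, add_mul, mul_add, Finset.sum_add_distrib]
    have h2 : ∑ m ∈ range B, Nat.stirlingSecond (a + 1) (m + 1) * extensionCount K j (m + 1) =
        ∑ m ∈ range B, Nat.stirlingSecond (a + 1) m * extensionCount K j m := by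
      have e1 := Finset.sum_range_succ
        (fun m => Nat.stirlingSecond (a + 1) m * extensionCount K j m) B
      have e2 := Finset.sum_range_succ'
        (fun m => Nat.stirlingSecond (a + 1) m * extensionCount K j m) B
      rw [extensionCount_eq_zero hB j] at e1
      simp at e1 e2
      omega
    rw [h2]
    congr 1
    rw [← Finset.sum_add_distrib, ← Finset.sum_add_distrib]
    apply Finset.sum_congr rfl
    intros; ring

theorem extensionCount_zero (K n : ℕ) : extensionCount K n 0 = Nat.stirlingSecond (n + 1) K := by
  rw [add_comm n 1, ← sum_stirling_extensionCount K 0 n (K + 1) (by omega),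
    Finset.sum_eq_single 0]
  · simp [Nat.stirlingSecond_self]
  · intro b _ hb
    rw [Nat.stirlingSecond_eq_zero_of_lt (by omega), zero_mul]
  · simp

theorem rankSystem_growth (n K : ℕ) :
    RankSystem (growthSeqs (n + 1) K) id (Nat.stirlingSecond (n + 1) K) (rankGrowth K)
      (unrankGrowth (n + 1) K) where
  inj := Function.injective_id.injOn
  lt x hx := by
    obtain ⟨l, rfl, rfl, h⟩ := mem_growthSeqs.1 hx
    rw [← extensionCount_zero]
    exact rankGrowthAux_lt h
  mono x hx y hy hxy := by
    obtain ⟨l, rfl, h1, h⟩ := mem_growthSeqs.1 hx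
    obtain ⟨l', rfl, h1', h'⟩ := mem_growthSeqs.1 hy
    simp only [id, List.cons_lt_cons_iff, lt_irrefl, true_and, false_or] at hxy
    exact rankGrowthAux_mono (h1.trans h1'.symm) h h' hxy
  mem r hr := by
    rw [← extensionCount_zero] at hr
    exact mem_growthSeqs.2 ⟨_, rfl, (unrankGrowthAux_spec hr).1, (unrankGrowthAux_spec hr).2.1⟩
  right_inv r hr := by
    rw [← extensionCount_zero] at hr
    exact (unrankGrowthAux_spec hr).2.2


/-! ### Trees as parent functions -/

/-- The parent functions of the trees on `[n]` with root `1`, extended by `0`. -/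
def parents (n : ℕ) : Set (ℕ → ℕ) :=
  {p | (∀ i ∈ Icc 2 n, p i ∈ Icc 1 n) ∧ (∀ i, i ∉ Icc 2 n → p i = 0) ∧
    ∀ i ∈ Icc 2 n, ∃ j, p^[j] i = 1}

/-- The set of edges `(i, p i)`. -/
def edges (n : ℕ) (p : ℕ → ℕ) : Finset (ℕ × ℕ) := (Icc 2 n).image (fun i => (i, p i))

theorem mem_edges {n : ℕ} {p : ℕ → ℕ} {a b : ℕ} :
    (a, b) ∈ edges n p ↔ a ∈ Icc 2 n ∧ p a = b := by
  simp only [edges, Finset.mem_image, Prod.mk.injEq]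
  constructor
  · rintro ⟨i, hi, rfl, h⟩; exact ⟨hi, h⟩
  · rintro ⟨h1, h2⟩; exact ⟨a, h1, rfl, h2⟩

theorem reflTransGen_edges {n : ℕ} {p : ℕ → ℕ} {v : ℕ} (h0 : ∀ i, i ∉ Icc 2 n → p i = 0)
    {j : ℕ} (h : p^[j] v = 1) :
    Relation.ReflTransGen (fun a b => (a, b) ∈ edges n p) v 1 := by
  induction j generalizing v with
  | zero => rw [show v = 1 from h]
  | succ j ih =>
    rw [Function.iterate_succ_apply] at h
    by_cases hv : v ∈ Icc 2 n
    · exact Relation.ReflTransGen.head (mem_edges.2 ⟨hv, rfl⟩) (ih h)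
    -- Outside of the domain the next value is `0`, which is absorbing, so `1` could not be reached
    -- any more.
    · rw [h0 v hv] at h
      have hz : p 0 = 0 := h0 0 (by simp)
      rw [Function.iterate_fixed hz] at h
      omega

theorem edges_mem_trees {n : ℕ} {p : ℕ → ℕ} (hp : p ∈ parents n) : edges n p ∈ trees n := by
  obtain ⟨h1, h2, h3⟩ := hp
  refine ⟨?_, ?_, ?_, ?_⟩
  · rintro ⟨a, b⟩ hab
    obtain ⟨ha, rfl⟩ := mem_edges.1 hab
    have := h1 a ha
    simp only [Finset.mem_product, Finset.mem_Icc] at *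
    omega
  · intro w hw
    have := (mem_edges.1 hw).1
    simp at this
  · intro v hv
    exact ⟨p v, mem_edges.2 ⟨hv, rfl⟩, fun w hw => (mem_edges.1 hw).2.symm⟩
  · intro v hv
    by_cases hv2 : v ∈ Icc 2 n
    · obtain ⟨j, hj⟩ := h3 v hv2
      exact reflTransGen_edges h2 hj
    · have : v = 1 := by simp only [Finset.mem_Icc] at *; omega
      rw [this]

theorem treeArray_eq {E : Finset (ℕ × ℕ)} {v w : ℕ} (h : (v, w) ∈ E)
    (hu : ∀ w', (v, w') ∈ E → w' = w) : treeArray E v = w := by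
  have : E.filter (fun e => e.1 = v) = {(v, w)} := by
    ext ⟨a, b⟩
    simp only [Finset.mem_filter, Finset.mem_singleton, Prod.mk.injEq]
    constructor
    · rintro ⟨h1, rfl⟩; exact ⟨rfl, hu _ h1⟩
    · rintro ⟨rfl, rfl⟩; exact ⟨h, rfl⟩
  rw [treeArray, this, Finset.sum_singleton]

theorem treeArray_eq_zero {E : Finset (ℕ × ℕ)} {v : ℕ} (h : ∀ w, (v, w) ∉ E) :
    treeArray E v = 0 := by
  have : E.filter (fun e => e.1 = v) = ∅ := by
    ext ⟨a, b⟩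
    simp only [Finset.mem_filter, Finset.notMem_empty, iff_false, not_and]
    rintro h1 rfl; exact h _ h1
  rw [treeArray, this, Finset.sum_empty]

theorem treeArray_edges {n : ℕ} {p : ℕ → ℕ} (h0 : ∀ i, i ∉ Icc 2 n → p i = 0) :
    treeArray (edges n p) = p := by
  funext v
  by_cases hv : v ∈ Icc 2 n
  · exact treeArray_eq (mem_edges.2 ⟨hv, rfl⟩) (fun w hw => (mem_edges.1 hw).2.symm)
  · rw [h0 v hv]
    exact treeArray_eq_zero (fun w hw => hv (mem_edges.1 hw).1)

/-- Uniqueness of outgoing edges turns the edge set into a function, and a directed path to the root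
into an iterate equal to `1`. From here on trees are handled as parent functions. -/
theorem treeArray_spec {n : ℕ} {T : Finset (ℕ × ℕ)} (hT : T ∈ trees n) :
    treeArray T ∈ parents n ∧ edges n (treeArray T) = T := by
  obtain ⟨h1, h2, h3, h4⟩ := hT
  have hE : ∀ v w, (v, w) ∈ T ↔ v ∈ Icc 2 n ∧ treeArray T v = w := by
    intro v w
    constructor
    · intro hvw
      have hv : v ∈ Icc 2 n := by
        have := h1 hvw
        have hv1 : v ≠ 1 := by rintro rfl; exact h2 _ hvw
        simp only [Finset.mem_product, Finset.mem_Icc] at *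
        omega
      obtain ⟨w', hw', hu⟩ := h3 v hv
      exact ⟨hv, treeArray_eq hvw (fun x hx => (hu x hx).trans (hu w hvw).symm)⟩
    · rintro ⟨hv, rfl⟩
      obtain ⟨w', hw', hu⟩ := h3 v hv
      rw [treeArray_eq hw' hu]; exact hw'
  have hedges : edges n (treeArray T) = T := by
    ext ⟨a, b⟩; rw [mem_edges, hE]
  refine ⟨⟨?_, ?_, ?_⟩, hedges⟩
  · intro i hi
    have := h1 ((hE i _).2 ⟨hi, rfl⟩)
    exact (Finset.mem_product.1 this).2
  · intro i hi
    exact treeArray_eq_zero (fun w hw => hi ((hE i w).1 hw).1)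
  · intro i hi
    have := h4 i (by simp only [Finset.mem_Icc] at *; omega)
    clear hi
    induction this using Relation.ReflTransGen.head_induction_on with
    | refl => exact ⟨0, rfl⟩
    | head hab _ ih =>
      obtain ⟨j, hj⟩ := ih
      exact ⟨j + 1, by rw [Function.iterate_succ_apply, ((hE _ _).1 hab).2, hj]⟩

/-! ### Iteration of parent functions -/

theorem iterate_parent_of_le_one {n : ℕ} {p : ℕ → ℕ} (h0 : ∀ i, i ∉ Icc 2 n → p i = 0) {v : ℕ}
    (hv : v ≤ 1) (i : ℕ) : p^[i] v ≤ 1 := by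
  have hz : p 0 = 0 := h0 0 (by simp)
  cases i with
  | zero => exact hv
  | succ i =>
    rw [Function.iterate_succ_apply, h0 v (by simp; omega), Function.iterate_fixed hz]
    omega

/-- Acyclicity: a vertex that recurs would recur forever, but its path reaches `1` and afterwards
stays at `0`. -/
theorem iterate_parent_ne {n : ℕ} {p : ℕ → ℕ} (hp : p ∈ parents n) {v j : ℕ} (hv : 2 ≤ v)
    (hj : 1 ≤ j) : p^[j] v ≠ v := by
  intro h
  by_cases hn : v ∈ Icc 2 n
  · obtain ⟨i, hi⟩ := hp.2.2 v hn
    -- The number `j * i` is a multiple of the supposed period and at least the number `i` of steps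
    -- to the root.
    have h2 : p^[j * i] v = v := by
      rw [Function.iterate_mul]; exact Function.iterate_fixed h i
    have h3 : p^[j * i] v ≤ 1 := by
      have : j * i = (j * i - i) + i := by
        have := Nat.le_mul_of_pos_left i hj; omega
      rw [this, Function.iterate_add_apply, hi]
      exact iterate_parent_of_le_one hp.2.1 le_rfl _
    omega
  · have h2 : p^[j] v ≤ 1 := by
      obtain ⟨j, rfl⟩ : ∃ j', j = j' + 1 := ⟨j - 1, by omega⟩
      rw [Function.iterate_succ_apply, hp.2.1 v hn]
      exact iterate_parent_of_le_one hp.2.1 (by omega) _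
    omega

theorem iterate_parent_le {n : ℕ} {p : ℕ → ℕ} (hp : p ∈ parents n) {v : ℕ} (hv : v ≤ n) (i : ℕ) :
    p^[i] v ≤ n := by
  induction i with
  | zero => exact hv
  | succ i ih =>
    rw [Function.iterate_succ_apply']
    by_cases h : p^[i] v ∈ Icc 2 n
    · exact (Finset.mem_Icc.1 (hp.1 _ h)).2
    · rw [hp.2.1 _ h]; omega

/-! ### Cycle maxima -/

theorem mem_iterates_max {n : ℕ} {f : ℕ → ℕ} {v : ℕ} : (iterates n f v).max = v ↔
    (∃ j, 1 ≤ j ∧ j ≤ n ∧ f^[j] v = v) ∧ ∀ j, 1 ≤ j → j ≤ n → f^[j] v ≤ v := by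
  constructor
  · intro h
    refine ⟨?_, fun j h1 h2 => ?_⟩
    · have := Finset.mem_of_max h
      simp only [iterates, Finset.mem_image, Finset.mem_Icc] at this
      obtain ⟨j, ⟨h1, h2⟩, h3⟩ := this
      exact ⟨j, h1, h2, h3⟩
    · refine Finset.le_max_of_eq (s := iterates n f v) ?_ h
      exact Finset.mem_image.2 ⟨j, Finset.mem_Icc.2 ⟨h1, h2⟩, rfl⟩
  · rintro ⟨⟨j, h1, h2, h3⟩, h4⟩
    apply le_antisymm
    · apply Finset.max_le
      intro a ha
      simp only [iterates, Finset.mem_image, Finset.mem_Icc] at ha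
      obtain ⟨i, ⟨hi1, hi2⟩, rfl⟩ := ha
      exact WithBot.coe_le_coe.2 (h4 i hi1 hi2)
    · apply Finset.le_max
      exact Finset.mem_image.2 ⟨j, Finset.mem_Icc.2 ⟨h1, h2⟩, h3⟩

/-- The cap `n` on the number of iterations is harmless: bounds for one period extend by
periodicity, and conversely the minimal period is at most `n`. -/
theorem mem_cycleMaxima {n : ℕ} {f : ℕ → ℕ} {v : ℕ} : v ∈ cycleMaxima n f ↔
    v ∈ Icc 2 (n - 1) ∧ (∃ j, 1 ≤ j ∧ f^[j] v = v) ∧ ∀ j, f^[j] v ≤ v := by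
  rw [cycleMaxima, Finset.mem_filter, mem_iterates_max]
  refine and_congr_right fun hv => ?_
  constructor
  · rintro ⟨⟨j, h1, h2, h3⟩, h4⟩
    refine ⟨⟨j, h1, h3⟩, fun i => ?_⟩
    have h5 : f^[i] v = f^[i % j] v := (Function.IsPeriodicPt.iterate_mod_apply h3 i).symm
    have := Nat.mod_lt i h1
    rw [h5]
    rcases Nat.eq_zero_or_pos (i % j) with h6 | h6
    · rw [h6]; exact le_rfl
    · exact h4 _ h6 (by omega)
  · rintro ⟨⟨j, h1, h3⟩, h4⟩
    refine ⟨⟨Function.minimalPeriod f v, ?_, ?_, Function.iterate_minimalPeriod⟩, fun j _ _ => h4 j⟩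
    · exact Function.IsPeriodicPt.minimalPeriod_pos h1 h3
    -- Within one minimal period the iterates are distinct and lie in `{0, …, v}`, so the period is
    -- at most `v + 1 ≤ n`.
    · have h5 := Finset.card_le_card_of_injOn (s := range (Function.minimalPeriod f v))
        (t := range (v + 1)) (fun i => f^[i] v)
        (fun i _ => by simpa [Nat.lt_succ_iff] using h4 i)
        (fun a ha b hb hab => Function.iterate_injOn_Iio_minimalPeriod
          (by simpa using ha) (by simpa using hb) hab)
      simp only [Finset.card_range, Finset.mem_Icc] at h5 hv
      omega

/-- A finite orbit contains a cycle. -/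
theorem exists_cycle_max {n : ℕ} {f : ℕ → ℕ} {v : ℕ} (h : ∀ j, f^[j] v ∈ Icc 2 (n - 1)) :
    ∃ j, f^[j] v ∈ cycleMaxima n f := by
  obtain ⟨i, j, hij, heq⟩ := Set.Finite.exists_lt_map_eq_of_forall_mem (f := fun j => f^[j] v)
    (t := (Icc 2 (n - 1) : Finset ℕ)) (fun j => by exact_mod_cast h j) (Finset.finite_toSet _)
  classical
  -- Behind the first repetition the orbit is periodic; its largest element is the required cycle
  -- maximum.
  have hne : ((Icc 2 (n - 1)).filter (fun m => ∃ t, m = f^[t] (f^[i] v))).Nonempty :=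
    ⟨f^[i] v, Finset.mem_filter.2 ⟨h i, 0, rfl⟩⟩
  obtain ⟨m, hm, hmax⟩ := Finset.exists_max_image _ id hne
  obtain ⟨_, t, rfl⟩ := Finset.mem_filter.1 hm
  refine ⟨t + i, ?_⟩
  rw [Function.iterate_add_apply]
  have hper : f^[j - i] (f^[i] v) = f^[i] v := by
    rw [← Function.iterate_add_apply, Nat.sub_add_cancel hij.le, heq]
  refine mem_cycleMaxima.2 ⟨(Finset.mem_filter.1 hm).1, ⟨j - i, by omega, ?_⟩, fun s => ?_⟩
  · rw [← Function.iterate_add_apply, add_comm, Function.iterate_add_apply, hper]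
  · rw [← Function.iterate_add_apply]
    refine hmax _ (Finset.mem_filter.2 ⟨?_, _, rfl⟩)
    rw [← Function.iterate_add_apply]; exact h _

theorem nextLeft_cases (n : ℕ) (f : ℕ → ℕ) (v : ℕ) :
    (∃ c ∈ cycleMaxima n f, c < v ∧ (∀ c' ∈ cycleMaxima n f, c' < v → c' ≤ c) ∧
      nextLeft n f v = f c) ∨
    (∀ c ∈ cycleMaxima n f, ¬ c < v) ∧ nextLeft n f v = 1 := by
  by_cases h : ((cycleMaxima n f).filter (fun m => m < v)).Nonempty
  · left
    have hm := Finset.max'_mem _ h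
    rw [Finset.mem_filter] at hm
    refine ⟨_, hm.1, hm.2, fun c' h1 h2 => ?_, ?_⟩
    · exact Finset.le_max' _ _ (Finset.mem_filter.2 ⟨h1, h2⟩)
    · rw [nextLeft, dif_pos h]
  · right
    refine ⟨fun c hc hcv => h ⟨c, Finset.mem_filter.2 ⟨hc, hcv⟩⟩, ?_⟩
    rw [nextLeft, dif_neg h]

theorem nextLeft_eq {n : ℕ} {f : ℕ → ℕ} {v c : ℕ} (hc : c ∈ cycleMaxima n f) (hcv : c < v)
    (h : ∀ c' ∈ cycleMaxima n f, c' < v → c' ≤ c) : nextLeft n f v = f c := by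
  rcases nextLeft_cases n f v with ⟨c', h1, h2, h3, h4⟩ | ⟨h1, _⟩
  · rw [h4, le_antisymm (h c' h1 h2) (h3 c hc hcv)]
  · exact absurd hcv (h1 c hc)

/-- The parent function of `Θ(f)`. -/
def thetaParent (n : ℕ) (f : ℕ → ℕ) (v : ℕ) : ℕ :=
  if v = n ∨ v ∈ cycleMaxima n f then nextLeft n f v else f v

theorem Theta_eq_edges {n : ℕ} (hn : 2 ≤ n) (f : ℕ → ℕ) : Theta n f = edges n (thetaParent n f) := by
  ext ⟨a, b⟩
  rw [mem_edges]
  have hC : ∀ v, v ∈ cycleMaxima n f → v ∈ Icc 2 (n - 1) := fun v hv => (mem_cycleMaxima.1 hv).1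
  simp only [Theta, graph, thetaParent, Finset.mem_union, Finset.mem_sdiff, Finset.mem_image,
    Prod.mk.injEq, Finset.mem_insert]
  constructor
  · rintro (⟨⟨i, hi, rfl, rfl⟩, h⟩ | ⟨v, hv, rfl, rfl⟩)
    · have h1 : i ∉ cycleMaxima n f := fun hc => h ⟨i, hc, rfl, rfl⟩
      rw [Finset.mem_Icc] at *
      rw [if_neg (by simp only [h1, or_false]; omega)]
      exact ⟨by omega, rfl⟩
    · rw [if_pos hv]
      refine ⟨?_, rfl⟩
      rcases hv with rfl | hv
      · simp [hn]
      · have := hC _ hv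
        rw [Finset.mem_Icc] at *; omega
  · rintro ⟨ha, h⟩
    split_ifs at h with hv
    · exact Or.inr ⟨a, hv, rfl, h⟩
    · left
      push Not at hv
      rw [Finset.mem_Icc] at *
      refine ⟨⟨a, Finset.mem_Icc.2 (by omega), rfl, h⟩, ?_⟩
      rintro ⟨m, hm, rfl, _⟩
      exact hv.2 hm

/-! ### `Θ(f)` is a tree -/

section Forward

variable {n : ℕ} {f : ℕ → ℕ}

theorem functions_zero (hf : f ∈ functions n) : f 0 = 0 := hf.2 0 (by simp)

theorem thetaParent_of_mem {c : ℕ} (hc : c = n ∨ c ∈ cycleMaxima n f) :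
    thetaParent n f c = nextLeft n f c := if_pos hc

theorem thetaParent_of_notMem {c : ℕ} (hc : ¬ (c = n ∨ c ∈ cycleMaxima n f)) :
    thetaParent n f c = f c := if_neg hc

theorem thetaParent_eq_zero (hn : 2 ≤ n) (hf : f ∈ functions n) (i : ℕ) (hi : i ∉ Icc 2 n) :
    thetaParent n f i = 0 := by
  rw [thetaParent_of_notMem, hf.2]
  · simp only [Finset.mem_Icc] at *; omega
  · rintro (rfl | h)
    · simp at hi; omega
    · have := (mem_cycleMaxima.1 h).1
      simp only [Finset.mem_Icc] at *; omega

/-- The parent function of `Θ(f)` runs through a cycle from its left end to its maximum. -/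
theorem exists_cycle_walk {c : ℕ} (hc : c ∈ cycleMaxima n f) :
    ∃ l, (thetaParent n f)^[l] (f c) = c ∧ ∀ i ≤ l, (thetaParent n f)^[i] (f c) ≤ c := by
  obtain ⟨hc1, hper, hle⟩ := mem_cycleMaxima.1 hc
  classical
  have hs := Nat.find_spec hper
  have hmin : ∀ i, 1 ≤ i → i < Nat.find hper → f^[i] c ≠ c := fun i h1 h2 h3 =>
    Nat.find_min hper h2 ⟨h1, h3⟩
  generalize Nat.find hper = j at hs hmin
  obtain ⟨l, rfl⟩ : ∃ l, j = l + 1 := ⟨j - 1, by omega⟩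
  have key : ∀ i ≤ l, (thetaParent n f)^[i] (f c) = f^[i + 1] c := by
    intro i hi
    induction i with
    | zero => rfl
    | succ i ih =>
      rw [Function.iterate_succ_apply', ih (by omega), Function.iterate_succ_apply' f (i + 1)]
      -- A vertex strictly inside the walk lies on the cycle of `c` and differs from `c`. It is not
      -- a cycle maximum, because `c` is one of its iterates and is larger.
      apply thetaParent_of_notMem
      rw [Finset.mem_Icc] at hc1
      have h1 := hle (i + 1)
      have h2 := hmin (i + 1) (by omega) (by omega)
      rintro (h | h)
      · omega
      · have := (mem_cycleMaxima.1 h).2.2 (l - i)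
        rw [← Function.iterate_add_apply, show l - i + (i + 1) = l + 1 by omega, hs.2] at this
        omega
  exact ⟨l, by rw [key l le_rfl, hs.2], fun i hi => by rw [key i hi]; exact hle _⟩

/-- The path from a cycle maximum (or `n`) to the root. -/
theorem path_spec (hn : 2 ≤ n) (hf : f ∈ functions n) {c : ℕ} (hc : c = n ∨ c ∈ cycleMaxima n f) :
    (∃ i, (thetaParent n f)^[i] c = 1) ∧
    (∀ i, 1 ≤ i → (thetaParent n f)^[i] c ≤ 1 ∨ ∃ c' ∈ cycleMaxima n f, c' < c ∧
      (thetaParent n f)^[i] c ≤ c' ∧ ∃ j, (thetaParent n f)^[j] ((thetaParent n f)^[i] c) = c') ∧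
    ∀ c' ∈ cycleMaxima n f, c' < c → ∃ j, (thetaParent n f)^[j] c = c' := by
  -- The parent of `c` is the left end of the cycle with the next smaller maximum `d`. The walk
  -- through that cycle ends at `d`, where the induction hypothesis takes over.
  induction c using Nat.strong_induction_on with
  | _ c ih =>
    have hp := thetaParent_of_mem hc
    rcases nextLeft_cases n f c with ⟨d, hd, hdc, hdmax, hd'⟩ | ⟨hnone, h1⟩
    · obtain ⟨⟨i0, hi0⟩, ih2, ih3⟩ := ih d hdc (Or.inr hd)
      obtain ⟨l, hl, hl'⟩ := exists_cycle_walk hd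
      rw [hd'] at hp
      have hcd : (thetaParent n f)^[l + 1] c = d := by
        rw [Function.iterate_succ_apply, hp, hl]
      refine ⟨⟨i0 + (l + 1), by rw [Function.iterate_add_apply, hcd, hi0]⟩, ?_, ?_⟩
      · intro i hi
        rcases Nat.lt_or_ge (l + 1) i with h | h
        · obtain ⟨t, rfl⟩ : ∃ t, i = t + (l + 1) := ⟨i - (l + 1), by omega⟩
          rw [Function.iterate_add_apply, hcd]
          rcases ih2 t (by omega) with h3 | ⟨c', h3, h4, h5⟩
          · exact Or.inl h3
          · exact Or.inr ⟨c', h3, by omega, h5⟩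
        · obtain ⟨t, rfl⟩ : ∃ t, i = t + 1 := ⟨i - 1, by omega⟩
          right
          refine ⟨d, hd, hdc, ?_, l - t, ?_⟩
          · rw [Function.iterate_succ_apply, hp]; exact hl' t (by omega)
          · rw [← Function.iterate_add_apply, show l - t + (t + 1) = l + 1 by omega, hcd]
      · intro c' hc' hc'c
        have := hdmax c' hc' hc'c
        rcases Nat.lt_or_ge c' d with h | h
        · obtain ⟨j, hj⟩ := ih3 c' hc' h
          exact ⟨j + (l + 1), by rw [Function.iterate_add_apply, hcd, hj]⟩
        · exact ⟨l + 1, by rw [hcd]; omega⟩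
    · rw [h1] at hp
      refine ⟨⟨1, hp⟩, fun i hi => Or.inl ?_, fun c' h2 h3 => absurd h3 (hnone c' h2)⟩
      obtain ⟨t, rfl⟩ : ∃ t, i = t + 1 := ⟨i - 1, by omega⟩
      rw [Function.iterate_succ_apply, hp]
      exact iterate_parent_of_le_one (thetaParent_eq_zero hn hf) le_rfl t

theorem nextLeft_mem (hn : 2 ≤ n) (hf : f ∈ functions n) (v : ℕ) : nextLeft n f v ∈ Icc 1 n := by
  rcases nextLeft_cases n f v with ⟨c, h1, _, _, h2⟩ | ⟨_, h2⟩
  · rw [h2]; exact hf.1 c (mem_cycleMaxima.1 h1).1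
  · rw [h2, Finset.mem_Icc]; omega

/-- The orbit of `v` under `f` is followed until it leaves the domain or meets a cycle maximum. So
far the parents in `Θ(f)` agree with `f`; the stopping point is `1`, or `n`, or a maximum, and
`path_spec` leads on to the root. -/
theorem thetaParent_mem_parents (hn : 2 ≤ n) (hf : f ∈ functions n) :
    thetaParent n f ∈ parents n := by
  refine ⟨?_, thetaParent_eq_zero hn hf, ?_⟩
  · intro i hi
    rw [thetaParent]
    split_ifs with h
    · exact nextLeft_mem hn hf i
    · push Not at h
      apply hf.1
      simp only [Finset.mem_Icc] at *; omega
  · intro v hv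
    classical
    -- An orbit that never leaves the domain runs into a cycle, hence also through its maximum.
    have hex : ∃ j, f^[j] v ∉ Icc 2 (n - 1) ∨ f^[j] v ∈ cycleMaxima n f := by
      by_contra hcon
      push Not at hcon
      obtain ⟨j, hj⟩ := exists_cycle_max (fun j => (hcon j).1)
      exact (hcon j).2 hj
    have hs := Nat.find_spec hex
    have hmin : ∀ i, i < Nat.find hex → f^[i] v ∈ Icc 2 (n - 1) ∧ f^[i] v ∉ cycleMaxima n f :=
      fun i hi => by have := Nat.find_min hex hi; push Not at this; exact this
    generalize Nat.find hex = j at hs hmin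
    have key : ∀ i ≤ j, (thetaParent n f)^[i] v = f^[i] v := by
      intro i hi
      induction i with
      | zero => rfl
      | succ i ih =>
        rw [Function.iterate_succ_apply', ih (by omega), Function.iterate_succ_apply']
        obtain ⟨h1, h2⟩ := hmin i (by omega)
        apply thetaParent_of_notMem
        rw [Finset.mem_Icc] at h1
        simp only [h2, or_false]; omega
    have hrange : f^[j] v ∈ Icc 1 n := by
      cases j with
      | zero => simp only [Finset.mem_Icc, Function.iterate_zero, id] at *; omega
      | succ j =>
        rw [Function.iterate_succ_apply']
        exact hf.1 _ (hmin j (by omega)).1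
    have hend : f^[j] v = 1 ∨ f^[j] v = n ∨ f^[j] v ∈ cycleMaxima n f := by
      rcases hs with h | h
      · simp only [Finset.mem_Icc] at h hrange; omega
      · exact Or.inr (Or.inr h)
    rcases hend with h | h
    · exact ⟨j, by rw [key j le_rfl, h]⟩
    · obtain ⟨i, hi⟩ := (path_spec hn hf h).1
      exact ⟨i + j, by rw [Function.iterate_add_apply, key j le_rfl, hi]⟩

end Forward

/-! ### The inverse of `Θ` -/

open Classical in
/-- The vertices on the path from `n` to the root, other than the ends, that are larger than all
later ones. -/
noncomputable def records (n : ℕ) (p : ℕ → ℕ) : Finset ℕ :=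
  (Icc 2 (n - 1)).filter (fun v => (∃ j, p^[j] n = v) ∧ ∀ i, 1 ≤ i → p^[i] v < v)

theorem mem_records {n : ℕ} {p : ℕ → ℕ} {v : ℕ} : v ∈ records n p ↔
    v ∈ Icc 2 (n - 1) ∧ (∃ j, p^[j] n = v) ∧ ∀ i, 1 ≤ i → p^[i] v < v := by
  classical
  simp only [records, Finset.mem_filter]

/-- The smallest element of `R ∪ {n}` above `v`. -/
def above (n : ℕ) (R : Finset ℕ) (v : ℕ) : ℕ :=
  if h : (R.filter (fun m => v < m)).Nonempty then (R.filter (fun m => v < m)).min' h else n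

theorem above_spec {n : ℕ} {R : Finset ℕ} {v : ℕ} (hR : ∀ r ∈ R, r < n) (hv : v < n) :
    (above n R v = n ∨ above n R v ∈ R) ∧ v < above n R v ∧
      ∀ r, r = n ∨ r ∈ R → v < r → above n R v ≤ r := by
  rw [above]
  split_ifs with h
  · have hm := Finset.min'_mem _ h
    rw [Finset.mem_filter] at hm
    refine ⟨Or.inr hm.1, hm.2, ?_⟩
    rintro r (rfl | hr) hvr
    · exact (hR _ hm.1).le
    · exact Finset.min'_le _ _ (Finset.mem_filter.2 ⟨hr, hvr⟩)
  · refine ⟨Or.inl rfl, hv, ?_⟩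
    rintro r (rfl | hr) hvr
    · exact le_rfl
    · exact absurd ⟨r, Finset.mem_filter.2 ⟨hr, hvr⟩⟩ h

theorem above_eq {n : ℕ} {R : Finset ℕ} {v u : ℕ} (hR : ∀ r ∈ R, r < n) (hu : u = n ∨ u ∈ R)
    (hvu : v < u) (h : ∀ r ∈ R, r < u → r ≤ v) : above n R v = u := by
  have hv : v < n := by rcases hu with rfl | hu; exacts [hvu, hvu.trans (hR u hu)]
  obtain ⟨h1, h2, h3⟩ := above_spec hR hv
  have h4 := h3 u hu hvu
  rcases h1 with h1 | h1
  · rcases hu with hu | hu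
    · omega
    · have := hR u hu; omega
  · by_contra hne
    have := h _ h1 (by omega)
    omega

/-- The function `f` with `Θ(f)` the tree with parent function `p`. -/
noncomputable def thetaInvFun (n : ℕ) (p : ℕ → ℕ) (v : ℕ) : ℕ :=
  if v ∈ records n p then p (above n (records n p) v) else if v = n then 0 else p v

theorem records_lt {n : ℕ} (hn : 2 ≤ n) {p : ℕ → ℕ} : ∀ r ∈ records n p, r < n := fun r hr => by
  have := (mem_records.1 hr).1
  rw [Finset.mem_Icc] at this; omega

theorem cycleMaxima_lt {n : ℕ} (hn : 2 ≤ n) {f : ℕ → ℕ} : ∀ r ∈ cycleMaxima n f, r < n :=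
  fun r hr => by
    have := (mem_cycleMaxima.1 hr).1
    rw [Finset.mem_Icc] at this; omega

/-- By `path_spec` each vertex at least `2` behind `n` on the path is bounded by, and leads to, some
cycle maximum. If it exceeds everything later, it must be that maximum. Conversely, everything after
a maximum is bounded by smaller maxima. -/
theorem records_thetaParent {n : ℕ} {f : ℕ → ℕ} (hn : 2 ≤ n) (hf : f ∈ functions n) :
    records n (thetaParent n f) = cycleMaxima n f := by
  ext v
  constructor
  · intro hv
    obtain ⟨h1, ⟨j, hj⟩, h3⟩ := mem_records.1 hv
    rw [Finset.mem_Icc] at h1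
    have hj1 : 1 ≤ j := by
      rcases Nat.eq_zero_or_pos j with rfl | h
      · simp at hj; omega
      · exact h
    rcases (path_spec hn hf (Or.inl rfl)).2.1 j hj1 with h | ⟨c, hc, _, hvc, i, hi⟩
    · omega
    · rw [hj] at hvc hi
      rcases Nat.eq_zero_or_pos i with rfl | h
      · rw [show v = c from hi]; exact hc
      · have := h3 i h; omega
  · intro hv
    have h1 := (mem_cycleMaxima.1 hv).1
    refine mem_records.2 ⟨h1, (path_spec hn hf (Or.inl rfl)).2.2 v hv (cycleMaxima_lt hn v hv), ?_⟩
    intro i hi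
    rw [Finset.mem_Icc] at h1
    rcases (path_spec hn hf (Or.inr hv)).2.1 i hi with h | ⟨c, hc, h4, h5, _⟩ <;> omega

/-- The maximum `v` is the largest one below its successor in the set of maxima and `n`, so this
successor was linked to `f v`. -/
theorem thetaInvFun_thetaParent {n : ℕ} {f : ℕ → ℕ} (hn : 2 ≤ n) (hf : f ∈ functions n) :
    thetaInvFun n (thetaParent n f) = f := by
  funext v
  rw [thetaInvFun, records_thetaParent hn hf]
  split_ifs with h1 h2
  · obtain ⟨h3, h4, h5⟩ := above_spec (cycleMaxima_lt hn) (cycleMaxima_lt hn v h1)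
    rw [thetaParent_of_mem h3]
    refine nextLeft_eq h1 h4 (fun c hc hlt => ?_)
    by_contra hcon
    have := h5 c (Or.inr hc) (by omega)
    omega
  · rw [h2, hf.2]
    simp; omega
  · exact thetaParent_of_notMem (by simp [h1, h2])

/-! ### Every tree is of the form `Θ(f)` -/

section Backward

variable {n : ℕ} {p : ℕ → ℕ}

/-- The largest vertex of a final part of the path from `n` is a record. -/
theorem exists_record (hp : p ∈ parents n) {u : ℕ} (hu : 2 ≤ u) (hpath : ∃ j, p^[j] n = u)
    (hun : ∀ i, p^[i] u ≠ n) : ∃ i, p^[i] u ∈ records n p ∧ ∀ j, p^[j] u ≤ p^[i] u := by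
  obtain ⟨j0, hj0⟩ := hpath
  have hle : ∀ i, p^[i] u ≤ n := fun i => by
    rw [← hj0, ← Function.iterate_add_apply]; exact iterate_parent_le hp le_rfl _
  classical
  have hne : ((range (n + 1)).filter (fun m => ∃ t, m = p^[t] u)).Nonempty :=
    ⟨u, Finset.mem_filter.2 ⟨by have := hle 0; simp at *; omega, 0, rfl⟩⟩
  obtain ⟨m, hm, hmax⟩ := Finset.exists_max_image _ id hne
  obtain ⟨_, t, rfl⟩ := Finset.mem_filter.1 hm
  have hmax' : ∀ j, p^[j] u ≤ p^[t] u := fun j =>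
    hmax _ (Finset.mem_filter.2 ⟨Finset.mem_range.2 (by have := hle j; omega), j, rfl⟩)
  refine ⟨t, mem_records.2 ⟨?_, ⟨t + j0, by rw [Function.iterate_add_apply, hj0]⟩, ?_⟩, hmax'⟩
  · have h1 := hmax' 0
    have h2 := hun t
    have h3 := hle t
    simp only [Function.iterate_zero, id, Finset.mem_Icc] at *
    omega
  · intro i hi
    have h1 := hmax' (i + t)
    have h2 := hmax' 0
    simp only [Function.iterate_zero, id] at h2
    -- The largest vertex does not recur, which makes the inequality for later vertices strict.
    have h3 := iterate_parent_ne hp (v := p^[t] u) (by omega) hi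
    rw [Function.iterate_add_apply] at h1
    omega

theorem thetaInvFun_mem_functions (hn : 2 ≤ n) (hp : p ∈ parents n) :
    thetaInvFun n p ∈ functions n := by
  constructor
  · intro i hi
    rw [thetaInvFun]
    split_ifs with h1 h2
    · obtain ⟨h3, h4, h5⟩ := above_spec (records_lt (p := p) hn) (records_lt hn i h1)
      apply hp.1
      have h6 := h5 n (Or.inl rfl) (records_lt hn i h1)
      rw [Finset.mem_Icc] at hi ⊢; omega
    · subst h2; simp at hi; omega
    · apply hp.1; rw [Finset.mem_Icc] at *; omega
  · intro i hi
    rw [thetaInvFun]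
    split_ifs with h1 h2
    · exact absurd (mem_records.1 h1).1 hi
    · rfl
    · apply hp.2.1; rw [Finset.mem_Icc] at *; omega

theorem iterate_ne_top (hn : 2 ≤ n) (hp : p ∈ parents n) {q i : ℕ} (hq : q = n ∨ q ∈ records n p)
    (hi : 1 ≤ i) : p^[i] q ≠ n := by
  rcases hq with rfl | hq
  · exact iterate_parent_ne hp hn hi
  · have h1 := (mem_records.1 hq).2.2 i hi
    have h2 := records_lt hn q hq
    omega

/-- Let `q` be the next larger record, or `n`. The path from `p q` to `r` contains no record before
`r`, so the reconstructed function follows it, and it sends `r` back to `p q`: the segment is closed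
to a cycle. Its largest vertex is `r`, since the largest vertex of the path from `p q` on is itself
a record and thus does not come before `r`. -/
theorem records_subset_cycleMaxima (hn : 2 ≤ n) (hp : p ∈ parents n) :
    records n p ⊆ cycleMaxima n (thetaInvFun n p) := by
  intro r hr
  obtain ⟨hr1, ⟨b, hb⟩, hr3⟩ := mem_records.1 hr
  obtain ⟨hq, hrq, hqmin⟩ := above_spec (records_lt hn) (records_lt hn r hr)
  have hfr : thetaInvFun n p r = p (above n (records n p) r) := if_pos hr
  generalize above n (records n p) r = q at *
  have hqpath : ∃ a, p^[a] n = q := by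
    rcases hq with rfl | hq
    · exact ⟨0, rfl⟩
    · exact (mem_records.1 hq).2.1
  obtain ⟨a, ha⟩ := hqpath
  -- On the path `q` comes before `r`; otherwise the larger vertex `q` would come after the record
  -- `r`, or be equal to it.
  have hab : a < b := by
    by_contra hcon
    have h1 : p^[a - b] r = q := by
      rw [← hb, ← Function.iterate_add_apply, Nat.sub_add_cancel (by omega), ha]
    rcases Nat.eq_zero_or_pos (a - b) with h2 | h2
    · rw [h2] at h1; simp at h1; omega
    · have := hr3 _ h2; omega
  obtain ⟨l, rfl⟩ : ∃ l, b = l + 1 + a := ⟨b - a - 1, by omega⟩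
  have hl : p^[l] (p q) = r := by
    rw [← Function.iterate_succ_apply, ← ha, ← Function.iterate_add_apply, hb]
  -- An intermediate record would exceed the later vertex `r`, hence be at least `q` by the choice
  -- of `q`, although it comes after `q`.
  have hu : ∀ i < l, p^[i] (p q) ∉ records n p := by
    intro i hi hrec
    have h1 := (mem_records.1 hrec).2.2 (l - i) (by omega)
    rw [← Function.iterate_add_apply, Nat.sub_add_cancel hi.le, hl] at h1
    have h2 := hqmin _ (Or.inr hrec) h1
    rcases hq with rfl | hq
    · have := records_lt hn _ hrec; omega
    · have := (mem_records.1 hq).2.2 (i + 1) (by omega)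
      rw [Function.iterate_succ_apply] at this
      omega
  have hne : ∀ i, p^[i] (p q) ≠ n := fun i => by
    rw [← Function.iterate_succ_apply]; exact iterate_ne_top hn hp hq (by omega)
  have key : ∀ i ≤ l, (thetaInvFun n p)^[i + 1] r = p^[i] (p q) := by
    intro i hi
    induction i with
    | zero => exact hfr
    | succ i ih =>
      rw [Function.iterate_succ_apply', ih (by omega), Function.iterate_succ_apply' p i,
        thetaInvFun, if_neg (hu i (by omega)), if_neg (hne i)]
  have hpq2 : 2 ≤ p q := by
    by_contra hcon
    have := iterate_parent_of_le_one hp.2.1 (v := p q) (by omega) l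
    rw [Finset.mem_Icc] at hr1; omega
  obtain ⟨i, hi, himax⟩ := exists_record hp hpq2
    ⟨a + 1, by rw [Function.iterate_succ_apply', ha]⟩ hne
  -- The largest vertex of the remaining path is a record, so it is not among the record-free
  -- positions before `r`.
  have hil : l ≤ i := by
    by_contra hcon
    exact hu i (by omega) hi
  have hir : p^[i] (p q) ≤ r := by
    obtain ⟨t, rfl⟩ : ∃ t, i = t + l := ⟨i - l, by omega⟩
    rw [Function.iterate_add_apply, hl]
    rcases Nat.eq_zero_or_pos t with rfl | ht
    · exact le_rfl
    · exact (hr3 t ht).le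
  have hper : (thetaInvFun n p)^[l + 1] r = r := by rw [key l le_rfl, hl]
  refine mem_cycleMaxima.2 ⟨hr1, ⟨l + 1, by omega, hper⟩, fun j => ?_⟩
  rw [← Function.IsPeriodicPt.iterate_mod_apply hper j]
  have hlt := Nat.mod_lt j (show 0 < l + 1 by omega)
  generalize j % (l + 1) = s at *
  cases s with
  | zero => exact le_rfl
  | succ s =>
    rw [key s (by omega)]
    exact (himax s).trans hir

/-- A cycle through a record has that record as its maximum, by the preceding inclusion. A cycle
without records would be a cycle of the tree, as the reconstructed function follows `p` away from
the records. -/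
theorem cycleMaxima_thetaInvFun (hn : 2 ≤ n) (hp : p ∈ parents n) :
    cycleMaxima n (thetaInvFun n p) = records n p := by
  refine Finset.Subset.antisymm (fun v hv => ?_) (records_subset_cycleMaxima hn hp)
  obtain ⟨hv1, ⟨j, hj, hper⟩, hle⟩ := mem_cycleMaxima.1 hv
  by_cases hex : ∃ i, (thetaInvFun n p)^[i] v ∈ records n p
  · obtain ⟨i, hi⟩ := hex
    -- Continuing to `j * i` steps in total leads from the record back to `v`. So `v` is at most the
    -- record, and being the maximum of the cycle it equals it.
    have h1 := (mem_cycleMaxima.1 (records_subset_cycleMaxima hn hp hi)).2.2 (j * i - i)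
    rw [← Function.iterate_add_apply, Nat.sub_add_cancel (Nat.le_mul_of_pos_left i hj),
      Function.iterate_mul, Function.iterate_fixed hper] at h1
    have h2 := hle i
    rw [show v = (thetaInvFun n p)^[i] v by omega]
    exact hi
  · exfalso
    push Not at hex
    have hfmem := thetaInvFun_mem_functions hn hp
    have hIcc : ∀ i, (thetaInvFun n p)^[i] v ∈ Icc 2 (n - 1) := by
      intro i
      by_contra hcon
      have h1 : ∀ t, (thetaInvFun n p)^[t + 1 + i] v = 0 := by
        intro t
        rw [Function.iterate_add_apply, Function.iterate_succ_apply, hfmem.2 _ hcon]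
        exact Function.iterate_fixed (functions_zero hfmem) t
      have h2 : (thetaInvFun n p)^[j * (i + 1)] v = v := by
        rw [Function.iterate_mul, Function.iterate_fixed hper]
      have h3 := h1 (j * (i + 1) - (i + 1))
      have h4 := Nat.le_mul_of_pos_left (i + 1) hj
      rw [show j * (i + 1) - (i + 1) + 1 + i = j * (i + 1) by omega, h2] at h3
      simp [h3] at hv1
    have key : ∀ i, (thetaInvFun n p)^[i] v = p^[i] v := by
      intro i
      induction i with
      | zero => rfl
      | succ i ih =>
        have h1 := hex i
        have h2 := hIcc i
        rw [ih] at h1 h2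
        rw [Function.iterate_succ_apply', ih, Function.iterate_succ_apply', thetaInvFun, if_neg h1,
          if_neg]
        rw [Finset.mem_Icc] at h2; omega
    rw [key j] at hper
    rw [Finset.mem_Icc] at hv1
    exact iterate_parent_ne hp hv1.1 hj hper

/-- A record, or `n`, with a smaller record below it recovers its parent through the next smaller
record. If there is none, its parent must be `1`. -/
theorem thetaParent_thetaInvFun (hn : 2 ≤ n) (hp : p ∈ parents n) :
    thetaParent n (thetaInvFun n p) = p := by
  funext v
  have hC := cycleMaxima_thetaInvFun hn hp
  rw [thetaParent]
  split_ifs with hv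
  · rcases nextLeft_cases n (thetaInvFun n p) v with ⟨c, hc, hcv, hmax, heq⟩ | ⟨hnone, heq⟩
    · rw [heq]
      rw [hC] at hc hmax hv
      rw [thetaInvFun, if_pos hc, above_eq (records_lt hn) hv hcv hmax]
    · rw [heq]
      rw [hC] at hnone hv
      by_contra hcon
      have hv2 : v ∈ Icc 2 n := by
        rcases hv with rfl | hv
        · simp [hn]
        · have := (mem_records.1 hv).1
          rw [Finset.mem_Icc] at *; omega
      have hpv := Finset.mem_Icc.1 (hp.1 v hv2)
      have hpath : ∃ j, p^[j] n = p v := by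
        rcases hv with rfl | hv
        · exact ⟨1, rfl⟩
        · obtain ⟨j, hj⟩ := (mem_records.1 hv).2.1
          exact ⟨j + 1, by rw [Function.iterate_succ_apply', hj]⟩
      -- If the parent were not `1`, the remaining path would contain a record, and this record
      -- would be smaller than `v`.
      obtain ⟨i, hi, _⟩ := exists_record hp (by omega) hpath (fun i => by
        rw [← Function.iterate_succ_apply]; exact iterate_ne_top hn hp hv (by omega))
      apply hnone _ hi
      rcases hv with rfl | hv
      · exact records_lt hn _ hi
      · rw [← Function.iterate_succ_apply]
        exact (mem_records.1 hv).2.2 _ (by omega)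
  · rw [hC] at hv
    push Not at hv
    rw [thetaInvFun, if_neg hv.2, if_neg hv.1]

end Backward

theorem Theta_bijOn {n : ℕ} (hn : 2 ≤ n) : Set.BijOn (Theta n) (functions n) (trees n) := by
  refine ⟨fun f hf => ?_, fun f hf f' hf' h => ?_, fun T hT => ?_⟩
  · rw [Theta_eq_edges hn]; exact edges_mem_trees (thetaParent_mem_parents hn hf)
  · simp only [Theta_eq_edges hn] at h
    have h1 := congrArg treeArray h
    rw [treeArray_edges (thetaParent_eq_zero hn hf),
      treeArray_edges (thetaParent_eq_zero hn hf')] at h1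
    rw [← thetaInvFun_thetaParent hn hf, h1, thetaInvFun_thetaParent hn hf']
  · obtain ⟨h1, h2⟩ := treeArray_spec hT
    refine ⟨thetaInvFun n (treeArray T), thetaInvFun_mem_functions hn h1, ?_⟩
    rw [Theta_eq_edges hn, thetaParent_thetaInvFun hn h1, h2]

theorem ThetaInv_Theta {n : ℕ} (hn : 2 ≤ n) {f : ℕ → ℕ} (hf : f ∈ functions n) :
    ThetaInv n (Theta n f) = f := (Theta_bijOn hn).injOn.leftInvOn_invFunOn hf

theorem ThetaInv_mem {n : ℕ} (hn : 2 ≤ n) {T : Finset (ℕ × ℕ)} (hT : T ∈ trees n) :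
    ThetaInv n T ∈ functions n ∧ Theta n (ThetaInv n T) = T :=
  ⟨(Theta_bijOn hn).surjOn.mapsTo_invFunOn hT, (Theta_bijOn hn).surjOn.rightInvOn_invFunOn hT⟩

/-- Replaces the inverse defined by choice by the explicit one that the ranking programs compute. -/
theorem ThetaInv_eq {n : ℕ} (hn : 2 ≤ n) {T : Finset (ℕ × ℕ)} (hT : T ∈ trees n) :
    ThetaInv n T = thetaInvFun n (treeArray T) := by
  obtain ⟨h1, h2⟩ := treeArray_spec hT
  have h3 : Theta n (thetaInvFun n (treeArray T)) = T := by
    rw [Theta_eq_edges hn, thetaParent_thetaInvFun hn h1, h2]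
  conv_lhs => rw [← h3]
  exact ThetaInv_Theta hn (thetaInvFun_mem_functions hn h1)

/-! ### Leaves -/

theorem mem_missing {n : ℕ} {f : ℕ → ℕ} {v : ℕ} :
    v ∈ missing n f ↔ v ∈ Icc 1 n ∧ ∀ x ∈ Icc 2 (n - 1), f x ≠ v := by
  simp [missing]

theorem outdeg_edges {n : ℕ} {p : ℕ → ℕ} {v : ℕ} :
    outdeg (edges n p) v = if v ∈ Icc 2 n then 1 else 0 := by
  rw [outdeg]
  split_ifs with h
  · rw [Finset.card_eq_one]
    refine ⟨(v, p v), ?_⟩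
    ext ⟨a, b⟩
    rw [Finset.mem_filter, mem_edges, Finset.mem_singleton, Prod.mk.injEq]
    constructor
    · rintro ⟨⟨_, h1⟩, h2⟩
      simp only at h2
      subst h2; exact ⟨rfl, h1.symm⟩
    · rintro ⟨rfl, rfl⟩; exact ⟨⟨h, rfl⟩, rfl⟩
  · rw [Finset.card_eq_zero, Finset.filter_eq_empty_iff]
    rintro ⟨a, b⟩ hab h2
    simp only at h2
    subst h2
    exact h (mem_edges.1 hab).1

theorem indeg_edges {n : ℕ} {p : ℕ → ℕ} {v : ℕ} :
    indeg (edges n p) v = ((Icc 2 n).filter (fun i => p i = v)).card := by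
  rw [indeg, edges, Finset.filter_image, Finset.card_image_of_injective]
  intro a b h
  exact (Prod.mk.inj h).1

/-- Each maximum hands its target over to the next larger maximum or to `n`, so apart from one extra
edge into `1` the edges of the tree have the same targets as those of `f`. A vertex other than `1`
has outdegree one and is a leaf iff it has no incoming edge. The root is a leaf iff the extra edge
is its only incoming one. -/
theorem leaves_Theta {n : ℕ} (hn : 2 ≤ n) {f : ℕ → ℕ} (hf : f ∈ functions n) :
    leaves n (Theta n f) = missing n f := by
  have hClt := cycleMaxima_lt hn (f := f)
  have hCge : ∀ c ∈ cycleMaxima n f, 2 ≤ c := fun c hc =>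
    (Finset.mem_Icc.1 (mem_cycleMaxima.1 hc).1).1
  -- The smallest element of the set of maxima and `n` is the vertex that the extra edge joins to
  -- `1`.
  obtain ⟨x0, hx0, hx0min⟩ : ∃ x0, (x0 = n ∨ x0 ∈ cycleMaxima n f) ∧
      ∀ c, c = n ∨ c ∈ cycleMaxima n f → x0 ≤ c := by
    obtain ⟨x, hx, hmin⟩ := Finset.exists_min_image (insert n (cycleMaxima n f)) id (by simp)
    exact ⟨x, by simpa using hx, fun c hc => hmin c (by simpa using hc)⟩
  have hmemIcc : ∀ c, c = n ∨ c ∈ cycleMaxima n f → c ∈ Icc 2 n := by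
    rintro c (rfl | hc)
    · simp [hn]
    · have := hClt c hc; have := hCge c hc; rw [Finset.mem_Icc]; omega
  have hF3 : thetaParent n f x0 = 1 := by
    rw [thetaParent_of_mem hx0]
    rcases nextLeft_cases n f x0 with ⟨c, hc, hlt, _⟩ | ⟨_, h⟩
    · have := hx0min c (Or.inr hc); omega
    · exact h
  have hF1 : ∀ x ∈ Icc 2 (n - 1), ∃ y ∈ Icc 2 n, y ≠ x0 ∧ thetaParent n f y = f x := by
    intro x hx
    by_cases hxC : x ∈ cycleMaxima n f
    -- The target of the back edge of `x` is now the parent of the next larger maximum, or of `n`;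
    -- being larger than `x`, this vertex is not `x0`.
    · obtain ⟨h3, h4, h5⟩ := above_spec hClt (hClt x hxC)
      refine ⟨_, hmemIcc _ h3, ?_, ?_⟩
      · have := hx0min x (Or.inr hxC); omega
      · rw [thetaParent_of_mem h3]
        refine nextLeft_eq hxC h4 (fun c hc hlt => ?_)
        by_contra hcon
        have := h5 c (Or.inr hc) (by omega)
        omega
    · rw [Finset.mem_Icc] at hx
      have hnot : ¬ (x = n ∨ x ∈ cycleMaxima n f) := by simp only [hxC, or_false]; omega
      refine ⟨x, Finset.mem_Icc.2 (by omega), ?_, thetaParent_of_notMem hnot⟩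
      rintro rfl; exact hnot hx0
  have hF2 : ∀ y ∈ Icc 2 n, y ≠ x0 → ∃ x ∈ Icc 2 (n - 1), f x = thetaParent n f y := by
    intro y hy hyx
    by_cases hyC : y = n ∨ y ∈ cycleMaxima n f
    · rw [thetaParent_of_mem hyC]
      rcases nextLeft_cases n f y with ⟨c, hc, hlt, _, h⟩ | ⟨hnone, _⟩
      · exact ⟨c, (mem_cycleMaxima.1 hc).1, h.symm⟩
      · exfalso
        have h1 := hx0min y hyC
        rcases hx0 with rfl | hx0
        · rw [Finset.mem_Icc] at hy; omega
        · exact hnone x0 hx0 (by omega)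
    · rw [thetaParent_of_notMem hyC]
      push Not at hyC
      rw [Finset.mem_Icc] at hy
      exact ⟨y, Finset.mem_Icc.2 (by omega), rfl⟩
  ext v
  rw [leaves, Finset.mem_filter, mem_missing, deg, Theta_eq_edges hn, outdeg_edges, indeg_edges]
  refine and_congr_right fun hv => ?_
  by_cases hv1 : v = 1
  · subst hv1
    rw [if_neg (by simp), add_zero, Finset.card_eq_one]
    constructor
    · rintro ⟨z, hz⟩ x hx hfx
      have h1 : x0 ∈ ({z} : Finset ℕ) := by
        rw [← hz]; exact Finset.mem_filter.2 ⟨hmemIcc _ hx0, hF3⟩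
      obtain ⟨y, hy, hyx, hpy⟩ := hF1 x hx
      have h2 : y ∈ ({z} : Finset ℕ) := by
        rw [← hz]; exact Finset.mem_filter.2 ⟨hy, by rw [hpy, hfx]⟩
      rw [Finset.mem_singleton] at h1 h2
      omega
    · intro h
      refine ⟨x0, ?_⟩
      ext y
      rw [Finset.mem_filter, Finset.mem_singleton]
      constructor
      · rintro ⟨hy, hpy⟩
        by_contra hne
        obtain ⟨x, hx, hfx⟩ := hF2 y hy hne
        exact h x hx (hfx.trans hpy)
      · rintro rfl; exact ⟨hmemIcc _ hx0, hF3⟩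
  · rw [if_pos (by rw [Finset.mem_Icc] at *; omega), Nat.add_eq_right, Finset.card_eq_zero,
      Finset.filter_eq_empty_iff]
    constructor
    · intro h x hx hfx
      obtain ⟨y, hy, _, hpy⟩ := hF1 x hx
      exact h hy (hpy.trans hfx)
    · intro h y hy hpy
      have hne : y ≠ x0 := by rintro rfl; omega
      obtain ⟨x, hx, hfx⟩ := hF2 y hy hne
      exact h x hx (hfx.trans hpy)


/-! ### Positions in lists -/

theorem findIdx_eq_idxOf {α : Type*} [DecidableEq α] {l : List α} {p : α → Bool} {a : α}
    (h : ∀ b ∈ l, p b = true ↔ b = a) : l.findIdx p = l.idxOf a := by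
  induction l with
  | nil => rfl
  | cons b l ih =>
    rw [List.findIdx_cons, List.idxOf_cons, ih (fun c hc => h c (by simp [hc]))]
    have hb := h b (by simp)
    by_cases hba : b = a
    · rw [hb.2 hba, beq_iff_eq.2 hba]
    · have h1 : p b = false := by rw [← Bool.not_eq_true]; exact fun h => hba (hb.1 h)
      rw [h1, beq_false_of_ne hba]

theorem idxOf_map_of_injOn {α β : Type*} [DecidableEq α] [DecidableEq β] {g : α → β} {l : List α}
    {a : α} (h : ∀ b ∈ l, g b = g a → b = a) : (l.map g).idxOf (g a) = l.idxOf a := by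
  induction l with
  | nil => rfl
  | cons b l ih =>
    rw [List.map_cons, List.idxOf_cons, List.idxOf_cons, ih (fun c hc => h c (by simp [hc]))]
    by_cases hba : b = a
    · simp [hba]
    · have h1 : g b ≠ g a := fun hg => hba (h b (by simp) hg)
      rw [beq_false_of_ne h1, beq_false_of_ne hba]

/-- The position in a sorted list is the number of smaller elements. -/
theorem idxOf_eq_countP {α β : Type*} [DecidableEq α] [LinearOrder β] {key : α → β} {l : List α}
    {a : α} (hl : l.Pairwise (fun x y => key x < key y)) (ha : a ∈ l) :
    l.idxOf a = l.countP (fun b => decide (key b < key a)) := by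
  induction l with
  | nil => simp at ha
  | cons b l ih =>
    rw [List.pairwise_cons] at hl
    rw [List.idxOf_cons]
    by_cases hba : b = a
    · subst hba
      simp only [beq_self_eq_true, cond_true]
      symm
      rw [List.countP_eq_zero]
      intro c hc
      rcases List.mem_cons.1 hc with rfl | hc
      · simp
      · simpa using (hl.1 c hc).le
    · have ha' : a ∈ l := by
        rcases List.mem_cons.1 ha with h | h
        · exact absurd h.symm hba
        · exact h
      rw [List.countP_cons_of_pos (by simpa using hl.1 a ha'), ← ih hl.2 ha']
      rw [beq_false_of_ne hba]; rfl

theorem getD_idxOf {l : List ℕ} {a : ℕ} (h : a ∈ l) : l.getD (l.idxOf a) 0 = a := by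
  rw [List.getD_eq_getElem _ _ (List.idxOf_lt_length_of_mem h), List.getElem_idxOf]

/-! ### Labels: numbering the values of `f` by first occurrence -/

/-- The values of `f`, in increasing order. -/
def presentList (n : ℕ) (f : ℕ → ℕ) : List ℕ := (Icc 1 n \ missing n f).sort (· ≤ ·)

/-- The first element of `{2, …, n-1}` at which `f` takes the value `i`. -/
noncomputable def firstOcc (n : ℕ) (f : ℕ → ℕ) (i : ℕ) : ℕ := sInf {x | x ∈ Icc 2 (n - 1) ∧ f x = i}

/-- The number of different values of `f` on `{2, …, x}`. -/
def valueCount (f : ℕ → ℕ) (x : ℕ) : ℕ := ((Icc 2 x).image f).card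

/-- The position of the value `i` when the values of `f` are ordered by their first occurrence,
and `0` if `i` is not a value. -/
noncomputable def label (n : ℕ) (f : ℕ → ℕ) (i : ℕ) : ℕ :=
  if i ∈ (Icc 2 (n - 1)).image f then valueCount f (firstOcc n f i) else 0

section Label

variable {n : ℕ} {f : ℕ → ℕ}

theorem firstOcc_spec {i : ℕ} (hi : i ∈ (Icc 2 (n - 1)).image f) :
    firstOcc n f i ∈ Icc 2 (n - 1) ∧ f (firstOcc n f i) = i := by
  obtain ⟨x, hx, rfl⟩ := Finset.mem_image.1 hi
  exact Nat.sInf_mem (s := {y | y ∈ Icc 2 (n - 1) ∧ f y = f x}) ⟨x, hx, rfl⟩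

theorem firstOcc_le {x : ℕ} (hx : x ∈ Icc 2 (n - 1)) : firstOcc n f (f x) ≤ x :=
  Nat.sInf_le ⟨hx, rfl⟩

theorem firstOcc_eq {x : ℕ} (hx : x ∈ Icc 2 (n - 1)) (h : ∀ y ∈ Icc 2 (n - 1), y < x → f y ≠ f x) :
    firstOcc n f (f x) = x := by
  obtain ⟨h1, h2⟩ := firstOcc_spec (Finset.mem_image_of_mem f hx)
  by_contra hne
  exact h _ h1 (lt_of_le_of_ne (firstOcc_le hx) hne) h2

theorem valueCount_mono {x y : ℕ} (h : x ≤ y) : valueCount f x ≤ valueCount f y :=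
  Finset.card_le_card (Finset.image_subset_image (Finset.Icc_subset_Icc_right h))

theorem label_of_mem {i : ℕ} (hi : i ∈ (Icc 2 (n - 1)).image f) :
    label n f i = valueCount f (firstOcc n f i) := if_pos hi

theorem label_eq_zero_iff {i : ℕ} : label n f i = 0 ↔ i ∉ (Icc 2 (n - 1)).image f := by
  rw [label]
  split_ifs with h
  · simp only [h, not_true_eq_false, iff_false]
    obtain ⟨h1, h2⟩ := firstOcc_spec h
    have : f (firstOcc n f i) ∈ (Icc 2 (firstOcc n f i)).image f :=
      Finset.mem_image_of_mem f (by rw [Finset.mem_Icc] at *; omega)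
    exact (Finset.card_pos.2 ⟨_, this⟩).ne'
  · simp [h]

/-- At the first occurrence of `i` precisely the values that occurred earlier and `i` itself have
been seen. Hence counting values up to that point ranks them by first occurrence. -/
theorem image_firstOcc {i : ℕ} (hi : i ∈ (Icc 2 (n - 1)).image f) :
    (Icc 2 (firstOcc n f i)).image f =
      insert i (((Icc 2 (n - 1)).image f).filter (fun j => firstOcc n f j < firstOcc n f i)) := by
  obtain ⟨h1, h2⟩ := firstOcc_spec hi
  rw [Finset.mem_Icc] at h1
  ext j
  rw [Finset.mem_insert, Finset.mem_filter]
  constructor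
  · intro hj
    obtain ⟨x, hx, rfl⟩ := Finset.mem_image.1 hj
    rw [Finset.mem_Icc] at hx
    have hx' : x ∈ Icc 2 (n - 1) := by rw [Finset.mem_Icc]; omega
    have h3 := firstOcc_le (f := f) hx'
    by_cases h4 : x = firstOcc n f i
    · left; rw [h4, h2]
    · right; exact ⟨Finset.mem_image_of_mem f hx', by omega⟩
  · rintro (rfl | ⟨hj, hlt⟩)
    · exact Finset.mem_image.2 ⟨_, Finset.mem_Icc.2 ⟨h1.1, le_rfl⟩, h2⟩
    · obtain ⟨h3, h4⟩ := firstOcc_spec hj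
      rw [Finset.mem_Icc] at h3
      exact Finset.mem_image.2 ⟨_, Finset.mem_Icc.2 ⟨h3.1, hlt.le⟩, h4⟩

theorem label_eq_card {i : ℕ} (hi : i ∈ (Icc 2 (n - 1)).image f) :
    label n f i =
      (((Icc 2 (n - 1)).image f).filter (fun j => firstOcc n f j < firstOcc n f i)).card + 1 := by
  rw [label_of_mem hi, valueCount, image_firstOcc hi, Finset.card_insert_of_notMem (by simp)]

theorem label_lt_iff {i j : ℕ} (hi : i ∈ (Icc 2 (n - 1)).image f)
    (hj : j ∈ (Icc 2 (n - 1)).image f) :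
    label n f i < label n f j ↔ firstOcc n f i < firstOcc n f j := by
  have key : ∀ i ∈ (Icc 2 (n - 1)).image f, ∀ j ∈ (Icc 2 (n - 1)).image f,
      firstOcc n f i < firstOcc n f j → label n f i < label n f j := by
    intro i hi j hj h
    rw [label_eq_card hi, label_eq_card hj, Nat.add_lt_add_iff_right]
    apply Finset.card_lt_card
    rw [Finset.ssubset_iff_of_subset]
    · exact ⟨i, Finset.mem_filter.2 ⟨hi, h⟩, by simp⟩
    · intro k hk
      rw [Finset.mem_filter] at *
      exact ⟨hk.1, by omega⟩
  refine ⟨fun h => ?_, key i hi j hj⟩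
  by_contra hcon
  rcases Nat.lt_or_ge (firstOcc n f j) (firstOcc n f i) with h1 | h1
  · have := key j hj i hi h1; omega
  · have h2 : firstOcc n f i = firstOcc n f j := by omega
    rw [label_of_mem hi, label_of_mem hj, h2] at h
    omega

theorem label_injOn : Set.InjOn (label n f) ((Icc 2 (n - 1)).image f) := by
  intro i hi j hj h
  have h1 := label_lt_iff hi hj
  have h2 := label_lt_iff hj hi
  have h3 : firstOcc n f i = firstOcc n f j := by omega
  rw [← (firstOcc_spec hi).2, ← (firstOcc_spec hj).2, h3]

theorem label_le (i : ℕ) : label n f i ≤ ((Icc 2 (n - 1)).image f).card := by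
  rw [label]
  split_ifs with h
  · have := (firstOcc_spec h).1
    rw [Finset.mem_Icc] at this
    exact valueCount_mono this.2
  · exact Nat.zero_le _

theorem sdiff_missing (hf : f ∈ functions n) : Icc 1 n \ missing n f = (Icc 2 (n - 1)).image f := by
  rw [missing, Finset.sdiff_sdiff_eq_self]
  intro i hi
  obtain ⟨x, hx, rfl⟩ := Finset.mem_image.1 hi
  exact hf.1 x hx

theorem mem_presentList (hf : f ∈ functions n) {i : ℕ} :
    i ∈ presentList n f ↔ i ∈ (Icc 2 (n - 1)).image f := by
  rw [presentList, Finset.mem_sort, sdiff_missing hf]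

theorem length_presentList (hf : f ∈ functions n) :
    (presentList n f).length = ((Icc 2 (n - 1)).image f).card := by
  rw [presentList, Finset.length_sort, sdiff_missing hf]

theorem card_missing (hf : f ∈ functions n) :
    (missing n f).card + ((Icc 2 (n - 1)).image f).card = n := by
  rw [← sdiff_missing hf, add_comm, Finset.card_sdiff_add_card_eq_card]
  · simp
  · rw [missing]; exact Finset.sdiff_subset

/-- The labels are distinct numbers from `1` to the number of values. In increasing order of the
values they are the one-line notation of `σ`. -/
theorem map_label_perm (hf : f ∈ functions n) :
    ((presentList n f).map (label n f)).Perm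
      (List.range' 1 ((Icc 2 (n - 1)).image f).card) := by
  rw [perm_range'_iff (by rw [List.length_map, length_presentList hf])]
  constructor
  · apply (Finset.sort_nodup _ _).map_on
    intro x hx y hy hxy
    exact label_injOn ((mem_presentList hf).1 hx) ((mem_presentList hf).1 hy) hxy
  · intro j hj
    obtain ⟨i, hi, rfl⟩ := List.mem_map.1 hj
    refine ⟨Nat.pos_of_ne_zero fun h => ?_, label_le i⟩
    exact label_eq_zero_iff.1 h ((mem_presentList hf).1 hi)

theorem exists_label_eq (hf : f ∈ functions n) {v : ℕ} (hv : v < ((Icc 2 (n - 1)).image f).card) :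
    ∃ i ∈ (Icc 2 (n - 1)).image f, label n f i = v + 1 := by
  have : v + 1 ∈ (presentList n f).map (label n f) := by
    rw [(map_label_perm hf).mem_iff, List.mem_range'_1]; omega
  obtain ⟨i, hi, h⟩ := List.mem_map.1 this
  exact ⟨i, (mem_presentList hf).1 hi, h⟩

/-! ### The parts of the set partition -/

/-- The part that belongs to the value `i`. -/
def part (n : ℕ) (f : ℕ → ℕ) (i : ℕ) : Finset ℕ := (Icc 1 (n - 2)).filter (fun x => f (x + 1) = i)

theorem orderedParts_eq : orderedParts n f = (presentList n f).map (part n f) := rfl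

theorem min_part {i : ℕ} (hi : i ∈ (Icc 2 (n - 1)).image f) :
    (part n f i).min = WithTop.some (firstOcc n f i - 1) := by
  obtain ⟨h1, h2⟩ := firstOcc_spec hi
  rw [Finset.mem_Icc] at h1
  apply le_antisymm
  · apply Finset.min_le
    rw [part, Finset.mem_filter, Finset.mem_Icc, Nat.sub_add_cancel (by omega)]
    exact ⟨by omega, h2⟩
  · apply Finset.le_min
    intro a ha
    rw [part, Finset.mem_filter, Finset.mem_Icc] at ha
    have := firstOcc_le (n := n) (f := f) (x := a + 1) (by rw [Finset.mem_Icc]; omega)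
    rw [ha.2] at this
    exact WithTop.coe_le_coe.2 (by omega)

theorem min_part_lt_iff {i j : ℕ} (hi : i ∈ (Icc 2 (n - 1)).image f)
    (hj : j ∈ (Icc 2 (n - 1)).image f) :
    (part n f i).min < (part n f j).min ↔ firstOcc n f i < firstOcc n f j := by
  have h1 := Finset.mem_Icc.1 (firstOcc_spec hi).1
  have h2 := Finset.mem_Icc.1 (firstOcc_spec hj).1
  rw [min_part hi, min_part hj, WithTop.coe_lt_coe]
  omega

theorem part_injOn : Set.InjOn (part n f) ((Icc 2 (n - 1)).image f) := by
  intro i hi j hj h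
  have h1 := min_part_lt_iff hi hj
  have h2 := min_part_lt_iff hj hi
  rw [h] at h1 h2
  simp only [lt_self_iff_false, false_iff, not_lt] at h1 h2
  rw [← (firstOcc_spec hi).2, ← (firstOcc_spec hj).2, le_antisymm h2 h1]

theorem sortedParts_perm : (sortedParts n f).Perm ((presentList n f).map (part n f)) :=
  List.perm_insertionSort _ _

/-- The order is strict because parts with equal minima belong to the same value of `f`. -/
theorem sortedParts_pairwise (hf : f ∈ functions n) :
    (sortedParts n f).Pairwise (fun A B => A.min < B.min) := by
  have h1 : (sortedParts n f).Pairwise (fun A B => A.min ≤ B.min) := by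
    have : Std.Total (fun A B : Finset ℕ => A.min ≤ B.min) := ⟨fun A B => le_total _ _⟩
    have : IsTrans (Finset ℕ) (fun A B : Finset ℕ => A.min ≤ B.min) :=
      ⟨fun A B C h1 h2 => h1.trans h2⟩
    exact List.pairwise_insertionSort _ _
  have h2 : (sortedParts n f).Pairwise (fun A B => A ≠ B) := by
    apply sortedParts_perm.nodup_iff.2
    apply (Finset.sort_nodup _ _).map_on
    intro x hx y hy hxy
    exact part_injOn ((mem_presentList hf).1 hx) ((mem_presentList hf).1 hy) hxy
  refine (h1.and h2).imp_of_mem fun {A B} hA hB h => ?_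
  obtain ⟨i, hi, rfl⟩ := List.mem_map.1 (sortedParts_perm.mem_iff.1 hA)
  obtain ⟨j, hj, rfl⟩ := List.mem_map.1 (sortedParts_perm.mem_iff.1 hB)
  rw [mem_presentList hf] at hi hj
  refine lt_of_le_of_ne h.1 fun heq => h.2 ?_
  have h3 := min_part_lt_iff hi hj
  have h4 := min_part_lt_iff hj hi
  rw [heq] at h3 h4
  simp only [lt_self_iff_false, false_iff, not_lt] at h3 h4
  rw [← (firstOcc_spec hi).2, ← (firstOcc_spec hj).2, le_antisymm h4 h3]

/-- The position of a part counts the parts with smaller minimum, which are those of the values that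
occur earlier. This lets labels replace the lists of sets in all later arguments. -/
theorem idxOf_part (hf : f ∈ functions n) {i : ℕ} (hi : i ∈ (Icc 2 (n - 1)).image f) :
    (sortedParts n f).idxOf (part n f i) + 1 = label n f i := by
  have hmem : part n f i ∈ sortedParts n f :=
    sortedParts_perm.mem_iff.2 (List.mem_map.2 ⟨i, (mem_presentList hf).2 hi, rfl⟩)
  rw [idxOf_eq_countP (sortedParts_pairwise hf) hmem, sortedParts_perm.countP_eq, List.countP_map,
    label_eq_card hi, List.countP_eq_length_filter]
  congr 1
  have hnd : (presentList n f).Nodup := Finset.sort_nodup _ _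
  rw [← List.toFinset_card_of_nodup (hnd.filter _)]
  congr 1
  ext j
  rw [List.mem_toFinset, List.mem_filter, Finset.mem_filter]
  rw [mem_presentList hf]
  refine and_congr_right fun hj => ?_
  simp only [Function.comp, decide_eq_true_eq]
  exact min_part_lt_iff hj hi

theorem partPerm_eq (hf : f ∈ functions n) :
    partPerm n f = (presentList n f).map (label n f) := by
  rw [partPerm, orderedParts_eq, List.map_map]
  apply List.map_congr_left
  intro i hi
  exact idxOf_part hf ((mem_presentList hf).1 hi)

theorem seqS_eq (hf : f ∈ functions n) :
    seqS n f = (List.range' 1 (n - 2)).map (fun x => label n f (f (x + 1)) - 1) := by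
  apply List.map_congr_left
  intro x hx
  rw [List.mem_range'_1] at hx
  have hx1 : x + 1 ∈ Icc 2 (n - 1) := by rw [Finset.mem_Icc]; omega
  have hi := Finset.mem_image_of_mem f hx1
  rw [← idxOf_part hf hi, Nat.add_sub_cancel]
  apply findIdx_eq_idxOf
  intro A hA
  obtain ⟨j, hj, rfl⟩ := List.mem_map.1 (sortedParts_perm.mem_iff.1 hA)
  rw [mem_presentList hf] at hj
  rw [decide_eq_true_eq]
  constructor
  · intro h
    rw [part, Finset.mem_filter] at h
    rw [h.2]
  · intro h
    rw [h, part, Finset.mem_filter, Finset.mem_Icc]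
    exact ⟨by omega, rfl⟩

theorem length_seqS : (seqS n f).length = n - 2 := by simp [seqS]

theorem getD_seqS (hf : f ∈ functions n) {i : ℕ} (hi : i < n - 2) :
    (seqS n f).getD i 0 = label n f (f (i + 2)) - 1 := by
  rw [seqS_eq hf, List.getD_eq_getElem _ _ (by simpa using hi), List.getElem_map,
    List.getElem_range']
  congr 3; omega

theorem label_pos {x : ℕ} (hx : x ∈ Icc 2 (n - 1)) : 1 ≤ label n f (f x) :=
  Nat.pos_of_ne_zero fun h => label_eq_zero_iff.1 h (Finset.mem_image_of_mem f hx)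

theorem label_first (hn : 3 ≤ n) : label n f (f 2) = 1 := by
  have h2 : 2 ∈ Icc 2 (n - 1) := by rw [Finset.mem_Icc]; omega
  rw [label_of_mem (Finset.mem_image_of_mem f h2), firstOcc_eq h2]
  · simp [valueCount]
  · intro y hy hlt; rw [Finset.mem_Icc] at hy; omega

/-! ### The three sequences of a function, and recovery of the function -/

theorem seqG_mem : seqG n f ∈ decreasingSeqs n (missing n f).card := by
  refine ⟨Finset.length_sort _, ?_, fun x hx => ?_⟩
  · exact (Finset.sortedGT_sort _).pairwise
  · rw [seqG, Finset.mem_sort] at hx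
    exact (mem_missing.1 hx).1

theorem seqG_toFinset : (seqG n f).toFinset = missing n f := Finset.sort_toFinset _ _

theorem seqH_mem (hf : f ∈ functions n) :
    seqH n f ∈ insertionSeqs ((Icc 2 (n - 1)).image f).card :=
  ⟨partPerm n f, by rw [partPerm_eq hf]; exact map_label_perm hf, rfl⟩

/-- Restricted growth holds since the value with the preceding label has its first occurrence
earlier; that occurrence is the witness. -/
theorem seqS_mem (hn : 3 ≤ n) (hf : f ∈ functions n) :
    seqS n f ∈ growthSeqs (n - 2) ((Icc 2 (n - 1)).image f).card := by
  refine ⟨length_seqS, ?_, ?_, ?_⟩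
  · rw [getD_seqS hf (by omega), label_first hn]
  · intro i hi hin
    have hx : i + 2 ∈ Icc 2 (n - 1) := by rw [Finset.mem_Icc]; omega
    have h1 := label_pos (f := f) hx
    have him := Finset.mem_image_of_mem f hx
    rw [getD_seqS hf hin]
    by_cases h2 : label n f (f (i + 2)) = 1
    · exact ⟨0, hi, by omega⟩
    · have h3 := label_le (n := n) (f := f) (f (i + 2))
      obtain ⟨u, hu, hlu⟩ := exists_label_eq hf (v := label n f (f (i + 2)) - 2) (by omega)
      have h4 := (label_lt_iff hu him).1 (by omega)
      have h5 := firstOcc_le (f := f) hx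
      obtain ⟨h6, h7⟩ := firstOcc_spec hu
      rw [Finset.mem_Icc] at h6
      refine ⟨firstOcc n f u - 2, by omega, ?_⟩
      rw [getD_seqS hf (by omega), Nat.sub_add_cancel h6.1, h7]
      omega
  · ext v
    rw [List.mem_toFinset, seqS_eq hf, List.mem_map, Finset.mem_range]
    constructor
    · rintro ⟨x, hx, rfl⟩
      rw [List.mem_range'_1] at hx
      have h1 := label_pos (n := n) (f := f) (x := x + 1) (by rw [Finset.mem_Icc]; omega)
      have h2 := label_le (n := n) (f := f) (f (x + 1))
      omega
    · intro hv
      obtain ⟨i, hi, hl⟩ := exists_label_eq hf hv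
      obtain ⟨h1, h2⟩ := firstOcc_spec hi
      rw [Finset.mem_Icc] at h1
      refine ⟨firstOcc n f i - 1, by rw [List.mem_range'_1]; omega, ?_⟩
      rw [Nat.sub_add_cancel (by omega), h2]; omega

theorem ofSeq_seq (hf : f ∈ functions n) : ofSeq n (seqG n f) (seqH n f) (seqS n f) = f := by
  funext x
  rw [ofSeq]
  split_ifs with hx
  · have hx' := Finset.mem_Icc.1 hx
    have hfx := Finset.mem_image_of_mem f hx
    have h1 := label_pos (f := f) hx
    have hperm : permOfInsertion (seqH n f) = (presentList n f).map (label n f) := by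
      have hp := map_label_perm hf
      rw [← partPerm_eq hf] at hp ⊢
      exact (insertionSeq_spec hp).2.2
    rw [seqG_toFinset, hperm, getD_seqS hf (by omega), Nat.sub_add_cancel hx'.1,
      Nat.sub_add_cancel h1, idxOf_map_of_injOn]
    · exact getD_idxOf ((mem_presentList hf).2 hfx)
    · intro b hb h
      exact label_injOn ((mem_presentList hf).1 hb) hfx h
  · exact (hf.2 x hx).symm

end Label

/-! ### Reconstruction of a function from its sequences -/

section Reconstruct

variable {n K : ℕ} {g h s : List ℕ}

/-- A discrete intermediate value property: an entry exceeds some earlier one by at most one, so all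
smaller values have occurred before it. -/
theorem growthSeqs_downward {N : ℕ} (hs : s ∈ growthSeqs N K) {i : ℕ} (hi : i < N) {v : ℕ}
    (hv : v ≤ s.getD i 0) : ∃ j ≤ i, s.getD j 0 = v := by
  induction i using Nat.strong_induction_on with
  | _ i ih =>
    by_cases h1 : v = s.getD i 0
    · exact ⟨i, le_rfl, h1.symm⟩
    · rcases Nat.eq_zero_or_pos i with rfl | hpos
      · have := hs.2.1; omega
      · obtain ⟨j, hj, h2⟩ := hs.2.2.1 i hpos hi
        obtain ⟨j', hj', h3⟩ := ih j hj (by omega) (by omega)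
        exact ⟨j', by omega, h3⟩

theorem sort_sdiff_length (hg : g ∈ decreasingSeqs n (n - K)) (hK : K ≤ n) :
    ((Icc 1 n \ g.toFinset).sort (· ≤ ·)).length = K := by
  have hnd : g.Nodup := hg.2.1.imp (fun h => by omega)
  have hsub : g.toFinset ⊆ Icc 1 n := fun x hx => hg.2.2 x (List.mem_toFinset.1 hx)
  rw [Finset.length_sort, Finset.card_sdiff_of_subset hsub, List.toFinset_card_of_nodup hnd, hg.1]
  simp; omega

/-- The properties of the function with sequences `g`, `h`, `s`: it maps `x` to the vertex number
`j`, where `σ j = s (x - 1) + 1`. -/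
theorem ofSeq_spec (hn : 3 ≤ n) (hK : K ≤ n) (hg : g ∈ decreasingSeqs n (n - K))
    (hh : h ∈ insertionSeqs K) (hs : s ∈ growthSeqs (n - 2) K) :
    ofSeq n g h s ∈ functions n ∧ missing n (ofSeq n g h s) = g.toFinset ∧
      (∀ x ∈ Icc 2 (n - 1), label n (ofSeq n g h s) (ofSeq n g h s x) = s.getD (x - 2) 0 + 1) ∧
      (presentList n (ofSeq n g h s)).map (label n (ofSeq n g h s)) = permOfInsertion h := by
  obtain ⟨hh1, hh2⟩ := mem_insertionSeqs.1 hh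
  have hσp := permOfInsertion_perm hh2
  rw [hh1] at hσp
  have hσlen : (permOfInsertion h).length = K := by simp [hh1]
  have hIlen := sort_sdiff_length hg hK
  have hImem : ∀ i, i ∈ (Icc 1 n \ g.toFinset).sort (· ≤ ·) ↔ i ∈ Icc 1 n \ g.toFinset :=
    fun i => Finset.mem_sort _
  have hInd : ((Icc 1 n \ g.toFinset).sort (· ≤ ·)).Nodup := Finset.sort_nodup _ _
  generalize hI : (Icc 1 n \ g.toFinset).sort (· ≤ ·) = I at *
  generalize hσ : permOfInsertion h = σ at *
  have hσnd : σ.Nodup := hσp.nodup_iff.2 List.nodup_range'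
  obtain ⟨f, hf⟩ : ∃ f, f = ofSeq n g h s := ⟨_, rfl⟩
  have hfval : ∀ x ∈ Icc 2 (n - 1), f x = I.getD (σ.idxOf (s.getD (x - 2) 0 + 1)) 0 := by
    intro x hx
    rw [hf, ofSeq, if_pos hx, hI, hσ]
  rw [← hf]
  have hsK : ∀ i < n - 2, s.getD i 0 < K := by
    intro i hi
    have hi' : i < s.length := hs.1.symm ▸ hi
    have h1 := hs.2.2.2
    rw [List.getD_eq_getElem _ _ hi', ← Finset.mem_range, ← h1]
    exact List.mem_toFinset.2 (List.getElem_mem hi')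
  have hidx : ∀ v < K, σ.idxOf (v + 1) < K := by
    intro v hv
    rw [← hσlen]
    apply List.idxOf_lt_length_of_mem
    rw [hσp.mem_iff, List.mem_range'_1]; omega
  have hfI : ∀ x ∈ Icc 2 (n - 1), f x ∈ I := by
    intro x hx
    rw [hfval x hx]
    rw [Finset.mem_Icc] at hx
    rw [List.getD_eq_getElem _ _ (by rw [hIlen]; exact hidx _ (hsK _ (by omega)))]
    exact List.getElem_mem _
  have hfun : f ∈ functions n := by
    refine ⟨fun x hx => ?_, fun x hx => ?_⟩
    · exact (Finset.mem_sdiff.1 ((hImem _).1 (hfI x hx))).1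
    · rw [hf, ofSeq, if_neg hx]
  -- Every position `j` is used: `σ j - 1` is an entry of `s`, because `s` is onto. So no vertex
  -- outside of `g` is missed.
  have hIval : ∀ j < K, ∃ x ∈ Icc 2 (n - 1), f x = I.getD j 0 ∧ s.getD (x - 2) 0 + 1 = σ.getD j 0 := by
    intro j hj
    have h1 : σ.getD j 0 ∈ σ := by
      rw [List.getD_eq_getElem _ _ (by omega)]; exact List.getElem_mem _
    have h2 := hσp.mem_iff.1 h1
    rw [List.mem_range'_1] at h2
    have h3 : σ.getD j 0 - 1 ∈ s.toFinset := by rw [hs.2.2.2, Finset.mem_range]; omega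
    rw [List.mem_toFinset] at h3
    obtain ⟨t, ht, h4⟩ := List.getElem_of_mem h3
    have ht' : t < n - 2 := by rw [← hs.1]; exact ht
    have hx : t + 2 ∈ Icc 2 (n - 1) := by rw [Finset.mem_Icc]; omega
    have h5 : s.getD (t + 2 - 2) 0 + 1 = σ.getD j 0 := by
      rw [Nat.add_sub_cancel, List.getD_eq_getElem _ _ ht, h4]; omega
    refine ⟨t + 2, hx, ?_, h5⟩
    rw [hfval _ hx, h5]
    congr 1
    rw [List.getD_eq_getElem _ _ (by omega)]
    exact hσnd.idxOf_getElem _ _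
  have hmiss : missing n f = g.toFinset := by
    have himg : (Icc 2 (n - 1)).image f = Icc 1 n \ g.toFinset := by
      ext i
      rw [← hImem]
      constructor
      · intro hi
        obtain ⟨x, hx, rfl⟩ := Finset.mem_image.1 hi
        exact hfI x hx
      · intro hi
        obtain ⟨j, hj, rfl⟩ := List.getElem_of_mem hi
        obtain ⟨x, hx, h1, _⟩ := hIval j (by omega)
        refine Finset.mem_image.2 ⟨x, hx, ?_⟩
        rw [h1, List.getD_eq_getElem]
    rw [missing, himg, Finset.sdiff_sdiff_eq_self]
    exact fun x hx => hg.2.2 x (List.mem_toFinset.1 hx)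
  have hfs : ∀ x ∈ Icc 2 (n - 1), ∀ y ∈ Icc 2 (n - 1),
      f x = f y ↔ s.getD (x - 2) 0 = s.getD (y - 2) 0 := by
    intro x hx y hy
    rw [hfval x hx, hfval y hy]
    rw [Finset.mem_Icc] at hx hy
    constructor
    · intro h1
      have hx' := hidx _ (hsK (x - 2) (by omega))
      have hy' := hidx _ (hsK (y - 2) (by omega))
      rw [List.getD_eq_getElem _ _ (hx'.trans_eq hIlen.symm),
        List.getD_eq_getElem _ _ (hy'.trans_eq hIlen.symm), hInd.getElem_inj_iff] at h1
      have h2 := congrArg (fun i => σ.getD i 0) h1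
      rw [getD_idxOf, getD_idxOf] at h2
      · omega
      · rw [hσp.mem_iff, List.mem_range'_1]; have := hsK (y - 2) (by omega); omega
      · rw [hσp.mem_iff, List.mem_range'_1]; have := hsK (x - 2) (by omega); omega
    · intro h1; rw [h1]
  have hlabel : ∀ x ∈ Icc 2 (n - 1), label n f (f x) = s.getD (x - 2) 0 + 1 := by
    intro x hx
    have him := Finset.mem_image_of_mem f hx
    obtain ⟨h1, h2⟩ := firstOcc_spec him
    have hmin : ∀ z ∈ Icc 2 (n - 1), z < firstOcc n f (f x) → f z ≠ f x := by
      intro z hz hlt heq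
      have := firstOcc_le (f := f) hz
      rw [heq] at this; omega
    rw [label_of_mem him, ← (hfs _ h1 _ hx).1 h2]
    generalize firstOcc n f (f x) = y at *
    rw [← h2] at hmin
    have hy := Finset.mem_Icc.1 h1
    -- The functions `f` and `s` induce the same partition of the arguments, so they have equally
    -- many values on any initial segment.
    have himage : valueCount f y = ((Icc 2 y).image (fun z => s.getD (z - 2) 0)).card := by
      have e1 : (Icc 2 y).image (fun z => s.getD (z - 2) 0) =
          ((Icc 2 y).image f).image (fun i => σ.getD (I.idxOf i) 0 - 1) := by
        rw [Finset.image_image]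
        apply Finset.image_congr
        intro z hz
        have hz' : z ∈ Icc 2 (n - 1) := by
          have := Finset.mem_Icc.1 (Finset.mem_coe.1 hz); rw [Finset.mem_Icc]; omega
        have hzI := Finset.mem_Icc.1 hz'
        have hzK := hidx _ (hsK (z - 2) (by omega))
        simp only [Function.comp]
        rw [hfval z hz', List.getD_eq_getElem I _ (by omega), hInd.idxOf_getElem, getD_idxOf]
        · rfl
        · rw [hσp.mem_iff, List.mem_range'_1]; have := hsK (z - 2) (by omega); omega
      rw [e1, Finset.card_image_of_injOn, valueCount]
      intro a ha b hb hab
      obtain ⟨za, hza, rfl⟩ := Finset.mem_image.1 (Finset.mem_coe.1 ha)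
      obtain ⟨zb, hzb, rfl⟩ := Finset.mem_image.1 (Finset.mem_coe.1 hb)
      rw [Finset.mem_Icc] at hza hzb
      have hIa := hfI za (by rw [Finset.mem_Icc]; omega)
      have hIb := hfI zb (by rw [Finset.mem_Icc]; omega)
      have la := List.idxOf_lt_length_of_mem hIa
      have lb := List.idxOf_lt_length_of_mem hIb
      simp only at hab
      have pa : 1 ≤ σ.getD (I.idxOf (f za)) 0 := by
        rw [List.getD_eq_getElem _ _ (by omega)]
        exact (List.mem_range'_1.1 (hσp.mem_iff.1 (List.getElem_mem _))).1
      have pb : 1 ≤ σ.getD (I.idxOf (f zb)) 0 := by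
        rw [List.getD_eq_getElem _ _ (by omega)]
        exact (List.mem_range'_1.1 (hσp.mem_iff.1 (List.getElem_mem _))).1
      have heq : σ.getD (I.idxOf (f za)) 0 = σ.getD (I.idxOf (f zb)) 0 := by omega
      rw [List.getD_eq_getElem _ _ (la.trans_eq (hIlen.trans hσlen.symm)),
        List.getD_eq_getElem _ _ (lb.trans_eq (hIlen.trans hσlen.symm)),
        hσnd.getElem_inj_iff] at heq
      exact (List.idxOf_inj hIa).1 heq
    rw [himage]
    -- At the first occurrence of an entry of `s`, exactly the smaller entries have been seen: they
    -- must occur earlier, and a larger one before it would have forced an earlier occurrence.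
    have hset : (Icc 2 y).image (fun z => s.getD (z - 2) 0) = range (s.getD (y - 2) 0 + 1) := by
      ext v
      rw [Finset.mem_image, Finset.mem_range]
      constructor
      · rintro ⟨z, hz, rfl⟩
        rw [Finset.mem_Icc] at hz
        by_contra hcon
        obtain ⟨j, hj, h3⟩ := growthSeqs_downward hs (i := z - 2) (v := s.getD (y - 2) 0)
          (by omega) (by omega)
        have hjm : j + 2 ∈ Icc 2 (n - 1) := by rw [Finset.mem_Icc]; omega
        have hzy : z ≠ y := by rintro rfl; omega
        refine hmin (j + 2) hjm (by omega) ?_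
        rw [hfs _ hjm _ h1, Nat.add_sub_cancel, h3]
      · intro hv
        obtain ⟨j, hj, h3⟩ := growthSeqs_downward hs (i := y - 2) (v := v) (by omega) (by omega)
        exact ⟨j + 2, by rw [Finset.mem_Icc]; omega, by rw [Nat.add_sub_cancel, h3]⟩
    rw [hset, Finset.card_range]
  refine ⟨hfun, hmiss, hlabel, ?_⟩
  have hIp : presentList n f = I := by rw [presentList, hmiss, hI]
  rw [hIp]
  apply List.ext_getElem
  · rw [List.length_map, hIlen, hσlen]
  · intro j h1 h2
    rw [List.getElem_map]
    have hj : j < I.length := by simpa using h1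
    obtain ⟨x, hx, h3, h4⟩ := hIval j (by omega)
    rw [List.getD_eq_getElem _ _ hj] at h3
    rw [List.getD_eq_getElem _ _ h2] at h4
    rw [← h3, hlabel x hx, h4]

theorem seqG_ofSeq (hn : 3 ≤ n) (hK : K ≤ n) (hg : g ∈ decreasingSeqs n (n - K))
    (hh : h ∈ insertionSeqs K) (hs : s ∈ growthSeqs (n - 2) K) :
    seqG n (ofSeq n g h s) = g := by
  rw [seqG, (ofSeq_spec hn hK hg hh hs).2.1]
  exact (List.toFinset_sort _ (hg.2.1.imp (fun h => by omega))).2 (hg.2.1.imp (fun h => by omega))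

theorem seqH_ofSeq (hn : 3 ≤ n) (hK : K ≤ n) (hg : g ∈ decreasingSeqs n (n - K))
    (hh : h ∈ insertionSeqs K) (hs : s ∈ growthSeqs (n - 2) K) :
    seqH n (ofSeq n g h s) = h := by
  have h1 := ofSeq_spec hn hK hg hh hs
  rw [seqH, partPerm_eq h1.1, h1.2.2.2, insertionSeq_permOfInsertion]

theorem seqS_ofSeq (hn : 3 ≤ n) (hK : K ≤ n) (hg : g ∈ decreasingSeqs n (n - K))
    (hh : h ∈ insertionSeqs K) (hs : s ∈ growthSeqs (n - 2) K) :
    seqS n (ofSeq n g h s) = s := by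
  have h1 := ofSeq_spec hn hK hg hh hs
  apply List.ext_getElem
  · rw [length_seqS, hs.1]
  · intro i h2 h3
    have hi : i < n - 2 := by rw [← length_seqS (n := n) (f := ofSeq n g h s)]; exact h2
    rw [← List.getD_eq_getElem _ 0 h2, ← List.getD_eq_getElem _ 0 h3, getD_seqS h1.1 hi,
      h1.2.2.1 _ (by rw [Finset.mem_Icc]; omega)]
    simp

end Reconstruct


/-! ### Ranking and unranking of trees -/

theorem mul_add_lt {A B x y : ℕ} (hx : x < A) (hy : y < B) : x * B + y < A * B := by
  have := Nat.mul_le_mul_right B (show x + 1 ≤ A by omega)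
  rw [Nat.succ_mul] at this
  omega

/-- Equal lengths of the first blocks ensure that neither is a proper prefix of the other. -/
theorem append_lt_append {a a' b b' : List ℕ} (hl : a.length = a'.length) (h : a ++ b < a' ++ b') :
    a < a' ∨ a = a' ∧ b < b' := by
  induction a generalizing a' with
  | nil =>
    have : a' = [] := List.length_eq_zero_iff.1 hl.symm
    subst this; exact Or.inr ⟨rfl, h⟩
  | cons x a ih =>
    obtain ⟨x', a', rfl⟩ := List.exists_cons_of_length_eq_add_one hl.symm
    simp only [List.cons_append, List.cons_lt_cons_iff] at h ⊢
    rcases h with h | ⟨rfl, h⟩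
    · exact Or.inl (Or.inl h)
    · rcases ih (by simpa using hl) h with h1 | ⟨rfl, h1⟩
      · exact Or.inl (Or.inr ⟨rfl, h1⟩)
      · exact Or.inr ⟨rfl, h1⟩

theorem mul_add_lt_mul_add {B x x' y y' : ℕ} (h : x < x' ∨ x = x' ∧ y < y') (hy : y < B) :
    x * B + y < x' * B + y' := by
  rcases h with h | ⟨rfl, h⟩
  · have := mul_add_lt h hy; omega
  · omega

section

variable {n k : ℕ} {T : Finset (ℕ × ℕ)}

theorem leaves_eq_missing (hn : 2 ≤ n) (hT : T ∈ trees n) :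
    leaves n T = missing n (ThetaInv n T) := by
  obtain ⟨h1, h2⟩ := ThetaInv_mem hn hT
  rw [← leaves_Theta hn h1, h2]

theorem card_image_eq (hn : 2 ≤ n) (hT : T ∈ treesWithLeafCount n k) :
    ((Icc 2 (n - 1)).image (ThetaInv n T)).card = n - k := by
  have h1 := card_missing (ThetaInv_mem hn hT.1).1
  have h2 := hT.2
  rw [leaves_eq_missing hn hT.1] at h2
  omega

theorem seq_mem (hn : 3 ≤ n) (hT : T ∈ treesWithLeafCount n k) :
    seqG n (ThetaInv n T) ∈ decreasingSeqs n k ∧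
      seqH n (ThetaInv n T) ∈ insertionSeqs (n - k) ∧
      seqS n (ThetaInv n T) ∈ growthSeqs (n - 2) (n - k) := by
  have hn2 : 2 ≤ n := by omega
  have hf := (ThetaInv_mem hn2 hT.1).1
  have hc := card_image_eq hn2 hT
  refine ⟨?_, hc ▸ seqH_mem hf, hc ▸ seqS_mem hn hf⟩
  have h2 := hT.2
  rw [leaves_eq_missing hn2 hT.1] at h2
  exact h2 ▸ seqG_mem

theorem rankSystem_growth_sub (hn : 3 ≤ n) (K : ℕ) :
    RankSystem (growthSeqs (n - 2) K) id (Nat.stirlingSecond (n - 2) K) (rankGrowth K)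
      (unrankGrowth (n - 2) K) := by
  obtain ⟨m, rfl⟩ : ∃ m, n = m + 3 := ⟨n - 3, by omega⟩
  exact rankSystem_growth m K

theorem rankLeafSet_eq (hn : 3 ≤ n) (hT : T ∈ treesWithLeafCount n k) :
    rankLeafSet n k T = rankInsertion (seqH n (ThetaInv n T)) * Nat.stirlingSecond (n - 2) (n - k) +
      rankGrowth (n - k) (seqS n (ThetaInv n T)) := by
  obtain ⟨_, h2, h3⟩ := seq_mem hn hT
  rw [rankLeafSet, (rankSystem_insertion _).lexRank_eq h2,
    (rankSystem_growth_sub hn _).lexRank_eq h3]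

theorem rankLeafCount_eq (hn : 3 ≤ n) (hT : T ∈ treesWithLeafCount n k) :
    rankLeafCount n k T = rankDecreasing (seqG n (ThetaInv n T)) *
      ((n - k).factorial * Nat.stirlingSecond (n - 2) (n - k)) + rankLeafSet n k T := by
  obtain ⟨h1, h2, h3⟩ := seq_mem hn hT
  rw [rankLeafCount, (rankSystem_decreasing _ _).lexRank_eq h1, rankLeafSet, add_assoc]

theorem rankLeafSet_lt (hn : 3 ≤ n) (hT : T ∈ treesWithLeafCount n k) :
    rankLeafSet n k T < (n - k).factorial * Nat.stirlingSecond (n - 2) (n - k) := by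
  obtain ⟨_, h2, h3⟩ := seq_mem hn hT
  rw [rankLeafSet_eq hn hT]
  exact mul_add_lt ((rankSystem_insertion _).lt _ h2) ((rankSystem_growth_sub hn _).lt _ h3)

theorem eq_of_seq_eq (hn : 2 ≤ n) {T' : Finset (ℕ × ℕ)} (hT : T ∈ trees n) (hT' : T' ∈ trees n)
    (hg : seqG n (ThetaInv n T) = seqG n (ThetaInv n T'))
    (hh : seqH n (ThetaInv n T) = seqH n (ThetaInv n T'))
    (hs : seqS n (ThetaInv n T) = seqS n (ThetaInv n T')) : T = T' := by
  rw [← (ThetaInv_mem hn hT).2, ← (ThetaInv_mem hn hT').2, ← ofSeq_seq (ThetaInv_mem hn hT).1,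
    hg, hh, hs, ofSeq_seq (ThetaInv_mem hn hT').1]

theorem seqAll_inj (hn : 3 ≤ n) {T' : Finset (ℕ × ℕ)} (hT : T ∈ treesWithLeafCount n k)
    (hT' : T' ∈ treesWithLeafCount n k)
    (h : seqAll n (ThetaInv n T) = seqAll n (ThetaInv n T')) : T = T' := by
  obtain ⟨h1, h2, h3⟩ := seq_mem hn hT
  obtain ⟨h1', h2', h3'⟩ := seq_mem hn hT'
  obtain ⟨e1, e2⟩ := List.append_inj h (h1.1.trans h1'.1.symm)
  obtain ⟨e2, e3⟩ := List.append_inj e2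
    ((mem_insertionSeqs.1 h2).1.trans (mem_insertionSeqs.1 h2').1.symm)
  exact eq_of_seq_eq (by omega) hT.1 hT'.1 e1 e2 e3

theorem rankLeafSet_mono (hn : 3 ≤ n) {T' : Finset (ℕ × ℕ)} (hT : T ∈ treesWithLeafCount n k)
    (hT' : T' ∈ treesWithLeafCount n k)
    (h : seqH n (ThetaInv n T) ++ seqS n (ThetaInv n T) <
      seqH n (ThetaInv n T') ++ seqS n (ThetaInv n T')) :
    rankLeafSet n k T < rankLeafSet n k T' := by
  obtain ⟨_, h2, h3⟩ := seq_mem hn hT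
  obtain ⟨_, h2', h3'⟩ := seq_mem hn hT'
  rw [rankLeafSet_eq hn hT, rankLeafSet_eq hn hT']
  refine mul_add_lt_mul_add ?_ ((rankSystem_growth_sub hn _).lt _ h3)
  rcases append_lt_append ((mem_insertionSeqs.1 h2).1.trans (mem_insertionSeqs.1 h2').1.symm) h
    with h | ⟨h, h'⟩
  · exact Or.inl ((rankSystem_insertion _).mono _ h2 _ h2' h)
  · exact Or.inr ⟨by rw [h], (rankSystem_growth_sub hn _).mono _ h3 _ h3' h'⟩

theorem Theta_ofSeq_spec (hk : k + 1 ≤ n) (hn : 3 ≤ n) {g h s : List ℕ}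
    (hg : g ∈ decreasingSeqs n k) (hh : h ∈ insertionSeqs (n - k))
    (hs : s ∈ growthSeqs (n - 2) (n - k)) :
    Theta n (ofSeq n g h s) ∈ treesWithLeafSet n g.toFinset ∧
      ThetaInv n (Theta n (ofSeq n g h s)) = ofSeq n g h s ∧
      seqG n (ofSeq n g h s) = g ∧ seqH n (ofSeq n g h s) = h ∧ seqS n (ofSeq n g h s) = s := by
  have hn2 : 2 ≤ n := by omega
  have hg' : g ∈ decreasingSeqs n (n - (n - k)) := by rw [Nat.sub_sub_self (by omega)]; exact hg
  have hK : n - k ≤ n := by omega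
  obtain ⟨h1, h2, _⟩ := ofSeq_spec hn hK hg' hh hs
  exact ⟨⟨(Theta_bijOn hn2).mapsTo h1, by rw [leaves_Theta hn2 h1, h2]⟩, ThetaInv_Theta hn2 h1,
    seqG_ofSeq hn hK hg' hh hs, seqH_ofSeq hn hK hg' hh hs, seqS_ofSeq hn hK hg' hh hs⟩

theorem treesWithLeafSet_subset {L : Finset ℕ} (hL : L.card = k) :
    treesWithLeafSet n L ⊆ treesWithLeafCount n k := fun _ hT => ⟨hT.1, by rw [hT.2, hL]⟩

theorem sort_mem_decreasingSeqs {L : Finset ℕ} (hL : L ⊆ Icc 1 n) (hc : L.card = k) :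
    L.sort (· ≥ ·) ∈ decreasingSeqs n k :=
  ⟨by rw [Finset.length_sort, hc], (Finset.sortedGT_sort _).pairwise, fun x hx =>
    hL ((Finset.mem_sort _).1 hx)⟩

/-- With a prescribed leaf set the sequence `g` is constant, so comparing keys amounts to comparing
the blocks `h` and `s`, a two-digit number. -/
theorem rankSystem_leafSet (hn : 3 ≤ n) (hk : k + 1 ≤ n) {L : Finset ℕ} (hL : L ⊆ Icc 1 n)
    (hc : L.card = k) :
    RankSystem (treesWithLeafSet n L) (fun T => seqAll n (ThetaInv n T))
      ((n - k).factorial * Nat.stirlingSecond (n - 2) (n - k)) (rankLeafSet n k)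
      (unrankLeafSet n k L) := by
  have hsub := treesWithLeafSet_subset (n := n) hc
  -- A nonempty range of ranks already forces a positive Stirling number, so division by it is
  -- meaningful without assuming `2 ≤ k`.
  have hS : 0 < (n - k).factorial * Nat.stirlingSecond (n - 2) (n - k) →
      0 < Nat.stirlingSecond (n - 2) (n - k) := fun h => Nat.pos_of_mul_pos_left h
  have hseqG : ∀ T ∈ treesWithLeafSet n L, seqG n (ThetaInv n T) = L.sort (· ≥ ·) := fun T hT => by
    rw [seqG, ← leaves_eq_missing (by omega) hT.1, hT.2]
  have hun : ∀ r < (n - k).factorial * Nat.stirlingSecond (n - 2) (n - k),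
      unrankLeafSet n k L r ∈ treesWithLeafSet n L ∧
        rankLeafSet n k (unrankLeafSet n k L r) = r := by
    intro r hr
    have hS := hS (by omega)
    have hh : r / Nat.stirlingSecond (n - 2) (n - k) < (n - k).factorial := by
      rw [Nat.div_lt_iff_lt_mul hS]; exact hr
    have hs : r % Nat.stirlingSecond (n - 2) (n - k) < Nat.stirlingSecond (n - 2) (n - k) :=
      Nat.mod_lt _ hS
    obtain ⟨h1, h2, h3, h4, h5⟩ := Theta_ofSeq_spec hk hn (sort_mem_decreasingSeqs hL hc)
      ((rankSystem_insertion _).mem _ hh) ((rankSystem_growth_sub hn _).mem _ hs)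
    rw [Finset.sort_toFinset] at h1
    refine ⟨h1, ?_⟩
    rw [unrankLeafSet, rankLeafSet_eq hn (hsub h1), h2, h4, h5, (rankSystem_insertion _).right_inv _ hh,
      (rankSystem_growth_sub hn _).right_inv _ hs, Nat.div_add_mod']
  exact
  { inj := fun T hT T' hT' h => seqAll_inj hn (hsub hT) (hsub hT') h
    lt := fun T hT => rankLeafSet_lt hn (hsub hT)
    mono := fun T hT T' hT' h => by
      apply rankLeafSet_mono hn (hsub hT) (hsub hT')
      simp only [seqAll, hseqG T hT, hseqG T' hT'] at h
      rcases append_lt_append rfl h with h | ⟨_, h⟩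
      · exact absurd h (lt_irrefl _)
      · exact h
    mem := fun r hr => (hun r hr).1
    right_inv := fun r hr => (hun r hr).2 }

theorem rankSystem_leafCount (hn : 3 ≤ n) (hk : k + 1 ≤ n) :
    RankSystem (treesWithLeafCount n k) (fun T => seqAll n (ThetaInv n T))
      (n.choose k * (n - k).factorial * Nat.stirlingSecond (n - 2) (n - k)) (rankLeafCount n k)
      (unrankLeafCount n k) := by
  have hun : ∀ r < n.choose k * ((n - k).factorial * Nat.stirlingSecond (n - 2) (n - k)),
      unrankLeafCount n k r ∈ treesWithLeafCount n k ∧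
        rankLeafCount n k (unrankLeafCount n k r) = r := by
    intro r hr
    have hM : 0 < (n - k).factorial * Nat.stirlingSecond (n - 2) (n - k) :=
      Nat.pos_of_mul_pos_left (lt_of_le_of_lt (Nat.zero_le _) hr)
    have hS : 0 < Nat.stirlingSecond (n - 2) (n - k) := Nat.pos_of_mul_pos_left hM
    have hg : r / ((n - k).factorial * Nat.stirlingSecond (n - 2) (n - k)) < n.choose k := by
      rw [Nat.div_lt_iff_lt_mul hM]; exact hr
    have hg' := (rankSystem_decreasing n k).mem _ hg
    have hh : r % ((n - k).factorial * Nat.stirlingSecond (n - 2) (n - k)) /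
        Nat.stirlingSecond (n - 2) (n - k) < (n - k).factorial := by
      rw [Nat.div_lt_iff_lt_mul hS]; exact Nat.mod_lt _ hM
    have hs : r % ((n - k).factorial * Nat.stirlingSecond (n - 2) (n - k)) %
        Nat.stirlingSecond (n - 2) (n - k) < Nat.stirlingSecond (n - 2) (n - k) :=
      Nat.mod_lt _ hS
    obtain ⟨h1, h2, h3, h4, h5⟩ := Theta_ofSeq_spec hk hn hg'
      ((rankSystem_insertion _).mem _ hh) ((rankSystem_growth_sub hn _).mem _ hs)
    have h6 := treesWithLeafSet_subset (k := k)
      (by rw [List.toFinset_card_of_nodup (hg'.2.1.imp (fun h => by omega)), hg'.1]) h1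
    refine ⟨h6, ?_⟩
    rw [unrankLeafCount, rankLeafCount_eq hn h6, rankLeafSet_eq hn h6, h2, h3, h4, h5,
      (rankSystem_decreasing _ _).right_inv _ hg, (rankSystem_insertion _).right_inv _ hh,
      (rankSystem_growth_sub hn _).right_inv _ hs, Nat.div_add_mod', Nat.div_add_mod']
  rw [mul_assoc]
  exact
  { inj := fun T hT T' hT' h => seqAll_inj hn hT hT' h
    lt := fun T hT => by
      rw [rankLeafCount_eq hn hT]
      exact mul_add_lt ((rankSystem_decreasing _ _).lt _ (seq_mem hn hT).1) (rankLeafSet_lt hn hT)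
    mono := fun T hT T' hT' h => by
      rw [rankLeafCount_eq hn hT, rankLeafCount_eq hn hT']
      refine mul_add_lt_mul_add ?_ (rankLeafSet_lt hn hT)
      have h1 := (seq_mem hn hT).1
      have h1' := (seq_mem hn hT').1
      rcases append_lt_append (h1.1.trans h1'.1.symm) h with h | ⟨h, h'⟩
      · exact Or.inl ((rankSystem_decreasing _ _).mono _ h1 _ h1' h)
      · exact Or.inr ⟨by rw [h], rankLeafSet_mono hn hT hT' h'⟩
    mem := fun r hr => (hun r hr).1
    right_inv := fun r hr => (hun r hr).2 }

end


/-! ### Structured programs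

Programs whose loops run through `0, …, n-1`, where `n` is the content of register `0`.
Register `2` contains `1`. -/

/-- The registers written by a program. -/
def Program.wreg : Program → List ℕ
  | .skip => []
  | .small (.const x _) => [x]
  | .small (.move x _) => [x]
  | .small (.add x _ _) => [x]
  | .small (.sub x _ _) => [x]
  | .small (.load x _ _) => [x]
  | .small (.store _ _ _) => []
  | .big (.toSmall x _) => [x]
  | .big _ => []
  | .comp p q => p.wreg ++ q.wreg
  | .cond _ p q => p.wreg ++ q.wreg
  | .loop _ p => p.wreg

/-- The arrays written by a program. -/
def Program.warr : Program → List ℕ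
  | .small (.store a _ _) => [a]
  | .comp p q => p.warr ++ q.warr
  | .cond _ p q => p.warr ++ q.warr
  | .loop _ p => p.warr
  | _ => []

/-- The big registers written by a program. -/
def Program.wbreg : Program → List ℕ
  | .big (.arith _ X _ _) => [X]
  | .big (.ofSmall X _) => [X]
  | .big (.load X _ _) => [X]
  | .big (.binomial X _ _) => [X]
  | .big (.extension X _ _) => [X]
  | .comp p q => p.wbreg ++ q.wbreg
  | .cond _ p q => p.wbreg ++ q.wbreg
  | .loop _ p => p.wbreg
  | _ => []

/-- `M` and `M'` agree in the registers and arrays that `p` does not write. -/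
structure Frame (p : Program) (M M' : Memory) : Prop where
  reg : ∀ x, x ∉ p.wreg → M'.reg x = M.reg x
  arr : ∀ a, a ∉ p.warr → M'.arr a = M.arr a
  breg : ∀ X, X ∉ p.wbreg → M'.breg X = M.breg X

theorem Frame.rfl {p : Program} {M : Memory} : Frame p M M :=
  ⟨fun _ _ => Eq.refl _, fun _ _ => Eq.refl _, fun _ _ => Eq.refl _⟩

theorem Frame.trans {p : Program} {M M' M'' : Memory} (h : Frame p M M') (h' : Frame p M' M'') :
    Frame p M M'' :=
  ⟨fun x hx => (h'.reg x hx).trans (h.reg x hx), fun x hx => (h'.arr x hx).trans (h.arr x hx),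
    fun x hx => (h'.breg x hx).trans (h.breg x hx)⟩

theorem Frame.weaken {p q : Program} {M M' : Memory} (h : Frame p M M')
    (h1 : p.wreg ⊆ q.wreg) (h2 : p.warr ⊆ q.warr) (h3 : p.wbreg ⊆ q.wbreg) : Frame q M M' :=
  ⟨fun x hx => h.reg x fun hx' => hx (h1 hx'), fun x hx => h.arr x fun hx' => hx (h2 hx'),
    fun x hx => h.breg x fun hx' => hx (h3 hx')⟩

/-- What a run can change is visible in the text of the program, so that preservation of particular
cells becomes a decidable check. -/
theorem Runs.frame {n N K : ℕ} {p : Program} {M M' : Memory} {a b : ℕ}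
    (h : Runs n N K p M M' a b) : Frame p M M' := by
  induction h with
  | skip M => exact Frame.rfl
  | small i M h =>
    constructor <;> intro x hx <;> cases i <;>
      simp_all [Program.wreg, Program.warr, SmallInstr.exec]
  | big i M h =>
    constructor <;> intro x hx <;> cases i <;>
      simp_all [Program.wreg, Program.wbreg, BigInstr.exec]
  | comp hp hq ihp ihq =>
    exact (ihp.weaken (List.subset_append_left _ _) (List.subset_append_left _ _)
      (List.subset_append_left _ _)).trans (ihq.weaken (List.subset_append_right _ _)
      (List.subset_append_right _ _) (List.subset_append_right _ _))
  | condTrue ht hp ih =>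
    exact ih.weaken (List.subset_append_left _ _) (List.subset_append_left _ _)
      (List.subset_append_left _ _)
  | condFalse ht hp ih =>
    exact ih.weaken (List.subset_append_right _ _) (List.subset_append_right _ _)
      (List.subset_append_right _ _)
  | loopTrue ht hp hl ihp ihl =>
    exact Frame.trans (p := .loop _ _)
      (ihp.weaken (List.Subset.refl _) (List.Subset.refl _) (List.Subset.refl _)) ihl
  | loopFalse ht => exact Frame.rfl

/-- Structured programs. -/
inductive Code
  | skip
  | small (i : SmallInstr)
  | big (i : BigInstr)
  | comp (p q : Code)
  | cond (t : Test) (p q : Code)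
  | rep (i : ℕ) (p : Code)

namespace Code

/-- Sequential composition. -/
scoped infixr:60 " ;; " => Code.comp

/-- `if t then p`. -/
def ifThen (t : Test) (p : Code) : Code := .cond t p .skip

/-- `if ¬ t then p`. -/
def ifNot (t : Test) (p : Code) : Code := .cond t .skip p

/-- The program for a structured program. -/
def toProgram : Code → Program
  | skip => .skip
  | small i => .small i
  | big i => .big i
  | comp p q => .comp p.toProgram q.toProgram
  | cond t p q => .cond t p.toProgram q.toProgram
  | rep i p => .comp (.small (.const i 0))
      (.loop (.small i 0) (.comp p.toProgram (.small (.add i i 2))))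

/-- A bound for the number of small operations. -/
def smallCost (n : ℕ) : Code → ℕ
  | skip => 0
  | small _ => 1
  | big _ => 0
  | comp p q => p.smallCost n + q.smallCost n
  | cond t p q => t.smallCost + (p.smallCost n + q.smallCost n)
  | rep _ p => 1 + (n * (p.smallCost n + 2) + 1)

/-- A bound for the number of big operations. -/
def bigCost (n : ℕ) : Code → ℕ
  | skip => 0
  | small _ => 0
  | big _ => 1
  | comp p q => p.bigCost n + q.bigCost n
  | cond t p q => t.bigCost + (p.bigCost n + q.bigCost n)
  | rep _ p => n * p.bigCost n

/-- The nesting depth of the loops. -/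
def depth : Code → ℕ
  | comp p q => max p.depth q.depth
  | cond _ p q => max p.depth q.depth
  | rep _ p => p.depth + 1
  | _ => 0

/-- The number of big operations in the text of a program. -/
def bigSize : Code → ℕ
  | big _ => 1
  | comp p q => p.bigSize + q.bigSize
  | cond t p q => t.bigCost + (p.bigSize + q.bigSize)
  | rep _ p => p.bigSize
  | _ => 0

/-- The nesting depth of the loops that contain big operations. -/
def bigDepth : Code → ℕ
  | comp p q => max p.bigDepth q.bigDepth
  | cond _ p q => max p.bigDepth q.bigDepth
  | rep _ p => if p.bigSize = 0 then 0 else p.bigDepth + 1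
  | _ => 0

/-- The length of the text of a program. -/
def size : Code → ℕ
  | skip => 0
  | small _ => 1
  | big _ => 0
  | comp p q => p.size + q.size
  | cond t p q => t.smallCost + (p.size + q.size)
  | rep _ p => p.size + 4

/-- A loop multiplies the cost by `n`. The `4` in its size pays for the initialization, for test and
increment in each round, and for the final test. -/
theorem smallCost_le {n : ℕ} (hn : 1 ≤ n) (p : Code) : p.smallCost n ≤ p.size * n ^ p.depth := by
  have hpow : ∀ {a b : ℕ}, a ≤ b → n ^ a ≤ n ^ b := fun h => Nat.pow_le_pow_right hn h
  have hpos : ∀ a, 1 ≤ n ^ a := fun a => Nat.one_le_pow _ _ hn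
  induction p with
  | skip => simp [smallCost]
  | small i => simp [smallCost, size, depth]
  | big i => simp [smallCost]
  | comp p q ihp ihq =>
    simp only [smallCost, size, depth, add_mul]
    exact Nat.add_le_add (ihp.trans (Nat.mul_le_mul_left _ (hpow (le_max_left _ _))))
      (ihq.trans (Nat.mul_le_mul_left _ (hpow (le_max_right _ _))))
  | cond t p q ihp ihq =>
    simp only [smallCost, size, depth, add_mul]
    exact Nat.add_le_add (Nat.le_mul_of_pos_right _ (hpos _))
      (Nat.add_le_add (ihp.trans (Nat.mul_le_mul_left _ (hpow (le_max_left _ _))))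
        (ihq.trans (Nat.mul_le_mul_left _ (hpow (le_max_right _ _)))))
  | rep i p ih =>
    simp only [smallCost, size, depth, pow_succ]
    have h1 := Nat.mul_le_mul_left n ih
    have h2 := Nat.mul_le_mul_right n (hpos p.depth)
    nlinarith

theorem bigCost_eq_zero {n : ℕ} {p : Code} (h : p.bigSize = 0) : p.bigCost n = 0 := by
  induction p with
  | skip => rfl
  | small i => rfl
  | big i => simp [bigSize] at h
  | comp p q ihp ihq =>
    simp only [bigSize] at h
    simp only [bigCost, ihp (by omega), ihq (by omega)]
  | cond t p q ihp ihq =>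
    simp only [bigSize] at h
    simp only [bigCost, ihp (by omega), ihq (by omega)]
    omega
  | rep i p ih =>
    simp only [bigSize] at h
    simp only [bigCost, ih h, mul_zero]

/-- Loops without big operations cost nothing here, so only loops containing some are counted in the
exponent. -/
theorem bigCost_le {n : ℕ} (hn : 1 ≤ n) (p : Code) : p.bigCost n ≤ p.bigSize * n ^ p.bigDepth := by
  have hpow : ∀ {a b : ℕ}, a ≤ b → n ^ a ≤ n ^ b := fun h => Nat.pow_le_pow_right hn h
  have hpos : ∀ a, 1 ≤ n ^ a := fun a => Nat.one_le_pow _ _ hn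
  induction p with
  | skip => simp [bigCost]
  | small i => simp [bigCost]
  | big i => simp [bigCost, bigSize, bigDepth]
  | comp p q ihp ihq =>
    simp only [bigCost, bigSize, bigDepth, add_mul]
    exact Nat.add_le_add (ihp.trans (Nat.mul_le_mul_left _ (hpow (le_max_left _ _))))
      (ihq.trans (Nat.mul_le_mul_left _ (hpow (le_max_right _ _))))
  | cond t p q ihp ihq =>
    simp only [bigCost, bigSize, bigDepth, add_mul]
    exact Nat.add_le_add (Nat.le_mul_of_pos_right _ (hpos _))
      (Nat.add_le_add (ihp.trans (Nat.mul_le_mul_left _ (hpow (le_max_left _ _))))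
        (ihq.trans (Nat.mul_le_mul_left _ (hpow (le_max_right _ _)))))
  | rep i p ih =>
    simp only [bigCost, bigSize, bigDepth]
    split_ifs with h
    · rw [bigCost_eq_zero h]; simp
    · rw [pow_succ]
      have h1 := Nat.mul_le_mul_left n ih
      nlinarith

/-! ### Weakest preconditions and their soundness -/

/-- The loop body does not change the counter and the constants. -/
def Steady (i : ℕ) (p : Code) : Prop :=
  i ∉ p.toProgram.wreg ∧ 0 ∉ p.toProgram.wreg ∧ 2 ∉ p.toProgram.wreg ∧ i ≠ 0 ∧ i ≠ 2

instance (i : ℕ) (p : Code) : Decidable (Steady i p) := by unfold Steady; infer_instance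

/-- Weakest preconditions (of runs within the bounds `n` and `N` for the contents of cells), with
loop invariants. -/
def wp (n N K : ℕ) : Code → (Memory → Prop) → Memory → Prop
  | skip, Q, M => Q M
  | small (.const x c), Q, M => c ≤ n ∧ Q { M with reg := Function.update M.reg x c }
  | small (.move x y), Q, M => Q { M with reg := Function.update M.reg x (M.reg y) }
  | small (.add x y z), Q, M => M.reg y + M.reg z ≤ n ∧
      Q { M with reg := Function.update M.reg x (M.reg y + M.reg z) }
  | small (.sub x y z), Q, M => Q { M with reg := Function.update M.reg x (M.reg y - M.reg z) }
  | small (.load x a i), Q, M => Q { M with reg := Function.update M.reg x (M.arr a (M.reg i)) }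
  | small (.store a i x), Q, M => Q { M with
      arr := Function.update M.arr a (Function.update (M.arr a) (M.reg i) (M.reg x)) }
  | big (.arith op X Y Z), Q, M => op.eval (M.breg Y) (M.breg Z) ≤ N ∧
      Q { M with breg := Function.update M.breg X (op.eval (M.breg Y) (M.breg Z)) }
  | big (.ofSmall X x), Q, M => M.reg x ≤ N ∧
      Q { M with breg := Function.update M.breg X (M.reg x) }
  | big (.toSmall x X), Q, M => M.breg X ≤ n ∧
      Q { M with reg := Function.update M.reg x (M.breg X) }
  | big (.load X A i), Q, M => Q { M with breg := Function.update M.breg X (M.barr A (M.reg i)) }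
  | big (.store A i X), Q, M => Q { M with
      barr := Function.update M.barr A (Function.update (M.barr A) (M.reg i) (M.breg X)) }
  | big (.binomial X y z), Q, M => (M.reg y).choose (M.reg z) ≤ N ∧
      Q { M with breg := Function.update M.breg X ((M.reg y).choose (M.reg z)) }
  | big (.extension X t m), Q, M => extensionCount K (M.reg t) (M.reg m) ≤ N ∧
      Q { M with breg := Function.update M.breg X (extensionCount K (M.reg t) (M.reg m)) }
  | comp p q, Q, M => wp n N K p (wp n N K q Q) M
  | cond t p q, Q, M => (t.holds M → wp n N K p Q M) ∧ (¬ t.holds M → wp n N K q Q M)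
  | rep i p, Q, M => M.reg 0 = n ∧ M.reg 2 = 1 ∧ Steady i p ∧ ∃ Inv : ℕ → Memory → Prop,
      Inv 0 { M with reg := Function.update M.reg i 0 } ∧
      (∀ j < n, ∀ M' : Memory, M'.Bounded n N → Frame (rep i p).toProgram M M' → M'.reg i = j →
        Inv j M' →
        wp n N K p (fun M'' => Inv (j + 1) { M'' with reg := Function.update M''.reg i (j + 1) })
          M') ∧
      ∀ M' : Memory, M'.Bounded n N → Frame (rep i p).toProgram M M' → M'.reg i = n → Inv n M' →
        Q M'

theorem wp_mono {n N K : ℕ} {p : Code} {Q Q' : Memory → Prop} {M : Memory}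
    (h : wp n N K p Q M) (hQ : ∀ M', Q M' → Q' M') : wp n N K p Q' M := by
  induction p generalizing Q Q' M with
  | skip => exact hQ _ h
  | small i =>
    cases i with
    | const x c => exact ⟨h.1, hQ _ h.2⟩
    | add x y z => exact ⟨h.1, hQ _ h.2⟩
    | _ => exact hQ _ h
  | big i =>
    cases i with
    | load X A i => exact hQ _ h
    | store A i X => exact hQ _ h
    | _ => exact ⟨h.1, hQ _ h.2⟩
  | comp p q ihp ihq => exact ihp h fun M' h' => ihq h' hQ
  | cond t p q ihp ihq => exact ⟨fun ht => ihp (h.1 ht) hQ, fun ht => ihq (h.2 ht) hQ⟩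
  | rep i p ih =>
    obtain ⟨h0, h1, h2, Inv, h3, h4, h5⟩ := h
    exact ⟨h0, h1, h2, Inv, h3, h4, fun M' a b c d => hQ _ (h5 M' a b c d)⟩

/-- The frame of a program may be used in the proof of its postcondition. -/
theorem wp_frame {n N K : ℕ} {p : Code} {Q : Memory → Prop} {M : Memory}
    (h : wp n N K p (fun M' => Frame p.toProgram M M' → Q M') M) : wp n N K p Q M := by
  induction p generalizing Q M with
  | skip => exact h Frame.rfl
  | small i =>
    have hF : Frame (Program.small i) M (i.exec M) := by
      constructor <;> intro x hx <;> cases i <;>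
        simp_all [Program.wreg, Program.warr, SmallInstr.exec]
    cases i with
    | const x c => exact ⟨h.1, h.2 hF⟩
    | add x y z => exact ⟨h.1, h.2 hF⟩
    | _ => exact h hF
  | big i =>
    have hF : Frame (Program.big i) M (i.exec K M) := by
      constructor <;> intro x hx <;> cases i <;>
        simp_all [Program.wreg, Program.wbreg, BigInstr.exec]
    cases i with
    | load X A i => exact h hF
    | store A i X => exact h hF
    | _ => exact ⟨h.1, h.2 hF⟩
  | comp p q ihp ihq =>
    refine ihp (wp_mono h fun M1 h1 hF1 => ihq (wp_mono h1 fun M2 h2 hF2 => h2 ?_))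
    exact (hF1.weaken (q := (comp p q).toProgram) (List.subset_append_left _ _)
      (List.subset_append_left _ _) (List.subset_append_left _ _)).trans
      (hF2.weaken (List.subset_append_right _ _) (List.subset_append_right _ _)
      (List.subset_append_right _ _))
  | cond t p q ihp ihq =>
    refine ⟨fun ht => ihp (wp_mono (h.1 ht) fun M1 h1 hF => h1 ?_),
      fun ht => ihq (wp_mono (h.2 ht) fun M1 h1 hF => h1 ?_)⟩
    · exact hF.weaken (List.subset_append_left _ _) (List.subset_append_left _ _)
        (List.subset_append_left _ _)
    · exact hF.weaken (List.subset_append_right _ _) (List.subset_append_right _ _)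
        (List.subset_append_right _ _)
  | rep i p ih =>
    obtain ⟨h0, h1, h2, Inv, h3, h4, h5⟩ := h
    exact ⟨h0, h1, h2, Inv, h3, h4, fun M' a b c d => h5 M' a b c d b⟩

/-- The rule for loops. -/
theorem wp_rep {n N K i : ℕ} {p : Code} {Q : Memory → Prop} {M : Memory} (h0 : M.reg 0 = n)
    (h2 : M.reg 2 = 1) (hs : Steady i p) (Inv : ℕ → Memory → Prop)
    (hinit : Inv 0 { M with reg := Function.update M.reg i 0 })
    (hstep : ∀ j < n, ∀ M' : Memory, M'.Bounded n N → Frame (rep i p).toProgram M M' →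
      M'.reg i = j → Inv j M' →
      wp n N K p (fun M'' => Inv (j + 1) { M'' with reg := Function.update M''.reg i (j + 1) }) M')
    (hend : ∀ M' : Memory, M'.Bounded n N → Frame (rep i p).toProgram M M' → M'.reg i = n →
      Inv n M' → Q M') : wp n N K (rep i p) Q M :=
  ⟨h0, h2, hs, Inv, hinit, hstep, hend⟩

/-- `p`, started in `M`, halts in a memory with property `Q`. -/
def Reaches (n N K : ℕ) (p : Code) (Q : Memory → Prop) (M : Memory) : Prop :=
  ∃ (M' : Memory) (a b : ℕ), Runs n N K p.toProgram M M' a b ∧ a ≤ p.smallCost n ∧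
    b ≤ p.bigCost n ∧ M'.Bounded n N ∧ Q M'

theorem bounded_reg {n N x v : ℕ} {M : Memory} (hM : M.Bounded n N) (hv : v ≤ n) :
    Memory.Bounded n N { M with reg := Function.update M.reg x v } := by
  refine ⟨fun y => ?_, hM.2⟩
  simp only [Function.update_apply]
  split_ifs
  · exact hv
  · exact hM.1 y

theorem bounded_arr {n N a i v : ℕ} {M : Memory} (hM : M.Bounded n N) (hv : v ≤ n) :
    Memory.Bounded n N
      { M with arr := Function.update M.arr a (Function.update (M.arr a) i v) } := by
  refine ⟨hM.1, fun b j => ?_, hM.2.2⟩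
  by_cases h : b = a
  · subst h
    simp only [Function.update_self, Function.update_apply]
    split_ifs
    · exact hv
    · exact hM.2.1 _ _
  · simp only [Function.update_of_ne h]
    exact hM.2.1 _ _

theorem bounded_breg {n N X v : ℕ} {M : Memory} (hM : M.Bounded n N) (hv : v ≤ N) :
    Memory.Bounded n N { M with breg := Function.update M.breg X v } := by
  refine ⟨hM.1, hM.2.1, fun y => ?_, hM.2.2.2⟩
  simp only [Function.update_apply]
  split_ifs
  · exact hv
  · exact hM.2.2.1 y

theorem bounded_barr {n N a i v : ℕ} {M : Memory} (hM : M.Bounded n N) (hv : v ≤ N) :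
    Memory.Bounded n N
      { M with barr := Function.update M.barr a (Function.update (M.barr a) i v) } := by
  refine ⟨hM.1, hM.2.1, hM.2.2.1, fun b j => ?_⟩
  by_cases h : b = a
  · subst h
    simp only [Function.update_self, Function.update_apply]
    split_ifs
    · exact hv
    · exact hM.2.2.2 _ _
  · simp only [Function.update_of_ne h]
    exact hM.2.2.2 _ _

theorem reaches_small {n N K : ℕ} {i : SmallInstr} {Q : Memory → Prop} {M : Memory}
    (h : (i.exec M).Bounded n N) (hQ : Q (i.exec M)) : Reaches n N K (small i) Q M :=
  ⟨_, _, _, Runs.small i M h, le_rfl, le_rfl, h, hQ⟩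

theorem reaches_big {n N K : ℕ} {i : BigInstr} {Q : Memory → Prop} {M : Memory}
    (h : (i.exec K M).Bounded n N) (hQ : Q (i.exec K M)) : Reaches n N K (big i) Q M :=
  ⟨_, _, _, Runs.big i M h, le_rfl, le_rfl, h, hQ⟩

/-- Soundness of the calculus, including boundedness and cost. Termination of loops is automatic,
since the counter and the constants in registers `0` and `2` are untouched by the body. -/
theorem reaches_of_wp {n N K : ℕ} {p : Code} {Q : Memory → Prop} {M : Memory}
    (hM : M.Bounded n N) (h : wp n N K p Q M) : Reaches n N K p Q M := by
  induction p generalizing Q M with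
  | skip => exact ⟨M, 0, 0, Runs.skip M, le_rfl, le_rfl, hM, h⟩
  | small i =>
    cases i with
    | const x c => exact reaches_small (bounded_reg hM h.1) h.2
    | move x y => exact reaches_small (bounded_reg hM (hM.1 _)) h
    | add x y z => exact reaches_small (bounded_reg hM h.1) h.2
    | sub x y z =>
      exact reaches_small (bounded_reg hM ((Nat.sub_le _ _).trans (hM.1 _))) h
    | load x a i => exact reaches_small (bounded_reg hM (hM.2.1 _ _)) h
    | store a i x => exact reaches_small (bounded_arr hM (hM.1 _)) h
  | big i =>
    cases i with
    | arith op X Y Z => exact reaches_big (bounded_breg hM h.1) h.2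
    | ofSmall X x => exact reaches_big (bounded_breg hM h.1) h.2
    | toSmall x X => exact reaches_big (bounded_reg hM h.1) h.2
    | load X A i => exact reaches_big (bounded_breg hM (hM.2.2.2 _ _)) h
    | store A i X => exact reaches_big (bounded_barr hM (hM.2.2.1 _)) h
    | binomial X y z => exact reaches_big (bounded_breg hM h.1) h.2
    | extension X t m => exact reaches_big (bounded_breg hM h.1) h.2
  | comp p q ihp ihq =>
    obtain ⟨M1, a, b, h1, h2, h3, h4, h5⟩ := ihp hM h
    obtain ⟨M2, a', b', h1', h2', h3', h4', h5'⟩ := ihq h4 h5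
    exact ⟨M2, _, _, Runs.comp h1 h1', Nat.add_le_add h2 h2', Nat.add_le_add h3 h3', h4', h5'⟩
  | cond t p q ihp ihq =>
    by_cases ht : t.holds M
    · obtain ⟨M1, a, b, h1, h2, h3, h4⟩ := ihp hM (h.1 ht)
      refine ⟨M1, _, _, Runs.condTrue ht h1, ?_, ?_, h4⟩
      · simp only [smallCost]; omega
      · simp only [bigCost]; omega
    · obtain ⟨M1, a, b, h1, h2, h3, h4⟩ := ihq hM (h.2 ht)
      refine ⟨M1, _, _, Runs.condFalse ht h1, ?_, ?_, h4⟩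
      · simp only [smallCost]; omega
      · simp only [bigCost]; omega
  | rep i p ih =>
    obtain ⟨h0, h1, ⟨hi, hi0, hi2, hne0, hne2⟩, Inv, hInv0, hstep, hend⟩ := h
    -- Induction on the number `d` of remaining rounds.
    have key : ∀ d j, j + d = n → ∀ M' : Memory, M'.Bounded n N →
        Frame (rep i p).toProgram M M' → M'.reg i = j → M'.reg 0 = n → M'.reg 2 = 1 → Inv j M' →
        ∃ (M'' : Memory) (a b : ℕ), Runs n N K
          (.loop (.small i 0) (.comp p.toProgram (.small (.add i i 2)))) M' M'' a b ∧
          a ≤ d * (p.smallCost n + 2) + 1 ∧ b ≤ d * p.bigCost n ∧ M''.Bounded n N ∧ Q M'' := by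
      intro d
      induction d with
      | zero =>
        intro j hj M' hB hF hri hr0 hr2 hI
        have hjn : j = n := by omega
        subst hjn
        refine ⟨M', _, _, Runs.loopFalse ?_, ?_, ?_, hB, hend M' hB hF hri hI⟩
        · simp only [Test.holds]; omega
        · simp [Test.smallCost]
        · simp [Test.bigCost]
      | succ d ihd =>
        intro j hj M' hB hF hri hr0 hr2 hI
        obtain ⟨M1, a, b, r1, ha, hb, hB1, hQ1⟩ := ih hB (hstep j (by omega) M' hB hF hri hI)
        have hfr := r1.frame
        have e0 : M1.reg i = j := by rw [hfr.reg i hi, hri]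
        have e1 : M1.reg 0 = n := by rw [hfr.reg 0 hi0, hr0]
        have e2 : M1.reg 2 = 1 := by rw [hfr.reg 2 hi2, hr2]
        have hexec : SmallInstr.exec (.add i i 2) M1 =
            { M1 with reg := Function.update M1.reg i (j + 1) } := by
          simp only [SmallInstr.exec, e0, e2]
        have hB2 : (SmallInstr.exec (.add i i 2) M1).Bounded n N := by
          rw [hexec]; exact bounded_reg hB1 (by omega)
        have r2 := Runs.comp (K := K) r1 (Runs.small (.add i i 2) M1 hB2)
        have hfr2 := r2.frame
        rw [hexec] at r2 hfr2 hB2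
        have hF2 : Frame (rep i p).toProgram M { M1 with reg := Function.update M1.reg i (j + 1) } :=
          hF.trans (hfr2.weaken (List.subset_append_right _ _) (List.subset_append_right _ _)
            (List.subset_append_right _ _))
        obtain ⟨M2, a', b', r3, ha', hb', hfin⟩ := ihd (j + 1) (by omega) _ hB2 hF2
          (by simp) (by simp [Function.update_of_ne hne0.symm, e1])
          (by simp [Function.update_of_ne hne2.symm, e2]) hQ1
        refine ⟨M2, _, _, Runs.loopTrue ?_ r2 r3, ?_, ?_, hfin⟩
        · simp only [Test.holds]; omega
        · simp only [Test.smallCost, add_mul]; omega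
        · simp only [Test.bigCost, add_mul]; omega
    have hB0 : Memory.Bounded n N { M with reg := Function.update M.reg i 0 } :=
      bounded_reg hM (Nat.zero_le _)
    have r0 : Runs n N K (.small (.const i 0)) M _ 1 0 := Runs.small (.const i 0) M hB0
    obtain ⟨M2, a, b, r1, ha, hb, hfin⟩ := key n 0 (by omega)
      { M with reg := Function.update M.reg i 0 } hB0
      (r0.frame.weaken (List.subset_append_left _ _) (List.subset_append_left _ _)
        (List.subset_append_left _ _))
      (by simp) (by simp [Function.update_of_ne hne0.symm, h0])
      (by simp [Function.update_of_ne hne2.symm, h1]) hInv0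
    refine ⟨M2, _, _, Runs.comp r0 r1, ?_, ?_, hfin⟩
    · simp only [smallCost]; omega
    · simp only [bigCost]; omega

end Code

open Code
set_option linter.unusedSimpArgs false
/-! ### Walks -/

/-- Starting from the vertex in register `4`, follow the array `a` up to the first vertex that is
at least as large. The vertex that is reached is put into register `6`. -/
def walk (a : ℕ) : Code :=
  .small (.load 6 a 4) ;; .rep 8 (ifThen (.small 6 4) (.small (.load 6 a 6)))

/-- The loop has a fixed number `n` of rounds and idles after a vertex at least `v` has been found.
The alternative `m = n` means that all rounds were used up. -/
theorem walk_spec {n N K a v : ℕ} {f : ℕ → ℕ} {Q : Memory → Prop} {M : Memory} (h0 : M.reg 0 = n)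
    (h2 : M.reg 2 = 1) (h4 : M.reg 4 = v) (ha : M.arr a = f)
    (h : ∀ M', Frame (walk a).toProgram M M' → (∃ m ≤ n, M'.reg 6 = f^[m] (f v) ∧
      (∀ i < m, f^[i] (f v) < v) ∧ (m = n ∨ v ≤ M'.reg 6)) → Q M') :
    wp n N K (walk a) Q M := by
  apply wp_frame
  refine wp_rep (by simpa using h0) (by simpa using h2)
    (by simp [Steady, ifThen, toProgram, Program.wreg])
    (fun j M' => ∃ m ≤ j, M'.reg 6 = f^[m] (f v) ∧
      (∀ i < m, f^[i] (f v) < v) ∧ (m = j ∨ v ≤ M'.reg 6)) ?_ ?_ ?_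
  · exact ⟨0, le_rfl, by simp [ha, h4], by simp, Or.inl rfl⟩
  · rintro j hj M' hB hF hi ⟨m, hm, h6, hlt, hor⟩
    have f4 := hF.reg 4 (by simp [ifThen, toProgram, Program.wreg])
    have fa := hF.arr a (by simp [ifThen, toProgram, Program.warr])
    simp only [ne_eq, Nat.reduceEqDiff, not_false_eq_true,
      Function.update_of_ne, h4, ha] at f4 fa
    simp only [ifThen, wp, Test.holds, f4, fa]
    refine ⟨fun hlt' => ?_, fun hge => ⟨m, by omega, by simpa using h6, hlt,
      Or.inr (by simpa using hge)⟩⟩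
    refine ⟨m + 1, by omega, ?_, ?_, ?_⟩
    · simp [h6, ← Function.iterate_succ_apply' f]
    · intro i hi
      rcases Nat.lt_succ_iff_lt_or_eq.1 hi with h1 | rfl
      · exact hlt i h1
      · omega
    · left; omega
  · intro M' hB hF hi hI hF'
    exact h M' hF' hI

/-- Pigeonhole: a longer path inside `{2, …, n}` would repeat a vertex. Hence the fixed number of
rounds suffices for walks in trees. -/
theorem iterate_parent_top {n : ℕ} {p : ℕ → ℕ} (hp : p ∈ parents n) {v i : ℕ} (hv : v ≤ n)
    (hi : n ≤ i + 1) : p^[i] v ≤ 1 := by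
  by_contra hcon
  have hall : ∀ t ≤ i, p^[t] v ∈ Icc 2 n := by
    intro t ht
    rw [Finset.mem_Icc]
    refine ⟨?_, iterate_parent_le hp hv t⟩
    by_contra h1
    have := iterate_parent_of_le_one hp.2.1 (v := p^[t] v) (by omega) (i - t)
    rw [← Function.iterate_add_apply, Nat.sub_add_cancel ht] at this
    omega
  obtain ⟨a, ha, b, hb, hne, heq⟩ := Finset.exists_ne_map_eq_of_card_lt_of_maps_to
    (s := range (i + 1)) (t := Icc 2 n) (f := fun t => p^[t] v) (by
      have h1 := Finset.mem_Icc.1 (hall 0 (Nat.zero_le _))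
      simp; omega)
    (fun t ht => by exact_mod_cast hall t (by simpa [Nat.lt_succ_iff] using ht))
  simp only [Finset.mem_range] at ha hb
  have key : ∀ a b, a < b → a < i + 1 → p^[a] v = p^[b] v → False := by
    intro a b hab ha heq
    have h2 := Finset.mem_Icc.1 (hall a (by omega))
    apply iterate_parent_ne hp h2.1 (j := b - a) (by omega)
    rw [← Function.iterate_add_apply, Nat.sub_add_cancel hab.le, heq]
  rcases Nat.lt_or_gt_of_ne hne with h | h
  · exact key a b h ha heq
  · exact key b a h hb heq.symm

/-- The outcome of a walk in a tree tells whether all later vertices are smaller. -/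
theorem walk_lt_iff {n m u v : ℕ} {p : ℕ → ℕ} (hp : p ∈ parents n) (hv : 2 ≤ v) (hvn : v ≤ n)
    (hu : u = p^[m] (p v)) (hlt : ∀ i < m, p^[i] (p v) < v) (hor : m = n ∨ v ≤ u) :
    u < v ↔ ∀ i, 1 ≤ i → p^[i] v < v := by
  constructor
  · intro h i hi
    have hm : m = n := by omega
    obtain ⟨i, rfl⟩ : ∃ i', i = i' + 1 := ⟨i - 1, by omega⟩
    rcases Nat.lt_or_ge i m with h1 | h1
    · exact hlt i h1
    · have := iterate_parent_top hp hvn (i := i + 1) (by omega)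
      omega
  · intro h
    have := h (m + 1) (by omega)
    rw [Function.iterate_succ_apply] at this
    omega

/-! ### The inverse of `Θ` -/

/-- Copy array `0` to array `1`, without the entry at `n`. -/
def copyTree : Code := .rep 7 (.small (.load 9 0 7) ;; .small (.store 1 7 9))

theorem copyTree_spec {n N K : ℕ} {p : ℕ → ℕ} {Q : Memory → Prop} {M : Memory}
    (h0 : M.reg 0 = n) (h2 : M.reg 2 = 1) (hp : M.arr 0 = p) (ha : M.arr 1 = fun _ => 0)
    (h : ∀ M', Frame copyTree.toProgram M M' → (M'.arr 1 = fun w => if w < n then p w else 0) →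
      Q M') : wp n N K copyTree Q M := by
  refine wp_rep h0 h2 (by decide) (fun j M' => M'.arr 1 = fun w => if w < j then p w else 0)
    ?_ ?_ ?_
  · simp [ha]
  · intro j hj M' hB hF hi hI
    have f0 := hF.arr 0 (by decide)
    simp only [wp, f0, hp, hI, hi]
    funext w
    simp [Function.update_apply, hi]
    split_ifs <;> first | rfl | omega | (congr; omega)
  · intro M' hB hF hi hI
    exact h M' hF hI

/-- Mark the vertices that come after `n` on the path from `n` to the root in array `2`. -/
def markPath : Code :=
  .small (.load 6 0 0) ;; .rep 8 (.small (.store 2 6 2) ;; .small (.load 6 0 6))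

theorem markPath_spec {n N K : ℕ} {p : ℕ → ℕ} {Q : Memory → Prop} {M : Memory}
    (h0 : M.reg 0 = n) (h2 : M.reg 2 = 1) (hp : M.arr 0 = p) (ha : M.arr 2 = fun _ => 0)
    (h : ∀ M', Frame markPath.toProgram M M' →
      (∀ w, 0 < M'.arr 2 w ↔ ∃ i < n, w = p^[i + 1] n) → Q M') : wp n N K markPath Q M := by
  apply wp_frame
  refine wp_rep (by simpa using h0) (by simpa using h2) (by decide)
    (fun j M' => M'.reg 6 = p^[j + 1] n ∧ ∀ w, 0 < M'.arr 2 w ↔ ∃ i < j, w = p^[i + 1] n) ?_ ?_ ?_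
  · simp [ha, hp, h0]
  · rintro j hj M' hB hF hi ⟨h6, hI⟩
    have f0 := hF.arr 0 (by decide)
    have f2 := hF.reg 2 (by decide)
    simp [hp, h2] at f0 f2
    simp only [wp, f0, f2]
    constructor
    · simp [h6, ← Function.iterate_succ_apply' p, f0]
    · intro w
      have : (∃ i < j + 1, w = p^[i + 1] n) ↔ w = p^[j + 1] n ∨ ∃ i < j, w = p^[i + 1] n := by
        constructor
        · rintro ⟨i, hi, rfl⟩
          rcases Nat.lt_succ_iff_lt_or_eq.1 hi with h1 | rfl
          · exact Or.inr ⟨i, h1, rfl⟩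
          · exact Or.inl rfl
        · rintro (rfl | ⟨i, hi, rfl⟩)
          · exact ⟨j, by omega, rfl⟩
          · exact ⟨i, by omega, rfl⟩
      rw [this, ← hI w, ← h6]
      by_cases hw : w = M'.reg 6
      · simp [hw]
      · simp [hw]
  · rintro M' hB hF hi ⟨_, hI⟩ hF'
    exact h M' hF' hI

/-- Replace the parents of the records, from the largest one to the smallest one. -/
def replaceRecords : Code :=
  .small (.load 5 0 0) ;;
  .rep 7 (.small (.sub 4 0 7) ;;
    ifThen (.small 2 4) (.small (.load 9 2 4) ;;
      ifThen (.small 3 9) (walk 0 ;;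
        ifThen (.small 6 4) (.small (.load 9 0 4) ;; .small (.store 1 4 5) ;; .small (.move 5 9)))))

theorem above_top {n : ℕ} {R : Finset ℕ} (hR : ∀ r ∈ R, r < n) : above n R n = n := by
  rw [above, dif_neg]
  rintro ⟨r, hr⟩
  rw [Finset.mem_filter] at hr
  have := hR r hr.1; omega

/-- The update of the next larger record during a scan of the vertices in decreasing order. -/
theorem above_pred {n v : ℕ} {R : Finset ℕ} (hR : ∀ r ∈ R, r < n) (hv : v + 1 ≤ n) :
    above n R v = if v + 1 ∈ R then v + 1 else above n R (v + 1) := by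
  split_ifs with h
  · exact above_eq hR (Or.inr h) (by omega) (fun r _ hr => by omega)
  · rcases Nat.lt_or_ge (v + 1) n with h1 | h1
    · obtain ⟨h2, h3, h4⟩ := above_spec hR h1
      refine above_eq hR h2 (by omega) (fun r hr hlt => ?_)
      by_contra hcon
      have hne : r ≠ v + 1 := fun h' => h (h' ▸ hr)
      have := h4 r (Or.inr hr) (by omega)
      omega
    · have hvn : v + 1 = n := by omega
      rw [hvn, above_top hR]
      exact above_eq hR (Or.inl rfl) (by omega) (fun r hr hlt => by omega)

/-- During the scan from `n` downwards, register `5` holds the parent of the smallest record (or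
`n`) above the vertices still to be treated. This is the value that the next record has to receive.
-/
theorem replaceRecords_spec {n N K : ℕ} {p : ℕ → ℕ} {Q : Memory → Prop} {M : Memory} (hn : 2 ≤ n)
    (h0 : M.reg 0 = n) (h2 : M.reg 2 = 1) (h3 : M.reg 3 = 0) (hp : M.arr 0 = p)
    (hpp : p ∈ parents n) (ha : M.arr 1 = fun w => if w < n then p w else 0)
    (hm : ∀ w, 0 < M.arr 2 w ↔ ∃ i < n, w = p^[i + 1] n)
    (h : ∀ M', Frame replaceRecords.toProgram M M' → M'.arr 1 = thetaInvFun n p → Q M') :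
    wp n N K replaceRecords Q M := by
  apply wp_frame
  have hR := records_lt (p := p) hn
  refine wp_rep (by simpa using h0) (by simpa using h2) (by decide)
    (fun j M' => M'.reg 5 = p (above n (records n p) (n - j)) ∧ M'.arr 1 = fun w =>
      if n - j < w then thetaInvFun n p w else if w < n then p w else 0) ?_ ?_ ?_
  · constructor
    · simp [hp, h0, above_top hR]
    · simp only [ha]
      funext w
      split_ifs with h1 h2 h3
      · omega
      · rfl
      · rw [thetaInvFun, if_neg (fun h4 => by have := hR w h4; omega), if_neg (by omega),
          hpp.2.1 w (by simp; omega)]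
      · rfl
  · rintro j hj M' hB hF hi ⟨h5, h1⟩
    have f0 := hF.reg 0 (by decide)
    have f2 := hF.reg 2 (by decide)
    have f3 := hF.reg 3 (by decide)
    have fp := hF.arr 0 (by decide)
    have fm := hF.arr 2 (by decide)
    simp [hp, h2, h0, h3] at f0 f2 fp fm f3
    obtain ⟨v, hv⟩ : ∃ v, n - j = v + 1 := ⟨n - j - 1, by omega⟩
    have hv' : n - (j + 1) = v := by omega
    have hnotrec : v + 1 ∉ records n p →
        (M'.reg 5 = p (above n (records n p) (n - (j + 1))) ∧ M'.arr 1 = fun w =>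
          if n - (j + 1) < w then thetaInvFun n p w else if w < n then p w else 0) := by
      intro hrec
      rw [hv', above_pred hR (by omega), if_neg hrec, h5, hv]
      refine ⟨rfl, ?_⟩
      rw [h1, hv]
      funext w
      by_cases hw : w = v + 1
      · subst hw
        rw [if_neg (lt_irrefl _), if_pos (Nat.lt_succ_self v), thetaInvFun, if_neg hrec]
        split_ifs <;> first | rfl | omega
      · split_ifs <;> first | rfl | omega
    simp only [ifThen, wp, Test.holds, ne_eq, Nat.reduceEqDiff,
      not_false_eq_true, Function.update_of_ne, Function.update_self, f0, f2, f3, fp, fm, hi, hv]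
    -- The marks cover the whole path behind `n`, as it is at most `1` after `n` steps. The vertex
    -- `n` itself is not marked, because the tree has no cycle.
    have hrec1 : v + 1 ∈ records n p ↔ (1 < v + 1 ∧ 0 < M.arr 2 (v + 1)) ∧
        ∀ i, 1 ≤ i → p^[i] (v + 1) < v + 1 := by
      rw [mem_records, hm, ← and_assoc]
      refine and_congr_left fun h4 => ?_
      rw [Finset.mem_Icc]
      constructor
      · rintro ⟨h5, i, hi⟩
        refine ⟨by omega, ?_⟩
        obtain ⟨i, rfl⟩ : ∃ i', i = i' + 1 := ⟨i - 1, by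
          rcases Nat.eq_zero_or_pos i with rfl | h6
          · simp at hi; omega
          · omega⟩
        refine ⟨i, ?_, hi.symm⟩
        by_contra hcon
        have := iterate_parent_top hpp le_rfl (i := i + 1) (by omega)
        omega
      · rintro ⟨h5, i, _, hi⟩
        refine ⟨⟨by omega, ?_⟩, i + 1, hi.symm⟩
        by_contra hcon
        have : v + 1 = n := by omega
        rw [this] at hi
        exact iterate_parent_ne hpp hn (by omega) hi.symm
    refine ⟨fun hlt => ⟨fun hmk => ?_, fun hmk => ?_⟩, fun hlt => ?_⟩
    · apply walk_spec (v := v + 1) (f := p) (by simpa using f0) (by simpa using f2) (by simp)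
        (by simpa using fp)
      rintro M1 hF1 ⟨m, hmn, h6, hall, hor⟩
      have g4 := hF1.reg 4 (by simp [walk, ifThen, toProgram, Program.wreg])
      have g5 := hF1.reg 5 (by simp [walk, ifThen, toProgram, Program.wreg])
      have ga := hF1.arr 1 (by simp [walk, ifThen, toProgram, Program.warr])
      have gp := hF1.arr 0 (by simp [walk, ifThen, toProgram, Program.warr])
      simp [fp] at g4 g5 ga gp
      have hiff := walk_lt_iff hpp (by omega) (by omega) h6 hall hor
      rw [g4, hiff]
      refine ⟨fun hall => ?_, fun hnall => ?_⟩
      · have hrec := hrec1.2 ⟨⟨hlt, hmk⟩, hall⟩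
        simp only [ne_eq, Nat.reduceEqDiff,
          not_false_eq_true, Function.update_of_ne, Function.update_self, g4, g5, gp, ga]
        constructor
        · rw [hv', above_pred hR (by omega), if_pos hrec]
        · rw [h1, hv, hv', h5, hv]
          funext w
          simp only [Function.update_apply]
          by_cases hw : w = v + 1
          · subst hw
            rw [if_pos rfl, if_pos (by omega), thetaInvFun, if_pos hrec]
          · rw [if_neg hw]
            split_ifs <;> first | rfl | omega
      · have := hnotrec (fun hrec => hnall (hrec1.1 hrec).2)
        simp only [ne_eq, Nat.reduceEqDiff,
          not_false_eq_true, Function.update_of_ne, g5, ga]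
        exact this
    · have := hnotrec (fun hrec => hmk (hrec1.1 hrec).1.2)
      simpa using this
    · have := hnotrec (fun hrec => hlt (hrec1.1 hrec).1.1)
      simpa using this
  · rintro M' hB hF hi ⟨_, h1⟩ hF'
    apply h M' hF'
    rw [h1]
    funext w
    split_ifs with h2 h3
    · rfl
    · rw [thetaInvFun, if_neg, if_neg (by omega)]
      intro hw
      have := (mem_records.1 hw).1
      rw [Finset.mem_Icc] at this; omega
    · omega

/-! ### Labels -/

/-- Number the values of array `1` by first occurrence, in array `3`. -/
def numberValues : Code :=
  .small (.move 10 3) ;;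
  .rep 7 (ifThen (.small 2 7) (.small (.load 12 1 7) ;; .small (.load 9 3 12) ;;
    ifNot (.small 3 9) (.small (.add 10 10 2) ;; .small (.store 3 12 10))))

/-- Before round `j` the arguments up to `j - 1` have been treated, and register `10` counts their
different values. A zero in array `3` shows that the value is new. -/
theorem numberValues_spec {n N K : ℕ} {f : ℕ → ℕ} {Q : Memory → Prop} {M : Memory} (hn : 2 ≤ n)
    (h0 : M.reg 0 = n) (h2 : M.reg 2 = 1) (h3 : M.reg 3 = 0) (hf : M.arr 1 = f)
    (ha : M.arr 3 = fun _ => 0)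
    (h : ∀ M', Frame numberValues.toProgram M M' → M'.arr 3 = label n f → Q M') :
    wp n N K numberValues Q M := by
  apply wp_frame
  refine wp_rep (by simpa using h0) (by simpa using h2) (by decide)
    (fun j M' => M'.reg 10 = valueCount f (j - 1) ∧ M'.arr 3 = fun w =>
      if w ∈ (Icc 2 (j - 1)).image f then valueCount f (firstOcc n f w) else 0) ?_ ?_ ?_
  · simp [ha, h3, valueCount]
  · rintro j hj M' hB hF hi ⟨h10, hI⟩
    have f2 := hF.reg 2 (by decide)
    have f3 := hF.reg 3 (by decide)
    have f1 := hF.arr 1 (by decide)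
    simp [hf, h2, h3] at f1 f2 f3
    simp only [ifThen, ifNot, wp, Test.holds, ne_eq, Nat.reduceEqDiff,
      not_false_eq_true, Function.update_of_ne, Function.update_self, f2, f3, f1, hi]
    refine ⟨fun hlt => ?_, fun hlt => ?_⟩
    · have hjm : j ∈ Icc 2 (n - 1) := by rw [Finset.mem_Icc]; omega
      have hins : Icc 2 j = insert j (Icc 2 (j - 1)) := by
        ext x; simp only [Finset.mem_insert, Finset.mem_Icc]; omega
      have hpos : 0 < M'.arr 3 (f j) ↔ f j ∈ (Icc 2 (j - 1)).image f := by
        rw [hI]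
        simp only
        split_ifs with h4
        · simp only [h4, iff_true]
          have h5 := label_pos (f := f) hjm
          rwa [label_of_mem (Finset.mem_image_of_mem f hjm)] at h5
        · simp [h4]
      rw [hpos]
      refine ⟨fun hmem => ?_, fun hmem => ?_⟩
      · have himg : (Icc 2 j).image f = (Icc 2 (j - 1)).image f := by
          rw [hins, Finset.image_insert, Finset.insert_eq_self.2 hmem]
        simp only [Nat.add_sub_cancel, valueCount, himg]
        exact ⟨h10, hI⟩
      · have hfirst : firstOcc n f (f j) = j := by
          refine firstOcc_eq hjm (fun y hy hlt heq => hmem ?_)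
          rw [← heq]
          apply Finset.mem_image_of_mem
          rw [Finset.mem_Icc] at *; omega
        have hcount : valueCount f j = valueCount f (j - 1) + 1 := by
          rw [valueCount, hins, Finset.image_insert, Finset.card_insert_of_notMem hmem]; rfl
        have hle : valueCount f j ≤ n := by
          refine Finset.card_image_le.trans ?_
          simp; omega
        rw [h10, ← hcount]
        refine ⟨hle, rfl, ?_⟩
        rw [hI]
        funext w
        simp only [Function.update_apply, Nat.add_sub_cancel]
        simp only [hins, Finset.image_insert, Finset.mem_insert]
        by_cases hw : w = f j
        · rw [if_pos hw, if_pos (Or.inl hw), hw, hfirst]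
        · rw [if_neg hw]
          simp only [hw, false_or]
    · have e1 : Icc 2 j = ∅ := by rw [Finset.Icc_eq_empty_iff]; omega
      have e2 : Icc 2 (j - 1) = ∅ := by rw [Finset.Icc_eq_empty_iff]; omega
      simp only [Nat.add_sub_cancel, valueCount, e1]
      simp only [valueCount, e2] at h10 hI
      exact ⟨h10, hI⟩
  · rintro M' hB hF hi ⟨_, h1⟩ hF'
    apply h M' hF'
    rw [h1]; rfl

/-! ### The rank of the set of leaves -/

/-- Add the rank of the set of the zeros of array `3`. -/
def addBinomials : Code :=
  .small (.move 11 1) ;;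
  .rep 7 (.small (.sub 4 0 7) ;; .small (.load 9 3 4) ;;
    ifNot (.small 3 9) (.small (.sub 12 4 2) ;; .big (.binomial 1 12 11) ;;
      .big (.arith .add 0 0 1) ;; .small (.sub 11 11 2)))

theorem filter_le_succ_of_mem {S : Finset ℕ} {v : ℕ} (h : v + 1 ∈ S) :
    S.filter (· ≤ v + 1) = insert (v + 1) (S.filter (· ≤ v)) := by
  ext x
  rw [Finset.mem_insert, Finset.mem_filter, Finset.mem_filter]
  constructor
  · rintro ⟨h1, h2⟩
    by_cases hx : x = v + 1
    · exact Or.inl hx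
    · exact Or.inr ⟨h1, by omega⟩
  · rintro (rfl | ⟨h1, h2⟩)
    · exact ⟨h, le_rfl⟩
    · exact ⟨h1, by omega⟩

theorem filter_le_succ_of_notMem {S : Finset ℕ} {v : ℕ} (h : v + 1 ∉ S) :
    S.filter (· ≤ v + 1) = S.filter (· ≤ v) := by
  apply Finset.filter_congr
  intro x hx
  have : x ≠ v + 1 := fun h' => h (h' ▸ hx)
  omega

/-- The elements are met in decreasing order, and register `11` holds the number of those still to
come. The sum so far plus the rank of the remaining sequence is invariant. -/
theorem addBinomials_spec {n N K : ℕ} {S : Finset ℕ} {Q : Memory → Prop} {M : Memory}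
    (h0 : M.reg 0 = n) (h2 : M.reg 2 = 1) (h3 : M.reg 3 = 0) (h1 : M.reg 1 = S.card)
    (hS : S ⊆ Icc 1 n) (hz : ∀ v ∈ Icc 1 n, M.arr 3 v = 0 ↔ v ∈ S) (hb : M.breg 0 = 0)
    (hN : n.choose S.card ≤ N)
    (h : ∀ M', Frame addBinomials.toProgram M M' →
      M'.breg 0 = rankDecreasing (S.sort (· ≥ ·)) → Q M') :
    wp n N K addBinomials Q M := by
  apply wp_frame
  have hlt : rankDecreasing (S.sort (· ≥ ·)) < n.choose S.card :=
    rankDecreasing_lt (sort_mem_decreasingSeqs hS rfl)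
  have hall : S.filter (· ≤ n) = S :=
    Finset.filter_true_of_mem fun x hx => (Finset.mem_Icc.1 (hS hx)).2
  have hnone : S.filter (· ≤ 0) = ∅ := by
    apply Finset.filter_false_of_mem
    intro x hx
    have := Finset.mem_Icc.1 (hS hx)
    omega
  refine wp_rep (by simpa using h0) (by simpa using h2) (by decide)
    (fun j M' => M'.reg 11 = (S.filter (· ≤ n - j)).card ∧
      M'.breg 0 + rankDecreasing ((S.filter (· ≤ n - j)).sort (· ≥ ·)) =
        rankDecreasing (S.sort (· ≥ ·))) ?_ ?_ ?_
  · simp [hall, h1, hb]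
  · rintro j hj M' hB hF hi ⟨h11, hI⟩
    have f0 := hF.reg 0 (by decide)
    have f2 := hF.reg 2 (by decide)
    have f3 := hF.reg 3 (by decide)
    have fa := hF.arr 3 (by decide)
    simp [h0, h2, h3] at f0 f2 f3 fa
    obtain ⟨v, hv⟩ : ∃ v, n - j = v + 1 := ⟨n - j - 1, by omega⟩
    have hv' : n - (j + 1) = v := by omega
    rw [hv] at h11 hI
    simp only [ifNot, wp, Test.holds, BinOp.eval, ne_eq, Nat.reduceEqDiff, not_false_eq_true,
      Function.update_of_ne, Function.update_self, f0, f2, f3, fa, hi, hv, hv',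
      Nat.add_sub_cancel]
    have hz' := hz (v + 1) (by rw [Finset.mem_Icc]; omega)
    refine ⟨fun hpos => ?_, fun hpos => ?_⟩
    · rw [filter_le_succ_of_notMem (by rw [← hz']; omega)] at h11 hI
      exact ⟨h11, hI⟩
    · rw [filter_le_succ_of_mem (by rw [← hz']; omega)] at h11 hI
      have hnm : v + 1 ∉ S.filter (· ≤ v) := by simp
      rw [Finset.card_insert_of_notMem hnm] at h11
      rw [Finset.sort_insert _ (fun b hb => by
        have := (Finset.mem_filter.1 hb).2; omega) hnm, rankDecreasing, Finset.length_sort,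
        Nat.add_sub_cancel] at hI
      rw [h11]
      refine ⟨by omega, by omega, rfl, ?_⟩
      omega
  · rintro M' hB hF hi ⟨_, hI⟩ hF'
    apply h M' hF'
    rw [Nat.sub_self, hnone] at hI
    simpa [rankDecreasing] using hI

/-! ### The rank of the insertion sequence -/

/-- Count the entries of array `3` after the position in register `4` that are positive and less
than register `9`. -/
def countLater : Code :=
  .small (.move 12 3) ;;
  .rep 8 (.small (.add 5 8 2) ;; ifThen (.small 4 5) (.small (.load 6 3 5) ;;
    ifThen (.small 3 6) (ifThen (.small 6 9) (.small (.add 12 12 2)))))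

theorem countLater_spec {n N K v t : ℕ} {lab : ℕ → ℕ} {Q : Memory → Prop} {M : Memory}
    (h0 : M.reg 0 = n) (h2 : M.reg 2 = 1) (h3 : M.reg 3 = 0) (h4 : M.reg 4 = v)
    (h9 : M.reg 9 = t) (ha : M.arr 3 = lab)
    (h : ∀ M', Frame countLater.toProgram M M' →
      M'.reg 12 = ((Icc (v + 1) n).filter (fun w => 0 < lab w ∧ lab w < t)).card → Q M') :
    wp n N K countLater Q M := by
  apply wp_frame
  refine wp_rep (by simpa using h0) (by simpa using h2) (by decide)
    (fun j M' => M'.reg 12 = ((Icc (v + 1) j).filter (fun w => 0 < lab w ∧ lab w < t)).card)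
    ?_ ?_ ?_
  · simp [h3]
  · rintro j hj M' hB hF hi hI
    have f2 := hF.reg 2 (by decide)
    have f3 := hF.reg 3 (by decide)
    have f4 := hF.reg 4 (by decide)
    have f9 := hF.reg 9 (by decide)
    have fa := hF.arr 3 (by decide)
    simp [h4, h2, h3, h9, ha] at f2 f3 f4 f9 fa
    simp only [ifThen, wp, Test.holds, ne_eq, Nat.reduceEqDiff, not_false_eq_true,
      Function.update_of_ne, Function.update_self, f2, f3, f4, f9, fa, hi, hI]
    refine ⟨by omega, fun hlt => ?_, fun hlt => ?_⟩
    · have hins : Icc (v + 1) (j + 1) = insert (j + 1) (Icc (v + 1) j) := by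
        ext x; simp only [Finset.mem_insert, Finset.mem_Icc]; omega
      have hnm : j + 1 ∉ (Icc (v + 1) j).filter (fun w => 0 < lab w ∧ lab w < t) := by simp
      have hle : ((Icc (v + 1) j).filter (fun w => 0 < lab w ∧ lab w < t)).card ≤ j := by
        refine (Finset.card_filter_le _ _).trans ?_
        simp
      rw [hins, Finset.filter_insert]
      refine ⟨fun h1 => ⟨fun h5 => ⟨by omega, ?_⟩, fun h5 => ?_⟩, fun h1 => ?_⟩
      · rw [if_pos ⟨h1, h5⟩, Finset.card_insert_of_notMem hnm]
      · rw [if_neg (by tauto)]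
      · rw [if_neg (by tauto)]
    · have e1 : Icc (v + 1) (j + 1) = ∅ := by rw [Finset.Icc_eq_empty_iff]; omega
      have e2 : Icc (v + 1) j = ∅ := by rw [Finset.Icc_eq_empty_iff]; omega
      rw [e1, e2]
  · rintro M' hB hF hi hI hF'
    exact h M' hF' hI

/-- Multiply big register `0` by `K!` and add the rank of the insertion sequence of the permutation
that is formed by the positive entries of array `3`. -/
def horner : Code :=
  .small (.sub 11 0 1) ;;
  .rep 7 (.small (.add 4 7 2) ;; .small (.load 9 3 4) ;;
    ifThen (.small 3 9) (countLater ;; .big (.ofSmall 1 11) ;; .big (.arith .mul 0 0 1) ;;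
      .big (.ofSmall 1 12) ;; .big (.arith .add 0 0 1) ;; .small (.sub 11 11 2)))

theorem filter_lt_of_mem {P : Finset ℕ} {v : ℕ} (h : v + 1 ∈ P) :
    P.filter (v < ·) = insert (v + 1) (P.filter (v + 1 < ·)) := by
  ext x
  rw [Finset.mem_insert, Finset.mem_filter, Finset.mem_filter]
  constructor
  · rintro ⟨h1, h2⟩
    by_cases hx : x = v + 1
    · exact Or.inl hx
    · exact Or.inr ⟨h1, by omega⟩
  · rintro (rfl | ⟨h1, h2⟩)
    · exact ⟨h, by omega⟩
    · exact ⟨h1, by omega⟩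

theorem filter_lt_of_notMem {P : Finset ℕ} {v : ℕ} (h : v + 1 ∉ P) :
    P.filter (v < ·) = P.filter (v + 1 < ·) := by
  apply Finset.filter_congr
  intro x hx
  have : x ≠ v + 1 := fun h' => h (h' ▸ hx)
  omega

theorem sort_filter_lt {P : Finset ℕ} {v : ℕ} (h : v + 1 ∈ P) :
    (P.filter (v < ·)).sort (· ≤ ·) = (v + 1) :: (P.filter (v + 1 < ·)).sort (· ≤ ·) := by
  rw [filter_lt_of_mem h, Finset.sort_insert]
  · intro b hb
    have := (Finset.mem_filter.1 hb).2; omega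
  · simp

/-- If `c` entries of the permutation remain, `c!` times the accumulated value plus the rank of the
remaining Lehmer code is invariant. No factorial is ever computed: each round multiplies by the
current `c`. -/
theorem horner_spec {n N K : ℕ} {P : Finset ℕ} {lab : ℕ → ℕ} {Q : Memory → Prop} {M : Memory}
    (h0 : M.reg 0 = n) (h2 : M.reg 2 = 1) (h3 : M.reg 3 = 0) (h1 : n - M.reg 1 = P.card)
    (ha : M.arr 3 = lab) (hP : P ⊆ Icc 1 n) (hpos : ∀ w ∈ Icc 1 n, 0 < lab w ↔ w ∈ P)
    (hN : M.breg 0 * P.card.factorial +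
      rankInsertion (lehmer ((P.sort (· ≤ ·)).map lab)) ≤ N) (hPN : P.card ≤ N)
    (h : ∀ M', Frame horner.toProgram M M' → M'.breg 0 = M.breg 0 * P.card.factorial +
      rankInsertion (lehmer ((P.sort (· ≤ ·)).map lab)) → Q M') :
    wp n N K horner Q M := by
  apply wp_frame
  generalize hX : M.breg 0 * P.card.factorial +
      rankInsertion (lehmer ((P.sort (· ≤ ·)).map lab)) = X at *
  have hall : P.filter (0 < ·) = P :=
    Finset.filter_true_of_mem fun x hx => (Finset.mem_Icc.1 (hP hx)).1
  have hnone : P.filter (n < ·) = ∅ := by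
    apply Finset.filter_false_of_mem
    intro x hx
    have := Finset.mem_Icc.1 (hP hx)
    omega
  have hlen : ∀ l, (lehmer l).length = l.length := by
    intro l
    induction l with
    | nil => rfl
    | cons a l ih => simp [lehmer, ih]
  refine wp_rep (by simpa using h0) (by simpa using h2) (by decide)
    (fun j M' => M'.reg 11 = (P.filter (j < ·)).card ∧
      M'.breg 0 * (P.filter (j < ·)).card.factorial +
        rankInsertion (lehmer (((P.filter (j < ·)).sort (· ≤ ·)).map lab)) = X) ?_ ?_ ?_
  · simp [hall, h1, h0, hX]
  · rintro j hj M' hB hF hi ⟨h11, hI⟩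
    have f0 := hF.reg 0 (by decide)
    have f2 := hF.reg 2 (by decide)
    have f3 := hF.reg 3 (by decide)
    have fa := hF.arr 3 (by decide)
    simp [h0, h2, h3, ha] at f0 f2 f3 fa
    simp only [ifThen, wp, Test.holds, BinOp.eval, ne_eq, Nat.reduceEqDiff, not_false_eq_true,
      Function.update_of_ne, Function.update_self, f0, f2, f3, fa, hi]
    have hz' := hpos (j + 1) (by rw [Finset.mem_Icc]; omega)
    refine ⟨by omega, fun hlab => ?_, fun hlab => ?_⟩
    · have hmem := hz'.1 hlab
      apply countLater_spec (v := j + 1) (t := lab (j + 1)) (lab := lab) (by simpa using f0)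
        (by simpa using f2) (by simpa using f3) (by simp) (by simp) (by simpa using fa)
      rintro M1 hF1 h12
      have g2 := hF1.reg 2 (by decide)
      have g11 := hF1.reg 11 (by decide)
      have gb := hF1.breg 0 (by decide)
      simp [f2, h11] at g2 g11 gb
      rw [sort_filter_lt hmem, filter_lt_of_mem hmem, Finset.card_insert_of_notMem (by simp),
        List.map_cons, lehmer, rankInsertion, hlen, List.length_map, Finset.length_sort] at hI
      have hcount : (((P.filter (j + 1 < ·)).sort (· ≤ ·)).map lab).countP
          (fun i => decide (i < lab (j + 1))) = M1.reg 12 := by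
        rw [h12, List.countP_map, List.countP_eq_length_filter,
          ← List.toFinset_card_of_nodup ((Finset.sort_nodup _ _).filter _)]
        congr 1
        ext w
        simp only [List.mem_toFinset, List.mem_filter, Finset.mem_sort, Finset.mem_filter,
          Function.comp, decide_eq_true_eq, Finset.mem_Icc]
        constructor
        · rintro ⟨⟨h5, h6⟩, h7⟩
          have h8 := hP h5
          exact ⟨⟨by omega, (Finset.mem_Icc.1 h8).2⟩, (hpos w h8).2 h5, h7⟩
        · rintro ⟨⟨h5, h6⟩, h7, h8⟩
          exact ⟨⟨(hpos w (by rw [Finset.mem_Icc]; omega)).1 h7, by omega⟩, h8⟩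
      rw [hcount, Nat.factorial_succ, ← add_assoc, ← mul_assoc, ← add_mul] at hI
      have hcard : #{x ∈ P | j < x} = #{x ∈ P | j + 1 < x} + 1 := by
        rw [filter_lt_of_mem hmem, Finset.card_insert_of_notMem (by simp)]
      have hle : #{x ∈ P | j < x} ≤ P.card := Finset.card_filter_le _ _
      -- The intermediate value is at most the invariant, since it is multiplied there by a positive
      -- factorial; so it stays below `N`.
      have hfac := Nat.le_mul_of_pos_right
        (M'.breg 0 * (#{x ∈ P | j + 1 < x} + 1) + M1.reg 12)
        (Nat.factorial_pos #{x ∈ P | j + 1 < x})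
      simp only [wp, BinOp.eval, ne_eq, Nat.reduceEqDiff, not_false_eq_true,
        Function.update_of_ne, Function.update_self, g2, g11, gb, hcard, Nat.add_sub_cancel,
        zero_ne_one, one_ne_zero]
      refine ⟨by omega, by omega, by omega, by omega, trivial, hI⟩
    · have hmem : j + 1 ∉ P := fun h' => hlab (hz'.2 h')
      rw [filter_lt_of_notMem hmem] at h11 hI
      exact ⟨h11, hI⟩
  · rintro M' hB hF hi ⟨_, hI⟩ hF'
    apply h M' hF'
    rw [hnone] at hI
    simpa [lehmer, rankInsertion] using hI

/-! ### The rank of the restricted growth sequence -/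

/-- Multiply big register `0` by the number of restricted growth sequences. -/
def mulGrowthCount : Code :=
  .small (.sub 4 0 2) ;; .small (.sub 4 4 2) ;; .small (.sub 4 4 2) ;; .big (.extension 1 4 3) ;;
  .big (.arith .mul 0 0 1)

theorem extensionCount_sub {n K : ℕ} (hn : 3 ≤ n) :
    extensionCount K (n - 3) 0 = Nat.stirlingSecond (n - 2) K := by
  rw [extensionCount_zero]; congr 1; omega

theorem mulGrowthCount_spec {n N K : ℕ} {Q : Memory → Prop} {M : Memory} (hn : 3 ≤ n)
    (h0 : M.reg 0 = n) (h2 : M.reg 2 = 1) (h3 : M.reg 3 = 0)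
    (hN : Nat.stirlingSecond (n - 2) K ≤ N) (hN' : M.breg 0 * Nat.stirlingSecond (n - 2) K ≤ N)
    (h : ∀ M', Frame mulGrowthCount.toProgram M M' →
      M'.breg 0 = M.breg 0 * Nat.stirlingSecond (n - 2) K → Q M') :
    wp n N K mulGrowthCount Q M := by
  apply wp_frame
  simp only [mulGrowthCount, wp, BinOp.eval, ne_eq, Nat.reduceEqDiff, not_false_eq_true,
    Function.update_of_ne, Function.update_self, h0, h2, h3, Nat.sub_sub, Nat.reduceAdd,
    extensionCount_sub hn, zero_ne_one, one_ne_zero]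
  exact ⟨hN, hN', fun hF => h _ hF (by simp)⟩

/-- Add the rank of the restricted growth sequence. -/
def addExtensions : Code :=
  .small (.move 10 3) ;;
  .rep 7 (ifThen (.small 2 7) (.small (.load 12 1 7) ;; .small (.load 9 3 12) ;;
    .small (.sub 12 9 2) ;; .small (.sub 11 10 2) ;; .small (.sub 4 0 2) ;; .small (.sub 4 4 7) ;;
    .big (.extension 1 4 11) ;; .big (.ofSmall 2 12) ;; .big (.arith .mul 1 2 1) ;;
    .big (.arith .add 0 0 1) ;; ifThen (.small 10 9) (.small (.move 10 9))))

/-- Along a growth sequence the relevant counts do not increase. Every table entry consulted is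
therefore at most the first one, the Stirling number. -/
theorem extensionCount_le {K t m a : ℕ} (ha : a ≤ m + 1) :
    extensionCount K t (max m a) ≤ extensionCount K (t + 1) m := by
  rw [extensionCount]
  rcases Nat.lt_or_ge m a with h | h
  · rw [max_eq_right h.le, show a = m + 1 by omega]; omega
  · rw [max_eq_left h]
    have := Nat.le_mul_of_pos_left (extensionCount K t m) (show 0 < m + 1 by omega)
    omega

theorem addExtensions_spec {n N K : ℕ} {f : ℕ → ℕ} {Q : Memory → Prop} {M : Memory} (hn : 3 ≤ n)
    (h0 : M.reg 0 = n) (h2 : M.reg 2 = 1) (h3 : M.reg 3 = 0) (hf : f ∈ functions n)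
    (ha1 : M.arr 1 = f) (ha3 : M.arr 3 = label n f) (hK : ((Icc 2 (n - 1)).image f).card = K)
    (hKN : K ≤ N) (hSN : Nat.stirlingSecond (n - 2) K ≤ N)
    (hN : M.breg 0 + rankGrowth K (seqS n f) ≤ N)
    (h : ∀ M', Frame addExtensions.toProgram M M' →
      M'.breg 0 = M.breg 0 + rankGrowth K (seqS n f) → Q M') :
    wp n N K addExtensions Q M := by
  apply wp_frame
  have hs : seqS n f ∈ growthSeqs (n - 2) K := hK ▸ seqS_mem hn hf
  have hlen : (seqS n f).length = n - 2 := length_seqS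
  have hget : ∀ x, 2 ≤ x → x < n → (seqS n f).getD (x - 2) 0 = label n f (f x) - 1 := by
    intro x hx hx'
    have := getD_seqS hf (i := x - 2) (by omega)
    rwa [Nat.sub_add_cancel hx] at this
  -- The leading `0` adds nothing to the rank and keeps the maximum `0`, so it can be processed like
  -- all other entries.
  have hval : GrowthValid K 0 (seqS n f) ∧ rankGrowthAux K 0 (seqS n f) = rankGrowth K (seqS n f) := by
    rw [show n - 2 = (n - 3) + 1 by omega] at hs
    obtain ⟨l, hl, _, hv⟩ := mem_growthSeqs.1 hs
    rw [hl]
    exact ⟨⟨by omega, by simpa using hv⟩, by simp [rankGrowthAux, rankGrowth]⟩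
  generalize hX : M.breg 0 + rankGrowth K (seqS n f) = X at *
  generalize seqS n f = s at *
  -- Register `10` holds one more than the current maximum, and `0` before the first entry, where
  -- truncated subtraction still gives maximum `0`.
  refine wp_rep (by simpa using h0) (by simpa using h2) (by decide)
    (fun j M' => GrowthValid K (M'.reg 10 - 1) (s.drop (j - 2)) ∧
      M'.breg 0 + rankGrowthAux K (M'.reg 10 - 1) (s.drop (j - 2)) = X ∧
      (j < n → extensionCount K (n - 1 - max j 2) (M'.reg 10 - 1) ≤ N)) ?_ ?_ ?_
  · refine ⟨by simpa [h3] using hval.1, by simp [h3, hval.2, hX], fun _ => ?_⟩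
    have : n - 1 - 2 = n - 3 := by omega
    simpa [h3, this, extensionCount_sub hn] using hSN
  · rintro j hj M' hB hF hi ⟨hI1, hI2, hI3⟩
    have f0 := hF.reg 0 (by decide)
    have f2 := hF.reg 2 (by decide)
    have f1 := hF.arr 1 (by decide)
    have f3 := hF.arr 3 (by decide)
    simp [h0, h2, ha1, ha3] at f0 f2 f1 f3
    simp only [ifThen, wp, Test.holds, BinOp.eval, ne_eq, Nat.reduceEqDiff, not_false_eq_true,
      Function.update_of_ne, Function.update_self, f0, f2, f1, f3, hi, zero_ne_one, one_ne_zero]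
    refine ⟨fun hlt => ?_, fun hlt => ?_⟩
    · have hjm : j ∈ Icc 2 (n - 1) := by rw [Finset.mem_Icc]; omega
      have hpos := label_pos (f := f) hjm
      have hle := label_le (n := n) (f := f) (f j)
      rw [hK] at hle
      have hdrop : s.drop (j - 2) = (label n f (f j) - 1) :: s.drop (j + 1 - 2) := by
        rw [List.drop_eq_getElem_cons (by omega), ← hget j (by omega) hj,
          List.getD_eq_getElem _ _ (by omega)]
        congr 2; omega
      rw [hdrop] at hI1 hI2
      have hlen' : (s.drop (j + 1 - 2)).length = n - 1 - j := by rw [List.length_drop]; omega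
      rw [rankGrowthAux, hlen'] at hI2
      have hI3' := hI3 hj
      rw [max_eq_left (by omega)] at hI3'
      have hfin : ∀ c, c - 1 = max (M'.reg 10 - 1) (label n f (f j) - 1) →
          GrowthValid K (c - 1) (s.drop (j + 1 - 2)) ∧
          M'.breg 0 + (label n f (f j) - 1) * extensionCount K (n - 1 - j) (M'.reg 10 - 1) +
            rankGrowthAux K (c - 1) (s.drop (j + 1 - 2)) = X ∧
          (j + 1 < n → extensionCount K (n - 1 - max (j + 1) 2) (c - 1) ≤ N) := by
        intro c hc
        rw [hc]
        refine ⟨hI1.2, by omega, fun hj' => ?_⟩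
        have h5 := extensionCount_le (K := K) (t := n - 1 - (j + 1)) hI1.1
        rw [show n - 1 - (j + 1) + 1 = n - 1 - j by omega] at h5
        rw [max_eq_left (show 2 ≤ j + 1 by omega)]
        omega
      refine ⟨hI3', by omega, by omega, by omega, fun hc => ?_, fun hc => ?_⟩
      · exact hfin _ (by omega)
      · exact hfin _ (by omega)
    · rw [show j + 1 - 2 = j - 2 by omega, show max (j + 1) 2 = max j 2 by omega]
      exact ⟨hI1, hI2, fun _ => hI3 hj⟩
  · rintro M' hB hF hi ⟨_, hI, _⟩ hF'
    apply h M' hF'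
    rw [List.drop_eq_nil_of_le (by omega), rankGrowthAux] at hI
    omega

/-! ### The ranking programs -/

/-- Compute `Θ⁻¹(T)` and its labels. -/
def prepareRank : Code :=
  .small (.const 2 1) ;; copyTree ;; markPath ;; replaceRecords ;; numberValues

/-- The ranking program for trees with a given leaf set. -/
def rankLeafSetCode : Code := prepareRank ;; horner ;; mulGrowthCount ;; addExtensions

/-- The ranking program for trees with a given number of leaves. -/
def rankLeafCountCode : Code :=
  prepareRank ;; addBinomials ;; horner ;; mulGrowthCount ;; addExtensions

section

variable {n k N : ℕ} {T : Finset (ℕ × ℕ)}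

theorem prepareRank_spec {K : ℕ} {Q : Memory → Prop} (hn : 3 ≤ n) (hT : T ∈ trees n)
    (h : ∀ M', Frame prepareRank.toProgram (input n k 0 (treeArray T)) M' → M'.reg 2 = 1 →
      M'.arr 1 = ThetaInv n T → M'.arr 3 = label n (ThetaInv n T) → Q M') :
    wp n N K prepareRank Q (input n k 0 (treeArray T)) := by
  apply wp_frame
  obtain ⟨hp, _⟩ := treeArray_spec hT
  rw [ThetaInv_eq (by omega) hT] at h
  generalize treeArray T = p at *
  refine ⟨by omega, ?_⟩
  apply copyTree_spec (p := p) (by simp [input]) (by simp) (by simp [input]) (by simp [input])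
  intro M1 hF1 h1
  have a0 := hF1.reg 0 (by decide)
  have a2 := hF1.reg 2 (by decide)
  have a3 := hF1.reg 3 (by decide)
  have aa0 := hF1.arr 0 (by decide)
  have aa2 := hF1.arr 2 (by decide)
  have aa3 := hF1.arr 3 (by decide)
  simp [input] at a0 a2 a3 aa0 aa2 aa3
  apply markPath_spec (p := p) a0 a2 aa0 aa2
  intro M2 hF2 h2
  have b0 := (hF2.reg 0 (by decide)).trans a0
  have b2 := (hF2.reg 2 (by decide)).trans a2
  have b3 := (hF2.reg 3 (by decide)).trans a3
  have ba0 := (hF2.arr 0 (by decide)).trans aa0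
  have ba1 := (hF2.arr 1 (by decide)).trans h1
  have ba3 := (hF2.arr 3 (by decide)).trans aa3
  apply replaceRecords_spec (p := p) (by omega) b0 b2 b3 ba0 hp ba1 h2
  intro M3 hF3 h3
  have c0 := (hF3.reg 0 (by decide)).trans b0
  have c2 := (hF3.reg 2 (by decide)).trans b2
  have c3 := (hF3.reg 3 (by decide)).trans b3
  have ca3 := (hF3.arr 3 (by decide)).trans ba3
  apply numberValues_spec (by omega) c0 c2 c3 h3 ca3
  intro M4 hF4 h4 hF
  exact h M4 hF ((hF4.reg 2 (by decide)).trans c2) ((hF4.arr 1 (by decide)).trans h3) h4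

/-- The second part of the ranking programs. -/
theorem rank_tail_spec {Q : Memory → Prop} {M : Memory} (hn : 3 ≤ n)
    (hT : T ∈ treesWithLeafCount n k) (h0 : M.reg 0 = n) (h1 : M.reg 1 = k) (h2 : M.reg 2 = 1)
    (h3 : M.reg 3 = 0) (ha1 : M.arr 1 = ThetaInv n T) (ha3 : M.arr 3 = label n (ThetaInv n T))
    (hSpos : 0 < Nat.stirlingSecond (n - 2) (n - k))
    (hM : (n - k).factorial * Nat.stirlingSecond (n - 2) (n - k) ≤ N)
    (hN : M.breg 0 * ((n - k).factorial * Nat.stirlingSecond (n - 2) (n - k)) +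
      rankLeafSet n k T ≤ N)
    (h : ∀ M', M'.breg 0 = M.breg 0 * ((n - k).factorial * Nat.stirlingSecond (n - 2) (n - k)) +
      rankLeafSet n k T → Q M') :
    wp n N (n - k) (horner ;; mulGrowthCount ;; addExtensions) Q M := by
  have hf := (ThetaInv_mem (by omega) hT.1).1
  have hKc := card_image_eq (by omega) hT
  rw [rankLeafSet_eq hn hT] at hN h
  generalize ThetaInv n T = f at *
  have hfac := Nat.self_le_factorial (n - k)
  have hfacpos := Nat.factorial_pos (n - k)
  have hSN : Nat.stirlingSecond (n - 2) (n - k) ≤ N :=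
    (Nat.le_mul_of_pos_left _ hfacpos).trans hM
  have hKN : n - k ≤ N := (hfac.trans (Nat.le_mul_of_pos_right _ hSpos)).trans hM
  have hX : rankInsertion (lehmer ((((Icc 2 (n - 1)).image f).sort (· ≤ ·)).map (label n f))) =
      rankInsertion (seqH n f) := by
    rw [seqH, insertionSeq_eq_lehmer (N := n - k), partPerm_eq hf, presentList, sdiff_missing hf]
    rw [partPerm_eq hf, ← hKc]; exact map_label_perm hf
  have hmul : (M.breg 0 * (n - k).factorial + rankInsertion (seqH n f)) *
      Nat.stirlingSecond (n - 2) (n - k) =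
      M.breg 0 * ((n - k).factorial * Nat.stirlingSecond (n - 2) (n - k)) +
        rankInsertion (seqH n f) * Nat.stirlingSecond (n - 2) (n - k) := by
    rw [add_mul, mul_assoc]
  have hXle : M.breg 0 * (n - k).factorial + rankInsertion (seqH n f) ≤ N := by
    have := Nat.le_mul_of_pos_right
      (M.breg 0 * (n - k).factorial + rankInsertion (seqH n f)) hSpos
    omega
  apply horner_spec (P := (Icc 2 (n - 1)).image f) h0 h2 h3 (by rw [h1, hKc]) ha3
  · intro i hi
    obtain ⟨x, hx, rfl⟩ := Finset.mem_image.1 hi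
    exact hf.1 x hx
  · intro w _
    rw [Nat.pos_iff_ne_zero, ne_eq, label_eq_zero_iff, not_not]
  · rw [hX, hKc]; exact hXle
  · rw [hKc]; exact hKN
  · intro M1 hF1 e1
    rw [hX, hKc] at e1
    have a0 := (hF1.reg 0 (by decide)).trans h0
    have a2 := (hF1.reg 2 (by decide)).trans h2
    have a3 := (hF1.reg 3 (by decide)).trans h3
    apply mulGrowthCount_spec hn a0 a2 a3 hSN
    · rw [e1, hmul]; omega
    · intro M2 hF2 e2
      rw [e1, hmul] at e2
      have b0 := (hF2.reg 0 (by decide)).trans a0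
      have b2 := (hF2.reg 2 (by decide)).trans a2
      have b3 := (hF2.reg 3 (by decide)).trans a3
      apply addExtensions_spec hn b0 b2 b3 hf
        (((hF2.arr 1 (by decide)).trans (hF1.arr 1 (by decide))).trans ha1)
        (((hF2.arr 3 (by decide)).trans (hF1.arr 3 (by decide))).trans ha3) hKc hKN hSN
      · rw [e2]; omega
      · intro M3 _ e3
        apply h
        rw [e3, e2]; omega

theorem input_bounded {r : ℕ} {A : ℕ → ℕ} (hk : k ≤ n) (hr : r ≤ N) (hA : ∀ i, A i ≤ n) :
    (input n k r A).Bounded n N := by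
  refine ⟨fun x => ?_, fun a i => ?_, fun X => ?_, fun _ _ => Nat.zero_le _⟩
  · simp only [input]; split_ifs <;> omega
  · simp only [input]; split_ifs
    · exact hA i
    · omega
  · simp only [input]; split_ifs <;> omega

theorem treeArray_le (hT : T ∈ trees n) (i : ℕ) : treeArray T i ≤ n := by
  obtain ⟨hp, _⟩ := treeArray_spec hT
  by_cases hi : i ∈ Icc 2 n
  · exact (Finset.mem_Icc.1 (hp.1 i hi)).2
  · rw [hp.2.1 i hi]; omega

/-- A program of depth `2`, with big operations in depth `1`, has the required cost. -/
theorem cost_le {p : Code} {C : ℕ} (hn : 1 ≤ n) (hd : p.depth ≤ 2) (hd' : p.bigDepth ≤ 1)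
    (hC : p.size ≤ C) (hC' : p.bigSize ≤ C) :
    p.smallCost n ≤ C * n ^ 2 ∧ p.bigCost n ≤ C * n := by
  constructor
  · exact (smallCost_le hn p).trans (Nat.mul_le_mul hC (Nat.pow_le_pow_right hn hd))
  · refine (bigCost_le hn p).trans (Nat.mul_le_mul hC' ?_)
    calc n ^ p.bigDepth ≤ n ^ 1 := Nat.pow_le_pow_right hn hd'
      _ = n := pow_one n

theorem ranks_of_wp {p : Code} {C : ℕ} {f : Finset (ℕ × ℕ) → ℕ} (hn : 1 ≤ n) (hk : k ≤ n)
    (hd : p.depth ≤ 2) (hd' : p.bigDepth ≤ 1) (hC : p.size ≤ C) (hC' : p.bigSize ≤ C)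
    (hT : T ∈ trees n)
    (h : wp n N (n - k) p (fun M => M.breg 0 = f T) (input n k 0 (treeArray T))) :
    Ranks p.toProgram C n k N f T := by
  obtain ⟨M', a, b, h1, h2, h3, _, h4⟩ :=
    reaches_of_wp (input_bounded hk (Nat.zero_le _) (treeArray_le hT)) h
  obtain ⟨h5, h6⟩ := cost_le hn hd hd' hC hC'
  exact ⟨M', a, b, h1, h4, h2.trans h5, h3.trans h6⟩

/-- For `2 ≤ k` one has `n - k ≤ n - 2`, so the number of trees is positive and bounds each of its
factors, in particular the number `K` held in big registers. -/
theorem stirling_pos {a b : ℕ} (hb : 1 ≤ b) (h : b ≤ a) : 0 < Nat.stirlingSecond a b := by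
  induction a generalizing b with
  | zero => omega
  | succ a ih =>
    obtain ⟨b, rfl⟩ : ∃ b', b = b' + 1 := ⟨b - 1, by omega⟩
    rw [Nat.stirlingSecond_succ_succ]
    rcases Nat.lt_or_ge b a with h1 | h1
    · have := ih (b := b + 1) (by omega) h1
      positivity
    · have : b = a := by omega
      subst this
      rw [Nat.stirlingSecond_self]; omega

theorem rankLeafSetCode_spec (hk2 : 2 ≤ k) (hk : k + 1 ≤ n) (hT : T ∈ treesWithLeafCount n k)
    (hM : (n - k).factorial * Nat.stirlingSecond (n - 2) (n - k) ≤ N) :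
    wp n N (n - k) rankLeafSetCode (fun M => M.breg 0 = rankLeafSet n k T)
      (input n k 0 (treeArray T)) := by
  apply prepareRank_spec (by omega) hT.1
  intro M1 hF1 h2 ha1 ha3
  have a0 := hF1.reg 0 (by decide)
  have a1 := hF1.reg 1 (by decide)
  have a3 := hF1.reg 3 (by decide)
  have ab := hF1.breg 0 (by decide)
  simp [input] at a0 a1 a3 ab
  have hlt := rankLeafSet_lt (by omega) hT
  apply rank_tail_spec (by omega) hT a0 a1 h2 a3 ha1 ha3 (stirling_pos (by omega) (by omega)) hM
  · rw [ab]; omega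
  · intro M2 e2
    rw [e2, ab]; omega

theorem rankLeafCountCode_spec (hk2 : 2 ≤ k) (hk : k + 1 ≤ n) (hT : T ∈ treesWithLeafCount n k)
    (hN : n.choose k * ((n - k).factorial * Nat.stirlingSecond (n - 2) (n - k)) ≤ N) :
    wp n N (n - k) rankLeafCountCode (fun M => M.breg 0 = rankLeafCount n k T)
      (input n k 0 (treeArray T)) := by
  have hn : 3 ≤ n := by omega
  have hpos : 0 < (n - k).factorial * Nat.stirlingSecond (n - 2) (n - k) :=
    Nat.mul_pos (Nat.factorial_pos _) (stirling_pos (by omega) (by omega))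
  have hcpos : 0 < n.choose k := Nat.choose_pos (by omega)
  apply prepareRank_spec hn hT.1
  intro M1 hF1 h2 ha1 ha3
  have a0 := hF1.reg 0 (by decide)
  have a1 := hF1.reg 1 (by decide)
  have a3 := hF1.reg 3 (by decide)
  have ab := hF1.breg 0 (by decide)
  simp [input] at a0 a1 a3 ab
  have hcard : (missing n (ThetaInv n T)).card = k := by
    rw [← leaves_eq_missing (by omega) hT.1]; exact hT.2
  have hrank := rankLeafCount_eq hn hT
  have hlt := (rankSystem_leafCount hn hk).lt T hT
  rw [mul_assoc] at hlt
  apply addBinomials_spec (S := missing n (ThetaInv n T)) a0 h2 a3 (by rw [a1, hcard])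
  · exact fun v hv => (mem_missing.1 hv).1
  · intro v hv
    rw [ha3, label_eq_zero_iff, missing, Finset.mem_sdiff]
    simp only [hv, true_and]
  · exact ab
  · rw [hcard]; exact (Nat.le_mul_of_pos_right _ hpos).trans hN
  · intro M2 hF2 e2
    apply rank_tail_spec hn hT ((hF2.reg 0 (by decide)).trans a0)
      ((hF2.reg 1 (by decide)).trans a1) ((hF2.reg 2 (by decide)).trans h2)
      ((hF2.reg 3 (by decide)).trans a3) ((hF2.arr 1 (by decide)).trans ha1)
      ((hF2.arr 3 (by decide)).trans ha3) (stirling_pos (by omega) (by omega))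
      ((Nat.le_mul_of_pos_left _ hcpos).trans hN)
    · rw [e2]
      exact (hrank ▸ hlt.le).trans hN
    · intro M3 e3
      rw [e3, e2, hrank]; rfl

end

/-! ### Splitting the rank -/

/-- Store `n - k` in register `13`, and quotient and remainder of big register `0` by the number of
restricted growth sequences in the big registers `2` and `3`. -/
def splitRank : Code :=
  .small (.const 2 1) ;; .small (.sub 13 0 1) ;; .small (.sub 4 0 2) ;; .small (.sub 4 4 2) ;;
  .small (.sub 4 4 2) ;; .big (.extension 1 4 3) ;; .big (.arith .div 2 0 1) ;;
  .big (.arith .mul 3 2 1) ;; .big (.arith .sub 3 0 3)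

theorem splitRank_spec {n N K r : ℕ} {Q : Memory → Prop} {M : Memory} (hn : 3 ≤ n)
    (h0 : M.reg 0 = n) (h1 : n - M.reg 1 = K) (h3 : M.reg 3 = 0) (hr : M.breg 0 = r) (hrN : r ≤ N)
    (hN : Nat.stirlingSecond (n - 2) K ≤ N)
    (h : ∀ M', Frame splitRank.toProgram M M' → M'.reg 2 = 1 → M'.reg 13 = K →
      M'.breg 2 = r / Nat.stirlingSecond (n - 2) K →
      M'.breg 3 = r % Nat.stirlingSecond (n - 2) K → Q M') :
    wp n N K splitRank Q M := by
  apply wp_frame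
  have hmod : r - r / Nat.stirlingSecond (n - 2) K * Nat.stirlingSecond (n - 2) K =
      r % Nat.stirlingSecond (n - 2) K := by
    have := Nat.div_add_mod' r (Nat.stirlingSecond (n - 2) K); omega
  simp only [splitRank, wp, BinOp.eval, ne_eq, Nat.reduceEqDiff, not_false_eq_true,
    Function.update_of_ne, Function.update_self, h0, h1, h3, hr, Nat.sub_sub, Nat.reduceAdd,
    extensionCount_sub hn, zero_ne_one, one_ne_zero]
  refine ⟨by omega, hN, (Nat.div_le_self _ _).trans hrN, (Nat.div_mul_le_self _ _).trans hrN,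
    (Nat.sub_le _ _).trans hrN, fun hF => h _ hF ?_ ?_ ?_ ?_⟩
  · simp
  · simp
  · simp
  · simpa using hmod

/-- Successive divisions of big register `2` by `1, …, K`; the remainders are stored in
array `2`. -/
def digits : Code :=
  .rep 7 (ifThen (.small 7 13) (.small (.add 11 7 2) ;; .big (.ofSmall 4 11) ;;
    .big (.arith .div 5 2 4) ;; .big (.arith .mul 6 5 4) ;; .big (.arith .sub 6 2 6) ;;
    .big (.toSmall 9 6) ;; .small (.store 2 11 9) ;; .big (.arith .div 2 2 4)))

/-- The factorial digits are obtained from the least significant one upwards, by division by `1, …,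
K`, which avoids all factorials. The quotient that remains is the rank of `g`. -/
theorem digits_spec {n N K q : ℕ} {Q : Memory → Prop} {M : Memory} (h0 : M.reg 0 = n)
    (h2 : M.reg 2 = 1) (h13 : M.reg 13 = K) (hq : M.breg 2 = q) (hKn : K ≤ n) (hKN : K ≤ N)
    (h : ∀ M', Frame digits.toProgram M M' → M'.breg 2 = q / K.factorial →
      (∀ w, 1 ≤ w → w ≤ K → M'.arr 2 w = q / (w - 1).factorial % w) → Q M') :
    wp n N K digits Q M := by
  apply wp_frame
  refine wp_rep (by simpa using h0) (by simpa using h2) (by decide)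
    (fun j M' => M'.breg 2 = q / (min j K).factorial ∧
      ∀ w, 1 ≤ w → w ≤ min j K → M'.arr 2 w = q / (w - 1).factorial % w) ?_ ?_ ?_
  · refine ⟨by simp [hq], fun w h1 h2 => ?_⟩
    omega
  · rintro j hj M' hB hF hi ⟨hb, hI⟩
    have f2 := hF.reg 2 (by decide)
    have f13 := hF.reg 13 (by decide)
    simp [h2, h13] at f2 f13
    simp only [ifThen, wp, Test.holds, BinOp.eval, ne_eq, Nat.reduceEqDiff, not_false_eq_true,
      Function.update_of_ne, Function.update_self, f2, f13, hi, zero_ne_one, one_ne_zero]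
    have hbN : M'.breg 2 ≤ N := hB.2.2.1 2
    refine ⟨fun hlt => ?_, fun hlt => ?_⟩
    · rw [min_eq_left hlt.le] at hb hI
      rw [min_eq_left (show j + 1 ≤ K from hlt)]
      have hmod : M'.breg 2 - M'.breg 2 / (j + 1) * (j + 1) = M'.breg 2 % (j + 1) := by
        have := Nat.div_add_mod' (M'.breg 2) (j + 1); omega
      have hlt' : M'.breg 2 % (j + 1) < j + 1 := Nat.mod_lt _ (Nat.succ_pos j)
      rw [hmod]
      refine ⟨by omega, by omega, (Nat.div_le_self _ _).trans hbN,
        (Nat.div_mul_le_self _ _).trans hbN, (Nat.mod_le _ _).trans hbN, by omega,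
        (Nat.div_le_self _ _).trans hbN, ?_, ?_⟩
      · rw [hb, Nat.div_div_eq_div_mul, Nat.factorial_succ, mul_comm]
      · intro w hw1 hw2
        by_cases hw : w = j + 1
        · subst hw
          simp [hb]
        · rw [Function.update_of_ne hw]
          exact hI w hw1 (by omega)
    · rw [min_eq_right (by omega)] at hb hI
      rw [min_eq_right (by omega)]
      exact ⟨hb, hI⟩
  · rintro M' hB hF hi ⟨hb, hI⟩ hF'
    rw [min_eq_right hKn] at hb hI
    exact h M' hF' hb hI

/-! ### The set of leaves -/

/-- Mark the elements of the decreasing sequence whose rank is given in big register `2`, in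
array `3`. -/
def markRank : Code :=
  .small (.move 11 1) ;;
  .rep 7 (.small (.sub 4 0 7) ;; .small (.sub 12 4 2) ;; .big (.binomial 4 12 11) ;;
    ifNot (.big 2 4) (.small (.store 3 4 2) ;; .big (.arith .sub 2 2 4) ;; .small (.sub 11 11 2)))

/-- Shows that the binomial coefficients looked up in `markRank` do not exceed `n.choose k`. -/
theorem choose_le_choose_add (a b c : ℕ) : a.choose b ≤ (a + c).choose (b + c) := by
  induction c with
  | zero => simp
  | succ c ih =>
    rw [← add_assoc, ← add_assoc, Nat.choose_succ_succ]
    omega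

/-- Successive greedy choices decrease, so one downward scan finds all of them. While the remaining
rank is less than the binomial coefficient of `n - j`, the first `y` that passes the test is the
greatest possible one. -/
theorem markRank_spec {n k N K m : ℕ} {Q : Memory → Prop} {M : Memory} (h0 : M.reg 0 = n)
    (h1 : M.reg 1 = k) (h2 : M.reg 2 = 1) (ha : M.arr 3 = fun _ => 0) (hb : M.breg 2 = m)
    (hm : m < n.choose k) (hN : n.choose k ≤ N)
    (h : ∀ M', Frame markRank.toProgram M M' →
      (∀ v, 0 < M'.arr 3 v ↔ v ∈ unrankDecreasing k m) → Q M') :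
    wp n N K markRank Q M := by
  apply wp_frame
  refine wp_rep (by simpa using h0) (by simpa using h2) (by decide)
    (fun j M' => M'.reg 11 ≤ k ∧ k ≤ M'.reg 11 + j ∧ M'.breg 2 < (n - j).choose (M'.reg 11) ∧
      ∀ v, (0 < M'.arr 3 v ∨ v ∈ unrankDecreasing (M'.reg 11) (M'.breg 2)) ↔
        v ∈ unrankDecreasing k m) ?_ ?_ ?_
  · simp [h1, hb, hm, ha]
  · rintro j hj M' hB hF hi ⟨hk1, hk2, hlt, hI⟩
    have f0 := hF.reg 0 (by decide)
    have f2 := hF.reg 2 (by decide)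
    simp [h0, h2] at f0 f2
    obtain ⟨y, hy⟩ : ∃ y, n - j = y + 1 := ⟨n - j - 1, by omega⟩
    have hy' : n - (j + 1) = y := by omega
    rw [hy] at hlt
    simp only [ifNot, wp, Test.holds, BinOp.eval, ne_eq, Nat.reduceEqDiff, not_false_eq_true,
      Function.update_of_ne, Function.update_self, f0, f2, hi, hy, hy', Nat.add_sub_cancel,
      zero_ne_one, one_ne_zero]
    generalize M'.reg 11 = k' at *
    have hbN : M'.breg 2 ≤ N := hB.2.2.1 2
    have hle : y.choose k' ≤ N := by
      refine (choose_le_choose_add y k' (k - k')).trans (le_trans ?_ hN)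
      rw [Nat.add_sub_cancel' hk1]
      exact Nat.choose_le_choose k (by omega)
    refine ⟨hle, fun hlt' => ?_, fun hge => ?_⟩
    · exact ⟨hk1, by omega, hlt', hI⟩
    · rw [not_lt] at hge
      obtain ⟨a, rfl⟩ : ∃ a, k' = a + 1 := by
        refine ⟨k' - 1, ?_⟩
        rcases Nat.eq_zero_or_pos k' with rfl | h5
        · simp at hlt hge; omega
        · omega
      have hpas := Nat.choose_succ_succ y a
      rw [Nat.succ_eq_add_one, Nat.succ_eq_add_one] at hpas
      rw [Nat.add_sub_cancel]
      refine ⟨(Nat.sub_le _ _).trans hbN, by omega, by omega, by omega, fun v => ?_⟩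
      rw [← hI v, unrankDecreasing, findGreatest_choose hge hlt, List.mem_cons]
      by_cases hv : v = y + 1
      · simp [hv]
      · simp [hv]
  -- At the end the remaining rank is below the binomial coefficient of `0`, which forces that no
  -- entry is left to be found.
  · rintro M' hB hF hi ⟨_, _, hlt, hI⟩ hF'
    apply h M' hF'
    intro v
    rw [← hI v]
    have : M'.reg 11 = 0 := by
      by_contra hne
      rw [Nat.sub_self, Nat.choose_eq_zero_of_lt (by omega)] at hlt
      omega
    simp [this, unrankDecreasing]

/-- Mark the elements that are listed in array `0`, in array `3`. -/
def markSet : Code :=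
  .rep 7 (ifThen (.small 7 1) (.small (.add 11 7 2) ;; .small (.load 12 0 11) ;;
    .small (.store 3 12 2)))

theorem markSet_spec {n k N K : ℕ} {L : Finset ℕ} {Q : Memory → Prop} {M : Memory}
    (h0 : M.reg 0 = n) (h1 : M.reg 1 = k) (h2 : M.reg 2 = 1) (hA : M.arr 0 = setArray L)
    (ha : M.arr 3 = fun _ => 0) (hk : k ≤ n) (hL : L.card = k)
    (h : ∀ M', Frame markSet.toProgram M M' → (∀ v, 0 < M'.arr 3 v ↔ v ∈ L) → Q M') :
    wp n N K markSet Q M := by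
  apply wp_frame
  refine wp_rep (by simpa using h0) (by simpa using h2) (by decide)
    (fun j M' => ∀ v, 0 < M'.arr 3 v ↔ v ∈ (L.sort (· ≤ ·)).take j) ?_ ?_ ?_
  · simp [ha]
  · rintro j hj M' hB hF hi hI
    have f1 := hF.reg 1 (by decide)
    have f2 := hF.reg 2 (by decide)
    have fa := hF.arr 0 (by decide)
    simp [h1, h2, hA] at f1 f2 fa
    simp only [ifThen, wp, Test.holds, ne_eq, Nat.reduceEqDiff, not_false_eq_true,
      Function.update_of_ne, Function.update_self, f1, f2, fa, hi, zero_ne_one, one_ne_zero]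
    refine ⟨fun hlt => ⟨by omega, fun v => ?_⟩, fun hlt v => ?_⟩
    · have hlen : j < (L.sort (· ≤ ·)).length := by rw [Finset.length_sort]; omega
      have hval : setArray L (j + 1) = (L.sort (· ≤ ·))[j] := by
        rw [setArray, if_neg (Nat.succ_ne_zero j), Nat.add_sub_cancel,
          List.getD_eq_getElem _ _ hlen]
      rw [List.take_succ_eq_append_getElem hlen, List.mem_append, ← hI v, hval]
      by_cases hv : v = (L.sort (· ≤ ·))[j]
      · simp [hv]
      · simp [hv]
    · rw [hI v, List.take_of_length_le (by rw [Finset.length_sort]; omega),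
        List.take_of_length_le (by rw [Finset.length_sort]; omega)]
  · rintro M' hB hF hi hI hF'
    apply h M' hF'
    intro v
    rw [hI v, List.take_of_length_le (by rw [Finset.length_sort]; omega), Finset.mem_sort]

/-! ### The permutation -/

/-- Increase the entries of array `4` that are larger than register `9`. -/
def raise : Code :=
  .rep 8 (.small (.add 5 8 2) ;; .small (.load 6 4 5) ;;
    ifThen (.small 9 6) (.small (.add 6 6 2) ;; .small (.store 4 5 6)))

theorem raise_spec {n N K d : ℕ} {lab : ℕ → ℕ} {Q : Memory → Prop} {M : Memory}
    (h0 : M.reg 0 = n) (h2 : M.reg 2 = 1) (h9 : M.reg 9 = d) (ha : M.arr 4 = lab)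
    (hz : ∀ w, w ∉ Icc 1 n → lab w = 0) (hlt : ∀ w, lab w < n)
    (h : ∀ M', Frame raise.toProgram M M' →
      (M'.arr 4 = fun w => if d + 1 ≤ lab w then lab w + 1 else lab w) → Q M') :
    wp n N K raise Q M := by
  apply wp_frame
  refine wp_rep (by simpa using h0) (by simpa using h2) (by decide)
    (fun j M' => M'.arr 4 = fun w => if w ≤ j ∧ d < lab w then lab w + 1 else lab w) ?_ ?_ ?_
  · simp only [ha]
    funext w
    by_cases hw : w ∈ Icc 1 n
    · rw [if_neg]
      rw [Finset.mem_Icc] at hw; omega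
    · rw [hz w hw, if_neg (by omega)]
  · rintro j hj M' hB hF hi hI
    have f2 := hF.reg 2 (by decide)
    have f9 := hF.reg 9 (by decide)
    simp [h2, h9] at f2 f9
    have hlj := hlt (j + 1)
    simp only [ifThen, wp, Test.holds, ne_eq, Nat.reduceEqDiff, not_false_eq_true,
      Function.update_of_ne, Function.update_self, f2, f9, hi, hI,
      show ¬ (j + 1 ≤ j) by omega, false_and, if_false]
    refine ⟨by omega, fun hd => ⟨by omega, ?_⟩, fun hd => ?_⟩
    · funext w
      simp only [Function.update_apply]
      by_cases hw : w = j + 1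
      · rw [if_pos hw, hw, if_pos ⟨le_rfl, hd⟩]
      · rw [if_neg hw]
        split_ifs <;> first | rfl | omega
    · funext w
      by_cases hw : w = j + 1
      · rw [hw, if_neg (by omega), if_neg (by omega)]
      · split_ifs <;> first | rfl | omega
  · rintro M' hB hF hi hI hF'
    apply h M' hF'
    rw [hI]
    funext w
    by_cases hw : w ∈ Icc 1 n
    · rw [Finset.mem_Icc] at hw
      simp only [hw.2, true_and, Nat.lt_iff_add_one_le]
    · rw [hz w hw, if_neg (by omega), if_neg (by omega)]

/-- Store the permutation whose insertion sequence is given in array `2` at the zeros of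
array `3`, in array `4`. -/
def insertLabels : Code :=
  .small (.move 11 3) ;;
  .rep 7 (.small (.sub 4 0 7) ;; .small (.load 9 3 4) ;;
    ifNot (.small 3 9) (.small (.add 11 11 2) ;; .small (.load 9 2 11) ;; raise ;;
      .small (.add 9 9 2) ;; .small (.store 4 4 9)))

/-- Connects division by decreasing factorials, as in the unranking procedure, with the digits found
by division by `1, …, K`. -/
theorem unrankInsertion_mod_factorial (c q : ℕ) :
    unrankInsertion (c + 1) (q % (c + 1).factorial) =
      (q / c.factorial % (c + 1)) :: unrankInsertion c (q % c.factorial) := by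
  rw [unrankInsertion, Nat.factorial_succ, mul_comm, Nat.mod_mul_right_div_self,
    Nat.mod_mul_right_mod]

/-- A permutation is rebuilt from its insertion sequence starting at the last entry, so the
positions are scanned downwards. With `c` labels placed, the digit for modulus `c + 1` determines
the next one. -/
theorem insertLabels_spec {n N K q : ℕ} {P : Finset ℕ} {Q : Memory → Prop} {M : Memory}
    (h0 : M.reg 0 = n) (h2 : M.reg 2 = 1) (h3 : M.reg 3 = 0) (ha : M.arr 4 = fun _ => 0)
    (hP : P ⊆ Icc 1 n) (hz : ∀ v ∈ Icc 1 n, 0 < M.arr 3 v ↔ v ∉ P)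
    (hd : ∀ w, 1 ≤ w → w ≤ P.card → M.arr 2 w = q / (w - 1).factorial % w)
    (h : ∀ M', Frame insertLabels.toProgram M M' → (∀ w, w ∉ P → M'.arr 4 w = 0) →
      (P.sort (· ≤ ·)).map (M'.arr 4) =
        permOfInsertion (unrankInsertion P.card (q % P.card.factorial)) → Q M') :
    wp n N K insertLabels Q M := by
  apply wp_frame
  have hall : P.filter (0 < ·) = P :=
    Finset.filter_true_of_mem fun x hx => (Finset.mem_Icc.1 (hP hx)).1
  have hnone : P.filter (n < ·) = ∅ := by
    apply Finset.filter_false_of_mem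
    intro x hx
    have := Finset.mem_Icc.1 (hP hx)
    omega
  have hcard : P.card ≤ n := by simpa using Finset.card_le_card hP
  refine wp_rep (by simpa using h0) (by simpa using h2) (by decide)
    (fun j M' => M'.reg 11 = (P.filter (n - j < ·)).card ∧
      (∀ w, w ∉ P.filter (n - j < ·) → M'.arr 4 w = 0) ∧
      ((P.filter (n - j < ·)).sort (· ≤ ·)).map (M'.arr 4) =
        permOfInsertion (unrankInsertion (P.filter (n - j < ·)).card
          (q % (P.filter (n - j < ·)).card.factorial))) ?_ ?_ ?_
  · simp [hnone, h3, ha, unrankInsertion, permOfInsertion]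
  · rintro j hj M' hB hF hi ⟨h11, hI0, hI⟩
    have f0 := hF.reg 0 (by decide)
    have f2 := hF.reg 2 (by decide)
    have f3 := hF.reg 3 (by decide)
    have fa2 := hF.arr 2 (by decide)
    have fa3 := hF.arr 3 (by decide)
    simp [h0, h2, h3] at f0 f2 f3 fa2 fa3
    obtain ⟨v, hv⟩ : ∃ v, n - j = v + 1 := ⟨n - j - 1, by omega⟩
    have hv' : n - (j + 1) = v := by omega
    rw [hv] at h11 hI0 hI
    simp only [ifNot, wp, Test.holds, ne_eq, Nat.reduceEqDiff, not_false_eq_true,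
      Function.update_of_ne, Function.update_self, f0, f2, f3, fa2, fa3, hi, hv, hv', h11]
    have hz' := hz (v + 1) (by rw [Finset.mem_Icc]; omega)
    refine ⟨fun hpos => ?_, fun hpos => ?_⟩
    · rw [filter_lt_of_notMem (hz'.1 hpos)]
      exact ⟨rfl, hI0, hI⟩
    · have hmem : v + 1 ∈ P := by
        by_contra hcon
        exact hpos (hz'.2 hcon)
      have hins := filter_lt_of_mem hmem
      have hnm : v + 1 ∉ P.filter (v + 1 < ·) := by simp
      have hc : (P.filter (v < ·)).card = (P.filter (v + 1 < ·)).card + 1 := by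
        rw [hins, Finset.card_insert_of_notMem hnm]
      have hcle : (P.filter (v < ·)).card ≤ P.card := Finset.card_filter_le _ _
      rw [hc, sort_filter_lt hmem, hd _ (by omega) (by omega), Nat.add_sub_cancel,
        unrankInsertion_mod_factorial, permOfInsertion, ← hI]
      generalize hcc : (P.filter (v + 1 < ·)).card = c at *
      -- The labels present are `1, …, c`, and `c < n` since one more position is still to be
      -- filled; raising them keeps them within the bound `n`.
      have hlt : ∀ w, M'.arr 4 w < n := by
        intro w
        by_cases hw : w ∈ P.filter (v + 1 < ·)
        · obtain ⟨e1, e2, _⟩ := unrankInsertion_spec (Nat.mod_lt q (Nat.factorial_pos c))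
          have hp := permOfInsertion_perm e2
          rw [e1, ← hI] at hp
          have hmw := hp.mem_iff.1 (List.mem_map_of_mem (f := M'.arr 4)
            ((Finset.mem_sort (· ≤ ·)).2 hw))
          rw [List.mem_range'_1] at hmw
          omega
        · rw [hI0 w hw]; omega
      have hdlt : q / c.factorial % (c + 1) < c + 1 := Nat.mod_lt _ (Nat.succ_pos c)
      refine ⟨by omega, ?_⟩
      apply raise_spec (d := q / c.factorial % (c + 1)) (lab := M'.arr 4) (by simpa using f0)
        (by simpa using f2) (by simp) (by simp)
        (fun w hw => hI0 w fun hw' => hw (hP (Finset.mem_filter.1 hw').1)) hlt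
      intro M1 hF1 e4
      have g2 := hF1.reg 2 (by decide)
      have g4 := hF1.reg 4 (by decide)
      have g9 := hF1.reg 9 (by decide)
      have g11 := hF1.reg 11 (by decide)
      simp [f2] at g2 g4 g9 g11
      simp only [wp, ne_eq, Nat.reduceEqDiff, not_false_eq_true, Function.update_of_ne,
        Function.update_self, g2, g4, g9, g11, e4]
      refine ⟨by omega, trivial, fun w hw => ?_, ?_⟩
      · rw [hins, Finset.mem_insert, not_or] at hw
        rw [Function.update_of_ne hw.1, hI0 w hw.2]
        simp
      · rw [List.map_cons, Function.update_self, List.map_map]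
        congr 1
        apply List.map_congr_left
        intro w hw
        have hvw := (Finset.mem_filter.1 ((Finset.mem_sort (· ≤ ·)).1 hw)).2
        have hne : w ≠ v + 1 := by omega
        rw [Function.update_of_ne hne]
        rfl
  · rintro M' hB hF hi ⟨_, hI0, hI⟩ hF'
    rw [Nat.sub_self, hall] at hI0 hI
    exact h M' hF' hI0 hI

/-- Invert array `4`, in array `5`. -/
def invertLabels : Code :=
  .rep 7 (.small (.add 4 7 2) ;; .small (.load 9 4 4) ;; .small (.store 5 9 4))

/-- The loop also writes for vertices outside of `P`. Injectivity is therefore required against all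
`v`; in the application those vertices carry the label `0`, which no element of `P` has. -/
theorem invertLabels_spec {n N K : ℕ} {P : Finset ℕ} {lab : ℕ → ℕ} {Q : Memory → Prop}
    {M : Memory} (h0 : M.reg 0 = n) (h2 : M.reg 2 = 1) (ha : M.arr 4 = lab) (hP : P ⊆ Icc 1 n)
    (hinj : ∀ v, ∀ w ∈ P, lab v = lab w → v = w)
    (h : ∀ M', Frame invertLabels.toProgram M M' → (∀ w ∈ P, M'.arr 5 (lab w) = w) → Q M') :
    wp n N K invertLabels Q M := by
  apply wp_frame
  refine wp_rep (by simpa using h0) (by simpa using h2) (by decide)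
    (fun j M' => ∀ w ∈ P, w ≤ j → M'.arr 5 (lab w) = w) ?_ ?_ ?_
  · intro w hw hw0
    have := Finset.mem_Icc.1 (hP hw)
    omega
  · rintro j hj M' hB hF hi hI
    have f2 := hF.reg 2 (by decide)
    have fa := hF.arr 4 (by decide)
    simp [h2, ha] at f2 fa
    simp only [wp, ne_eq, Nat.reduceEqDiff, not_false_eq_true,
      Function.update_of_ne, Function.update_self, f2, fa, hi]
    refine ⟨by omega, fun w hw hwj => ?_⟩
    by_cases hwe : w = j + 1
    · rw [hwe, Function.update_self]
    · rw [Function.update_of_ne]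
      · exact hI w hw (by omega)
      · exact fun h' => hwe (hinj _ w hw h'.symm).symm
  · rintro M' hB hF hi hI hF'
    exact h M' hF' fun w hw => hI w hw (Finset.mem_Icc.1 (hP hw)).2

/-! ### The restricted growth sequence -/

/-- Find the entries of the restricted growth sequence with the rank in big register `3`, and store
the corresponding entries of array `5` in array `1`. -/
def growthValues : Code :=
  .small (.move 10 3) ;;
  .rep 7 (ifThen (.small 2 7) (.small (.sub 4 0 2) ;; .small (.sub 4 4 7) ;;
    .small (.sub 11 10 2) ;; .big (.extension 4 4 11) ;; .big (.ofSmall 6 10) ;;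
    ifThen (.big 9 4) (.big (.arith .div 5 3 4) ;;
      ifThen (.big 5 6) (.big (.arith .div 6 3 4))) ;;
    .big (.toSmall 9 6) ;; .big (.arith .mul 6 6 4) ;; .big (.arith .sub 3 3 6) ;;
    .small (.add 9 9 2) ;; .small (.load 12 5 9) ;; .small (.store 1 7 12) ;;
    ifThen (.small 10 9) (.small (.move 10 9))))

/-- The greedy entry is the minimum of the quotient `b / e` and the current maximum plus one
(register `10`), or the latter if `e = 0`; see `findGreatest_extension`. One division thus replaces
a search, which keeps the number of big operations linear. -/
theorem growthValues_spec {n N K r : ℕ} {inv : ℕ → ℕ} {Q : Memory → Prop} {M : Memory}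
    (hn : 3 ≤ n) (h0 : M.reg 0 = n) (h2 : M.reg 2 = 1) (h3 : M.reg 3 = 0)
    (ha1 : M.arr 1 = fun _ => 0) (ha5 : M.arr 5 = inv) (hb : M.breg 3 = r) (hb9 : M.breg 9 = 0)
    (hK : K + 1 ≤ n) (hKN : K ≤ N) (hSN : Nat.stirlingSecond (n - 2) K ≤ N)
    (hr : r < Nat.stirlingSecond (n - 2) K)
    (h : ∀ M', Frame growthValues.toProgram M M' → (M'.arr 1 = fun x =>
      if x ∈ Icc 2 (n - 1) then inv ((unrankGrowth (n - 2) K r).getD (x - 2) 0 + 1) else 0) →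
      Q M') :
    wp n N K growthValues Q M := by
  apply wp_frame
  obtain ⟨s, hs⟩ : ∃ s, s = unrankGrowth (n - 2) K r := ⟨_, rfl⟩
  rw [← hs] at h
  have hs' : s = 0 :: unrankGrowthAux K (n - 3) 0 r := by
    rw [hs, unrankGrowth]; congr 2
  refine wp_rep (by simpa using h0) (by simpa using h2) (by decide)
    (fun j M' => (M'.arr 1 = fun x =>
        if 2 ≤ x ∧ x < j then inv (s.getD (x - 2) 0 + 1) else 0) ∧
      ((j ≤ 2 ∧ M'.reg 10 = 0 ∧ M'.breg 3 = r) ∨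
        (2 < j ∧ 1 ≤ M'.reg 10 ∧
          s.drop (j - 2) = unrankGrowthAux K (n - j) (M'.reg 10 - 1) (M'.breg 3) ∧
          M'.breg 3 < extensionCount K (n - j) (M'.reg 10 - 1) ∧
          extensionCount K (n - j) (M'.reg 10 - 1) ≤ N))) ?_ ?_ ?_
  · simp [ha1, h3, hb]
  · rintro j hj M' hB hF hi ⟨hI1, hI⟩
    have f0 := hF.reg 0 (by decide)
    have f2 := hF.reg 2 (by decide)
    have fa := hF.arr 5 (by decide)
    have fb := hF.breg 9 (by decide)
    simp [h0, h2, ha5, hb9] at f0 f2 fa fb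
    have hbN : M'.breg 3 ≤ N := hB.2.2.1 3
    by_cases hlt : 1 < j
    swap
    · simp only [ifThen, wp, Test.holds, BinOp.eval, ne_eq, Nat.reduceEqDiff, not_false_eq_true,
        Function.update_of_ne, Function.update_self, f2, hi, hlt, false_imp_iff, true_and,
        true_imp_iff]
      rcases hI with ⟨e1, e2, e3⟩ | hI
      · refine ⟨?_, Or.inl ⟨by omega, e2, e3⟩⟩
        rw [hI1]
        funext x
        rw [if_neg (by omega), if_neg (by omega)]
      · omega
    obtain ⟨c, hc⟩ : ∃ c, M'.reg 10 = c := ⟨_, rfl⟩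
    obtain ⟨b, hb'⟩ : ∃ b, M'.breg 3 = b := ⟨_, rfl⟩
    obtain ⟨e, he⟩ : ∃ e, extensionCount K (n - 1 - j) (c - 1) = e := ⟨_, rfl⟩
    rw [hc, hb'] at hI
    rw [hb'] at hbN
    have hjn : n - j = n - 1 - j + 1 := by omega
    -- Treats the first entry like the others: there `c = 0`, so the minimum yields the entry `0`,
    -- and the truncated `c - 1` is the maximum `0`.
    have key : e ≤ N ∧ c ≤ K ∧ ∃ a, (a = if 0 < e then min c (b / e) else c) ∧ a * e ≤ b ∧
        s.getD (j - 2) 0 = a ∧ s.drop (j + 1 - 2) =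
          unrankGrowthAux K (n - 1 - j) (max c (a + 1) - 1) (b - a * e) ∧
        b - a * e < extensionCount K (n - 1 - j) (max c (a + 1) - 1) ∧
        extensionCount K (n - 1 - j) (max c (a + 1) - 1) ≤ N := by
      rcases hI with ⟨e1, e2, e3⟩ | ⟨e1, e2, e3, e4, e5⟩
      · have hj2 : j = 2 := by omega
        subst hj2 e2 e3
        have hE : e = Nat.stirlingSecond (n - 2) K := by
          rw [← he, ← extensionCount_sub hn]; congr 1
        refine ⟨by omega, by omega, 0, by simp, by simp, by simp [hs'], ?_, ?_, ?_⟩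
        · rw [hs']; simp; congr 1
        · simp at he ⊢; omega
        · simp at he ⊢; omega
      · rw [hjn] at e3 e4 e5
        -- The count of extensions is positive, so the maximum `c - 1` is still below `K`.
        have hcK : c ≤ K := by
          by_contra hcon
          rw [extensionCount_eq_zero (show K ≤ c - 1 by omega)] at e4
          omega
        obtain ⟨a, ha⟩ : ∃ a, a = Nat.findGreatest
          (fun a => a * extensionCount K (n - 1 - j) (c - 1) ≤ b) (c - 1 + 1) := ⟨_, rfl⟩
        obtain ⟨g1, g2, g3⟩ := greedy_growth_lt e4 ha
        have g4 := extensionCount_le (K := K) (t := n - 1 - j) g1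
        have g5 := extensionCount_le (K := K) (t := n - 1 - j) (Nat.zero_le (c - 1 + 1))
        rw [unrankGrowthAux, ← ha] at e3
        rw [findGreatest_extension] at ha
        rw [he] at e3 ha g2 g3
        rw [max_eq_left (Nat.zero_le _), he] at g5
        rw [Nat.sub_add_cancel e2] at ha g1
        have hmax : max c (a + 1) - 1 = max (c - 1) a := by omega
        have hlen : j - 2 < s.length := by
          by_contra hcon
          rw [List.drop_eq_nil_of_le (by omega)] at e3
          simp at e3
        rw [List.drop_eq_getElem_cons hlen, List.cons.injEq] at e3
        refine ⟨by omega, hcK, a, ha, g2, ?_, ?_, ?_, ?_⟩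
        · rw [List.getD_eq_getElem _ _ hlen, e3.1]
        · rw [hmax, ← e3.2]; congr 1; omega
        · rw [hmax]; exact g3
        · rw [hmax]; omega
    obtain ⟨k1, k2, a, k3, k4, k5, k6, k7, k8⟩ := key
    have hac : a ≤ c := by rw [k3]; split_ifs <;> omega
    have hfin : ∀ x, (Function.update (M'.arr 1) j (inv (a + 1))) x =
        if 2 ≤ x ∧ x < j + 1 then inv (s.getD (x - 2) 0 + 1) else 0 := by
      intro x
      rw [hI1, Function.update_apply]
      by_cases hx : x = j
      · subst hx
        rw [if_pos rfl, if_pos ⟨by omega, by omega⟩, k5]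
      · rw [if_neg hx]
        split_ifs <;> first | rfl | omega
    have hjn' : n - (j + 1) = n - 1 - j := by omega
    have hfin' : ∀ c', c' = max c (a + 1) → 2 < j + 1 ∧ 1 ≤ c' ∧
        s.drop (j + 1 - 2) = unrankGrowthAux K (n - (j + 1)) (c' - 1) (b - a * e) ∧
        b - a * e < extensionCount K (n - (j + 1)) (c' - 1) ∧
        extensionCount K (n - (j + 1)) (c' - 1) ≤ N := by
      rintro c' rfl
      rw [hjn']
      exact ⟨by omega, by omega, k6, k7, k8⟩
    have hae : a * e ≤ N := k4.trans hbN
    have hbe : b / e ≤ N := (Nat.div_le_self _ _).trans hbN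
    have hba : b - a * e ≤ N := (Nat.sub_le _ _).trans hbN
    simp only [ifThen, wp, Test.holds, BinOp.eval, ne_eq, Nat.reduceEqDiff, not_false_eq_true,
      Function.update_of_ne, Function.update_self, f0, f2, fa, fb, hi, hc, hb', he, hlt,
      not_true_eq_false, false_imp_iff, and_true, true_imp_iff, zero_ne_one, one_ne_zero]
    refine ⟨k1, by omega, fun he0 => ⟨hbe, fun hlt' => ?_, fun hlt' => ?_⟩, fun he0 => ?_⟩
    · rw [if_pos he0, min_eq_right hlt'.le] at k3
      rw [← k3]
      refine ⟨by omega, by omega, hae, hba, by omega, fun hc1 => ?_, fun hc1 => ?_⟩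
      · exact ⟨funext hfin, Or.inr (hfin' _ (by omega))⟩
      · exact ⟨funext hfin, Or.inr (hfin' _ (by omega))⟩
    · rw [if_pos he0, min_eq_left (by omega)] at k3
      rw [← k3]
      refine ⟨by omega, hae, hba, by omega, fun hc1 => ?_, fun hc1 => ?_⟩
      · exact ⟨funext hfin, Or.inr (hfin' _ (by omega))⟩
      · exact ⟨funext hfin, Or.inr (hfin' _ (by omega))⟩
    · rw [if_neg he0] at k3
      rw [← k3]
      refine ⟨by omega, hae, hba, by omega, fun hc1 => ?_, fun hc1 => ?_⟩
      · exact ⟨funext hfin, Or.inr (hfin' _ (by omega))⟩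
      · exact ⟨funext hfin, Or.inr (hfin' _ (by omega))⟩
  · rintro M' hB hF hi ⟨hI1, _⟩ hF'
    apply h M' hF'
    rw [hI1]
    funext x
    have hx : (2 ≤ x ∧ x < n) ↔ x ∈ Icc 2 (n - 1) := by rw [Finset.mem_Icc]; omega
    simp only [hx]

/-! ### The map `Θ` -/

/-- Store the parents of `Θ(f)` in array `0`, where `f` is given in array `1`. -/
def thetaParents : Code :=
  .small (.move 5 2) ;;
  .rep 7 (ifThen (.small 2 7) (.small (.move 4 7) ;; .small (.load 12 1 7) ;; walk 1 ;;
    .cond (.small 6 4) (.small (.store 0 4 12)) (.cond (.small 4 6) (.small (.store 0 4 12))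
      (.small (.store 0 4 5) ;; .small (.move 5 12))))) ;;
  .small (.store 0 0 5)

/-- The walk stops at `v` itself exactly if the orbit returns to `v` without meeting a larger vertex
first. A cycle maximum returns within `n` steps, so the walk is long enough. -/
theorem walk_eq_iff {n m u v : ℕ} {f : ℕ → ℕ} (hv : v ∈ Icc 2 (n - 1)) (hu : u = f^[m] (f v))
    (hlt : ∀ i < m, f^[i] (f v) < v) (hor : m = n ∨ v ≤ u) : u = v ↔ v ∈ cycleMaxima n f := by
  constructor
  · intro huv
    have hper : f^[m + 1] v = v := by rw [Function.iterate_succ_apply, ← hu, huv]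
    refine mem_cycleMaxima.2 ⟨hv, ⟨m + 1, by omega, hper⟩, fun j => ?_⟩
    rw [← Function.IsPeriodicPt.iterate_mod_apply (f := f) (n := m + 1) hper j]
    have := Nat.mod_lt j (Nat.succ_pos m)
    generalize j % (m + 1) = i at *
    rcases i with _ | i
    · rfl
    · rw [Function.iterate_succ_apply]
      exact (hlt i (by omega)).le
  · intro h
    obtain ⟨⟨j, h1, h2, h3⟩, _⟩ := mem_iterates_max.1 (Finset.mem_filter.1 h).2
    have hle : u ≤ v := by
      rw [hu, ← Function.iterate_succ_apply]
      exact (mem_cycleMaxima.1 h).2.2 _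
    by_contra hne
    obtain ⟨j, rfl⟩ : ∃ j', j = j' + 1 := ⟨j - 1, by omega⟩
    have := hlt j (by omega)
    rw [← Function.iterate_succ_apply, h3] at this
    omega

/-- The update of the left end of the last cycle seen, in a scan of the vertices in increasing
order. After the scan it is the target for `n`. -/
theorem nextLeft_succ (n : ℕ) (f : ℕ → ℕ) (v : ℕ) :
    nextLeft n f (v + 1) = if v ∈ cycleMaxima n f then f v else nextLeft n f v := by
  split_ifs with h
  · exact nextLeft_eq h (Nat.lt_succ_self v) fun c' _ h' => by omega
  · have hlt : ∀ c ∈ cycleMaxima n f, c < v + 1 → c < v := fun c hc hcv => by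
      have : c ≠ v := fun h' => h (h' ▸ hc)
      omega
    rcases nextLeft_cases n f v with ⟨c, h1, h2, h3, h4⟩ | ⟨h1, h2⟩
    · rw [h4]
      exact nextLeft_eq h1 (by omega) fun c' hc' hlt' => h3 c' hc' (hlt c' hc' hlt')
    · rcases nextLeft_cases n f (v + 1) with ⟨c, h3, h4, _⟩ | ⟨_, h3⟩
      · exact absurd (hlt c h3 h4) (h1 c h3)
      · rw [h3, h2]

theorem thetaParents_spec {n N K : ℕ} {f : ℕ → ℕ} {Q : Memory → Prop} {M : Memory} (hn : 2 ≤ n)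
    (h0 : M.reg 0 = n) (h2 : M.reg 2 = 1) (ha : M.arr 1 = f)
    (h : ∀ M', (∀ w ∈ Icc 2 n, M'.arr 0 w = thetaParent n f w) → Q M') :
    wp n N K thetaParents Q M := by
  have hlow : ∀ v ≤ 2, nextLeft n f v = 1 := fun v hv => by
    rcases nextLeft_cases n f v with ⟨c, h1, h2, _⟩ | ⟨_, h1⟩
    · have := Finset.mem_Icc.1 (mem_cycleMaxima.1 h1).1
      omega
    · exact h1
  refine wp_rep (by simpa using h0) (by simpa using h2) (by decide)
    (fun j M' => M'.reg 5 = nextLeft n f j ∧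
      ∀ w, 2 ≤ w → w < j → M'.arr 0 w = thetaParent n f w) ?_ ?_ ?_
  · exact ⟨by simp [h2, hlow], fun w h1 h2 => by omega⟩
  · rintro j hj M' hB hF hi ⟨h5, hI⟩
    have f0 := hF.reg 0 (by decide)
    have f2 := hF.reg 2 (by decide)
    have fa := hF.arr 1 (by decide)
    simp [h0, h2, ha] at f0 f2 fa
    simp only [ifThen, wp, Test.holds, ne_eq, Nat.reduceEqDiff, not_false_eq_true,
      Function.update_of_ne, Function.update_self, f0, f2, fa, hi]
    refine ⟨fun hlt => ?_, fun hlt => ?_⟩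
    · have hjm : j ∈ Icc 2 (n - 1) := by rw [Finset.mem_Icc]; omega
      apply walk_spec (v := j) (f := f) (by simpa using f0) (by simpa using f2) (by simp)
        (by simpa using fa)
      rintro M1 hF1 ⟨m, hmn, h6, hall, hor⟩
      have g4 := hF1.reg 4 (by simp [walk, ifThen, toProgram, Program.wreg])
      have g5 := hF1.reg 5 (by simp [walk, ifThen, toProgram, Program.wreg])
      have g12 := hF1.reg 12 (by simp [walk, ifThen, toProgram, Program.wreg])
      have ga := hF1.arr 0 (by simp [walk, ifThen, toProgram, Program.warr])
      simp [fa] at g4 g5 g12 ga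
      have hiff := walk_eq_iff hjm h6 hall hor
      have hupd : ∀ y, y = thetaParent n f j → ∀ w, 2 ≤ w → w < j + 1 →
          Function.update (M'.arr 0) j y w = thetaParent n f w := by
        rintro y hy w hw1 hw2
        by_cases hw : w = j
        · rw [hw, Function.update_self, hy]
        · rw [Function.update_of_ne hw]
          exact hI w hw1 (by omega)
      have hout : M1.reg 6 ≠ j → M'.reg 5 = nextLeft n f (j + 1) ∧ ∀ w, 2 ≤ w → w < j + 1 →
          Function.update (M'.arr 0) j (f j) w = thetaParent n f w := by
        intro hne
        have hnm : j ∉ cycleMaxima n f := fun h' => hne (hiff.2 h')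
        refine ⟨by rw [nextLeft_succ, if_neg hnm, h5], hupd _ ?_⟩
        rw [thetaParent_of_notMem]
        rintro (h' | h')
        · omega
        · exact hnm h'
      simp only [wp, Test.holds, ne_eq, Nat.reduceEqDiff, not_false_eq_true,
        Function.update_of_ne, Function.update_self, g4, g5, g12, ga]
      refine ⟨fun h7 => hout (by omega), fun h7 => ⟨fun h8 => hout (by omega), fun h8 => ?_⟩⟩
      have hm := hiff.1 (by omega)
      refine ⟨by rw [nextLeft_succ, if_pos hm], hupd _ ?_⟩
      rw [thetaParent_of_mem (Or.inr hm), h5]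
    · refine ⟨by rw [h5, hlow j (by omega), hlow (j + 1) (by omega)], fun w h1 h2 => by omega⟩
  · rintro M' hB hF hi ⟨h5, hI⟩
    have f0 := hF.reg 0 (by decide)
    simp [h0] at f0
    simp only [wp, f0]
    apply h
    intro w hw
    rw [Finset.mem_Icc] at hw
    by_cases hwn : w = n
    · subst hwn
      simp [h5, thetaParent_of_mem]
    · simp only [Function.update_self, Function.update_of_ne hwn]
      exact hI w hw.1 (by omega)

/-! ### The unranking programs -/

/-- The part of the unranking programs that follows the determination of the set of leaves. -/
def unrankTail : Code := insertLabels ;; invertLabels ;; growthValues ;; thetaParents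

/-- The unranking program for trees with a given leaf set. -/
def unrankLeafSetCode : Code := splitRank ;; digits ;; markSet ;; unrankTail

/-- The unranking program for trees with a given number of leaves. -/
def unrankLeafCountCode : Code := splitRank ;; digits ;; markRank ;; unrankTail

section

variable {n k N : ℕ}

/-- The search for a position in `σ` is replaced by a look-up in the inverse array, from labels to
vertices. -/
theorem ofSeq_eq {K : ℕ} {g h s : List ℕ} {lab inv : ℕ → ℕ} (hn : 3 ≤ n) (hh : h ∈ insertionSeqs K)
    (hs : s ∈ growthSeqs (n - 2) K)
    (hlab : ((Icc 1 n \ g.toFinset).sort (· ≤ ·)).map lab = permOfInsertion h)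
    (hinv : ∀ w ∈ Icc 1 n \ g.toFinset, inv (lab w) = w) :
    ofSeq n g h s = fun x => if x ∈ Icc 2 (n - 1) then inv (s.getD (x - 2) 0 + 1) else 0 := by
  funext x
  rw [ofSeq]
  split_ifs with hx
  · rw [Finset.mem_Icc] at hx
    obtain ⟨h1, h2⟩ := mem_insertionSeqs.1 hh
    have hp := permOfInsertion_perm h2
    have hlt : s.getD (x - 2) 0 < K := by
      have hlen : x - 2 < s.length := by rw [hs.1]; omega
      rw [List.getD_eq_getElem _ _ hlen, ← Finset.mem_range, ← hs.2.2.2, List.mem_toFinset]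
      exact List.getElem_mem hlen
    have hmem : s.getD (x - 2) 0 + 1 ∈ permOfInsertion h := by
      rw [hp.mem_iff, List.mem_range'_1]; omega
    rw [← hlab] at hmem ⊢
    obtain ⟨w, hw, hw'⟩ := List.mem_map.1 hmem
    rw [← hw', idxOf_map_of_injOn, getD_idxOf hw, hinv w ((Finset.mem_sort _).1 hw)]
    intro b hb hbw
    rw [← hinv b ((Finset.mem_sort _).1 hb), ← hinv w ((Finset.mem_sort _).1 hw), hbw]
  · rfl

theorem unrankTail_spec {K q r : ℕ} {g : List ℕ} {Q : Memory → Prop} {M : Memory} (hn : 3 ≤ n)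
    (hK : K + 1 ≤ n) (h0 : M.reg 0 = n) (h2 : M.reg 2 = 1) (h3 : M.reg 3 = 0)
    (ha1 : M.arr 1 = fun _ => 0) (ha4 : M.arr 4 = fun _ => 0) (hb : M.breg 3 = r)
    (hb9 : M.breg 9 = 0) (hg : g ∈ decreasingSeqs n (n - K)) (hz : ∀ v, 0 < M.arr 3 v ↔ v ∈ g)
    (hd : ∀ w, 1 ≤ w → w ≤ K → M.arr 2 w = q / (w - 1).factorial % w) (hKN : K ≤ N)
    (hSN : Nat.stirlingSecond (n - 2) K ≤ N) (hr : r < Nat.stirlingSecond (n - 2) K)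
    (h : ∀ M', (∀ w ∈ Icc 2 n, M'.arr 0 w = thetaParent n (ofSeq n g
      (unrankInsertion K (q % K.factorial)) (unrankGrowth (n - 2) K r)) w) → Q M') :
    wp n N K unrankTail Q M := by
  have hcard : (Icc 1 n \ g.toFinset).card = K := by
    rw [← sort_sdiff_length hg (by omega), Finset.length_sort]
  have hq : q % K.factorial < K.factorial := Nat.mod_lt _ (Nat.factorial_pos K)
  have hh : unrankInsertion K (q % K.factorial) ∈ insertionSeqs K :=
    (rankSystem_insertion K).mem _ hq
  have hs : unrankGrowth (n - 2) K r ∈ growthSeqs (n - 2) K :=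
    (rankSystem_growth_sub hn K).mem _ hr
  apply insertLabels_spec (P := Icc 1 n \ g.toFinset) (q := q) h0 h2 h3 ha4 Finset.sdiff_subset
  · intro v hv
    rw [hz, Finset.mem_sdiff, List.mem_toFinset]
    simp [hv]
  · rw [hcard]; exact hd
  · intro M1 hF1 hoff hlab
    rw [hcard] at hlab
    have a0 := (hF1.reg 0 (by decide)).trans h0
    have a2 := (hF1.reg 2 (by decide)).trans h2
    have a3 := (hF1.reg 3 (by decide)).trans h3
    have aa1 := (hF1.arr 1 (by decide)).trans ha1
    have ab := (hF1.breg 3 (by decide)).trans hb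
    have ab9 := (hF1.breg 9 (by decide)).trans hb9
    have hp := permOfInsertion_perm (mem_insertionSeqs.1 hh).2
    rw [← hlab] at hp
    have hinj := List.inj_on_of_nodup_map (hp.nodup_iff.2 List.nodup_range')
    have hpos : ∀ w ∈ Icc 1 n \ g.toFinset, 1 ≤ M1.arr 4 w := fun w hw => by
      have := hp.mem_iff.1 (List.mem_map_of_mem (f := M1.arr 4)
        ((Finset.mem_sort (· ≤ ·)).2 hw))
      rw [List.mem_range'_1] at this
      exact this.1
    apply invertLabels_spec (P := Icc 1 n \ g.toFinset) a0 a2 rfl Finset.sdiff_subset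
    · intro v w hw hvw
      by_cases hv : v ∈ Icc 1 n \ g.toFinset
      · exact hinj ((Finset.mem_sort _).2 hv) ((Finset.mem_sort _).2 hw) hvw
      · have := hpos w hw
        rw [← hvw, hoff v hv] at this
        omega
    · intro M2 hF2 hinv
      have b0 := (hF2.reg 0 (by decide)).trans a0
      have b2 := (hF2.reg 2 (by decide)).trans a2
      have b3 := (hF2.reg 3 (by decide)).trans a3
      have ba1 := (hF2.arr 1 (by decide)).trans aa1
      have bb := (hF2.breg 3 (by decide)).trans ab
      have bb9 := (hF2.breg 9 (by decide)).trans ab9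
      apply growthValues_spec hn b0 b2 b3 ba1 rfl bb bb9 hK hKN hSN hr
      intro M3 hF3 e1
      rw [← ofSeq_eq hn hh hs hlab hinv] at e1
      exact thetaParents_spec (by omega) ((hF3.reg 0 (by decide)).trans b0)
        ((hF3.reg 2 (by decide)).trans b2) e1 h

theorem unranks_of_wp {p : Code} {C r : ℕ} {A : ℕ → ℕ} {f : ℕ → Finset (ℕ × ℕ)} (hn : 1 ≤ n)
    (hk : k ≤ n) (hd : p.depth ≤ 2) (hd' : p.bigDepth ≤ 1) (hC : p.size ≤ C) (hC' : p.bigSize ≤ C)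
    (hr : r ≤ N) (hA : ∀ i, A i ≤ n)
    (h : wp n N (n - k) p (fun M => Stores n (M.arr 0) (f r)) (input n k r A)) :
    Unranks p.toProgram C n k N A f r := by
  obtain ⟨M', a, b, h1, h2, h3, _, h4⟩ := reaches_of_wp (input_bounded hk hr hA) h
  obtain ⟨h5, h6⟩ := cost_le hn hd hd' hC hC'
  exact ⟨M', a, b, h1, h4, h2.trans h5, h3.trans h6⟩

theorem stores_Theta {f A : ℕ → ℕ} (hn : 2 ≤ n) (h : ∀ w ∈ Icc 2 n, A w = thetaParent n f w) :
    Stores n A (Theta n f) := by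
  intro i hi
  rw [Theta_eq_edges hn, mem_edges]
  exact ⟨hi, (h i hi).symm⟩

theorem unrankLeafSetCode_spec {L : Finset ℕ} {r : ℕ} (hk2 : 2 ≤ k) (hk : k + 1 ≤ n)
    (hL : L ⊆ Icc 1 n) (hc : L.card = k)
    (hN : (n - k).factorial * Nat.stirlingSecond (n - 2) (n - k) ≤ N)
    (hr : r < (n - k).factorial * Nat.stirlingSecond (n - 2) (n - k)) :
    wp n N (n - k) unrankLeafSetCode (fun M => Stores n (M.arr 0) (unrankLeafSet n k L r))
      (input n k r (setArray L)) := by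
  have hn : 3 ≤ n := by omega
  have hSpos : 0 < Nat.stirlingSecond (n - 2) (n - k) := stirling_pos (by omega) (by omega)
  have hSN := (Nat.le_mul_of_pos_left _ (Nat.factorial_pos (n - k))).trans hN
  have hKN := ((Nat.self_le_factorial (n - k)).trans (Nat.le_mul_of_pos_right _ hSpos)).trans hN
  apply splitRank_spec hn (by simp [input]) (by simp [input]) (by simp [input]) (by simp [input])
    (hr.le.trans hN) hSN
  intro M1 hF1 a2 a13 b2 b3
  have a0 := hF1.reg 0 (by decide)
  have a1 := hF1.reg 1 (by decide)
  have a3 := hF1.reg 3 (by decide)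
  have aa0 := hF1.arr 0 (by decide)
  have aa1 := hF1.arr 1 (by decide)
  have aa3 := hF1.arr 3 (by decide)
  have aa4 := hF1.arr 4 (by decide)
  have ab9 := hF1.breg 9 (by decide)
  simp [input] at a0 a1 a3 aa0 aa1 aa3 aa4 ab9
  apply digits_spec a0 a2 a13 b2 (by omega) hKN
  intro M2 hF2 _ hd
  apply markSet_spec (k := k) (L := L) ((hF2.reg 0 (by decide)).trans a0)
    ((hF2.reg 1 (by decide)).trans a1) ((hF2.reg 2 (by decide)).trans a2)
    ((hF2.arr 0 (by decide)).trans aa0) ((hF2.arr 3 (by decide)).trans aa3) (by omega) hc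
  intro M3 hF3 hz
  apply unrankTail_spec (g := L.sort (· ≥ ·)) (q := r / Nat.stirlingSecond (n - 2) (n - k))
    (r := r % Nat.stirlingSecond (n - 2) (n - k)) hn (by omega)
    ((hF3.reg 0 (by decide)).trans ((hF2.reg 0 (by decide)).trans a0))
    ((hF3.reg 2 (by decide)).trans ((hF2.reg 2 (by decide)).trans a2))
    ((hF3.reg 3 (by decide)).trans ((hF2.reg 3 (by decide)).trans a3))
    ((hF3.arr 1 (by decide)).trans ((hF2.arr 1 (by decide)).trans aa1))
    ((hF3.arr 4 (by decide)).trans ((hF2.arr 4 (by decide)).trans aa4))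
    ((hF3.breg 3 (by decide)).trans ((hF2.breg 3 (by decide)).trans b3))
    ((hF3.breg 9 (by decide)).trans ((hF2.breg 9 (by decide)).trans ab9))
  · rw [Nat.sub_sub_self (by omega)]
    exact sort_mem_decreasingSeqs hL hc
  · intro v
    rw [hz, Finset.mem_sort]
  · rw [hF3.arr 2 (by decide)]
    exact hd
  · exact hKN
  · exact hSN
  · exact Nat.mod_lt _ hSpos
  · intro M4 h4
    -- For a prescribed leaf set the quotient is already below `K!`, so reduction modulo `K!` has no
    -- effect.
    rw [Nat.mod_eq_of_lt (Nat.div_lt_of_lt_mul (by rwa [mul_comm]))] at h4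
    exact stores_Theta (by omega) h4

theorem unrankLeafCountCode_spec {r : ℕ} (hk2 : 2 ≤ k) (hk : k + 1 ≤ n)
    (hN : n.choose k * ((n - k).factorial * Nat.stirlingSecond (n - 2) (n - k)) ≤ N)
    (hr : r < n.choose k * ((n - k).factorial * Nat.stirlingSecond (n - 2) (n - k))) :
    wp n N (n - k) unrankLeafCountCode (fun M => Stores n (M.arr 0) (unrankLeafCount n k r))
      (input n k r (fun _ => 0)) := by
  have hn : 3 ≤ n := by omega
  have hSpos : 0 < Nat.stirlingSecond (n - 2) (n - k) := stirling_pos (by omega) (by omega)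
  have hMpos := Nat.mul_pos (Nat.factorial_pos (n - k)) hSpos
  have hMN := (Nat.le_mul_of_pos_left _ (Nat.choose_pos (show k ≤ n by omega))).trans hN
  have hCN := (Nat.le_mul_of_pos_right (n.choose k) hMpos).trans hN
  have hSN := (Nat.le_mul_of_pos_left _ (Nat.factorial_pos (n - k))).trans hMN
  have hKN := ((Nat.self_le_factorial (n - k)).trans (Nat.le_mul_of_pos_right _ hSpos)).trans hMN
  have hr1 : r / ((n - k).factorial * Nat.stirlingSecond (n - 2) (n - k)) < n.choose k :=
    Nat.div_lt_of_lt_mul (by rwa [mul_comm])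
  apply splitRank_spec hn (by simp [input]) (by simp [input]) (by simp [input]) (by simp [input])
    (hr.le.trans hN) hSN
  intro M1 hF1 a2 a13 b2 b3
  have a0 := hF1.reg 0 (by decide)
  have a1 := hF1.reg 1 (by decide)
  have a3 := hF1.reg 3 (by decide)
  have aa1 := hF1.arr 1 (by decide)
  have aa3 := hF1.arr 3 (by decide)
  have aa4 := hF1.arr 4 (by decide)
  have ab9 := hF1.breg 9 (by decide)
  simp [input] at a0 a1 a3 aa1 aa3 aa4 ab9
  apply digits_spec a0 a2 a13 b2 (by omega) hKN
  intro M2 hF2 c2 hd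
  -- Dividing first by the Stirling number and then by all of `1, …, K` amounts to dividing by `K!
  -- S`; this leaves the rank of `g`.
  rw [Nat.div_div_eq_div_mul, mul_comm] at c2
  apply markRank_spec ((hF2.reg 0 (by decide)).trans a0)
    ((hF2.reg 1 (by decide)).trans a1) ((hF2.reg 2 (by decide)).trans a2)
    ((hF2.arr 3 (by decide)).trans aa3) c2 hr1 hCN
  intro M3 hF3 hz
  apply unrankTail_spec (q := r / Nat.stirlingSecond (n - 2) (n - k))
    (r := r % Nat.stirlingSecond (n - 2) (n - k)) hn (by omega)
    ((hF3.reg 0 (by decide)).trans ((hF2.reg 0 (by decide)).trans a0))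
    ((hF3.reg 2 (by decide)).trans ((hF2.reg 2 (by decide)).trans a2))
    ((hF3.reg 3 (by decide)).trans ((hF2.reg 3 (by decide)).trans a3))
    ((hF3.arr 1 (by decide)).trans ((hF2.arr 1 (by decide)).trans aa1))
    ((hF3.arr 4 (by decide)).trans ((hF2.arr 4 (by decide)).trans aa4))
    ((hF3.breg 3 (by decide)).trans ((hF2.breg 3 (by decide)).trans b3))
    ((hF3.breg 9 (by decide)).trans ((hF2.breg 9 (by decide)).trans ab9)) (hz := hz)
  · rw [Nat.sub_sub_self (by omega)]
    exact (rankSystem_decreasing n k).mem _ hr1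
  · rw [hF3.arr 2 (by decide)]
    exact hd
  · exact hKN
  · exact hSN
  · exact Nat.mod_lt _ hSpos
  · intro M4 h4
    simp only [unrankLeafCount]
    rw [Nat.mod_mul_left_div_self, Nat.mod_mul_left_mod]
    exact stores_Theta (by omega) h4

theorem setArray_le {L : Finset ℕ} (hL : L ⊆ Icc 1 n) (i : ℕ) : setArray L i ≤ n := by
  rw [setArray]
  split_ifs with hi
  · exact Nat.zero_le n
  · rcases Nat.lt_or_ge (i - 1) (L.sort (· ≤ ·)).length with h | h
    · rw [List.getD_eq_getElem _ _ h]
      exact (Finset.mem_Icc.1 (hL ((Finset.mem_sort _).1 (List.getElem_mem h)))).2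
    · rw [List.getD_eq_default _ _ h]
      exact Nat.zero_le n

end

end LeafTrees

theorem mainTheorem3 :
    -- correctness of the ranking and unranking procedures
    (∀ n k : ℕ, 2 ≤ k → k + 1 ≤ n →
      Set.BijOn (Theta n) (functions n) (trees n) ∧
      ((treesWithLeafCount n k).ncard
          = n.choose k * (n - k).factorial * Nat.stirlingSecond (n - 2) (n - k) ∧
        Set.BijOn (rankLeafCount n k) (treesWithLeafCount n k)
          (Set.Iio (treesWithLeafCount n k).ncard) ∧
        (∀ T ∈ treesWithLeafCount n k, rankLeafCount n k T =
          {T' ∈ treesWithLeafCount n k |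
            seqAll n (ThetaInv n T') < seqAll n (ThetaInv n T)}.ncard) ∧
        Set.MapsTo (unrankLeafCount n k) (Set.Iio (treesWithLeafCount n k).ncard)
          (treesWithLeafCount n k) ∧
        Set.InvOn (unrankLeafCount n k) (rankLeafCount n k) (treesWithLeafCount n k)
          (Set.Iio (treesWithLeafCount n k).ncard)) ∧
      ∀ L : Finset ℕ, L ⊆ Finset.Icc 1 n → L.card = k →
        (treesWithLeafSet n L).ncard
          = (n - k).factorial * Nat.stirlingSecond (n - 2) (n - k) ∧
        Set.BijOn (rankLeafSet n k) (treesWithLeafSet n L)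
          (Set.Iio (treesWithLeafSet n L).ncard) ∧
        (∀ T ∈ treesWithLeafSet n L, rankLeafSet n k T =
          {T' ∈ treesWithLeafSet n L |
            seqAll n (ThetaInv n T') < seqAll n (ThetaInv n T)}.ncard) ∧
        Set.MapsTo (unrankLeafSet n k L) (Set.Iio (treesWithLeafSet n L).ncard)
          (treesWithLeafSet n L) ∧
        Set.InvOn (unrankLeafSet n k L) (rankLeafSet n k) (treesWithLeafSet n L)
          (Set.Iio (treesWithLeafSet n L).ncard)) ∧
    -- complexity: fixed programs and a constant that do not depend on `n`, `k`, `L`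
    ∃ (rankP unrankP rankPL unrankPL : Program) (C : ℕ), ∀ n k : ℕ, 2 ≤ k → k + 1 ≤ n →
      ((∀ T ∈ treesWithLeafCount n k,
          Ranks rankP C n k (treesWithLeafCount n k).ncard (rankLeafCount n k) T) ∧
        ∀ r < (treesWithLeafCount n k).ncard,
          Unranks unrankP C n k (treesWithLeafCount n k).ncard (fun _ => 0)
            (unrankLeafCount n k) r) ∧
      ∀ L : Finset ℕ, L ⊆ Finset.Icc 1 n → L.card = k →
        (∀ T ∈ treesWithLeafSet n L,
          Ranks rankPL C n k (treesWithLeafSet n L).ncard (rankLeafSet n k) T) ∧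
        ∀ r < (treesWithLeafSet n L).ncard,
          Unranks unrankPL C n k (treesWithLeafSet n L).ncard (setArray L)
            (unrankLeafSet n k L) r := by

  -- The constant `150` bounds the numbers of small and of big operations in the texts of all four
  -- programs.
  refine ⟨fun n k hk2 hk => ⟨Theta_bijOn (by omega), ?_, fun L hL hc => ?_⟩,
    rankLeafCountCode.toProgram, unrankLeafCountCode.toProgram, rankLeafSetCode.toProgram,
    unrankLeafSetCode.toProgram, 150, fun n k hk2 hk => ⟨?_, fun L hL hc => ?_⟩⟩
  · have h := rankSystem_leafCount (n := n) (k := k) (by omega) hk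
    rw [h.ncard_eq]
    exact ⟨rfl, h.bijOn, fun T hT => h.eq_ncard hT, h.mem, h.invOn⟩
  · have h := rankSystem_leafSet (n := n) (k := k) (by omega) hk hL hc
    rw [h.ncard_eq]
    exact ⟨rfl, h.bijOn, fun T hT => h.eq_ncard hT, h.mem, h.invOn⟩
  · rw [(rankSystem_leafCount (n := n) (k := k) (by omega) hk).ncard_eq, mul_assoc]
    constructor
    · intro T hT
      exact ranks_of_wp (by omega) (by omega) (by decide) (by decide) (by decide) (by decide) hT.1
        (rankLeafCountCode_spec hk2 hk hT le_rfl)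
    · intro r hr
      exact unranks_of_wp (by omega) (by omega) (by decide) (by decide) (by decide) (by decide)
        hr.le (fun _ => Nat.zero_le n) (unrankLeafCountCode_spec hk2 hk le_rfl hr)
  · rw [(rankSystem_leafSet (n := n) (k := k) (by omega) hk hL hc).ncard_eq]
    constructor
    · intro T hT
      exact ranks_of_wp (by omega) (by omega) (by decide) (by decide) (by decide) (by decide) hT.1
        (rankLeafSetCode_spec hk2 hk (treesWithLeafSet_subset hc hT) le_rfl)
    · intro r hr
      exact unranks_of_wp (by omega) (by omega) (by decide) (by decide) (by decide) (by decide)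
        hr.le (setArray_le hL) (unrankLeafSetCode_spec hk2 hk hL hc le_rfl hr)
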